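/- Let $L_x,L_y$ be even, let $\Lambda$ be the $L_x\times L_y$ square lattice with periodic boundary conditions, $N=L_xL_y$, and let $t_{jk}=t_{kj}=\pm1$ be nearest-neighbour hopping amplitudes ($t_{jk}=0$ for all other pairs) with $\pi$ flux per plaquette, i.e. the product of the four amplitudes around every elementary plaquette is $-1$. Consider $$\mathcal H=-\sum_{\langle j,k\rangle}\left(t_{jk}\,c_j^\dagger c_k+\mathrm{H.c.}\right)$$ at chemical potential $\mu=0$, where the $c_j$ are annihilation operators either of hard-core bosons or of spinless fermions, and let $E_0^{\rm B}$, $E_0^{\rm F}$ be the corresponding grand-canonical ground-state energies, i.e. the smallest eigenvalues of $\mathcal H$ on the full Fock space (all particle numbers). 1. (Anderson bound for bosons.) Let $L_x,L_y\ge4$. For each plaquette $\alpha$ whose lower left corner has even coordinates, let $+_\alpha$ be the cross formed by $\alpha$ and its four adjacent plaquettes. There are $N/4$ such crosses, each has $12$ sites, and, for hard-core bosons, $$\mathcal H=\sum_\alpha h_\alpha,\qquad h_\alpha=-\tfrac12\sum_{\langle j,k\rangle\in +_\alpha}\left(t_{jk}\,c_j^\dagger c_k+\mathrm{H.c.}\right),$$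 where the last sum is over the links bounding the plaquettes of $+_\alpha$. If $\epsilon_0^\alpha$ is the ground-state energy of $h_\alpha$, then $E_0^{\rm B}\ge\sum_\alpha\epsilon_0^\alpha$; moreover $\epsilon_0^\alpha=-3.609035$ up to an error of at most $5\cdot10^{-7}$, and $$E_0^{\rm B}/N\ \ge\ -0.902259 .$$ 2. (Fermions.) As $L_x,L_y\to\infty$ through even integers, uniformly in the choice of the amplitudes $t$, $$E_0^{\rm F}/N\ \longrightarrow\ e^{\rm F}=-\frac1{4\pi^2}\int_0^{2\pi}\!\!\int_0^{2\pi}\sqrt{\cos^2x+\cos^2y}\;dy\,dx ,$$ and $e^{\rm F}=-0.958091$ up to an error of at most $5\cdot10^{-7}$. 3. (Inversion.) Consequently the bosons have strictly higher ground-state energy per site than the fermions in the thermodynamic limit: there are $\delta>0$ and $L_0$ such that $E_0^{\rm B}/N\ge E_0^{\rm F}/N+\delta$ for all even $L_x,L_y\ge L_0$ and every such choice of $t$. -/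

import Mathlib

open scoped BigOperators Matrix

noncomputable section

namespace PiFlux

/-! ## Fock space, hard-core bosons and spinless fermions

For a finite set `V` of sites the occupation-number basis is indexed by `Finset V` (the set of
occupied sites), both for hard-core bosons and for spinless fermions.  Operators on the Fock space
`Finset V → ℂ` are matrices in this basis. -/

section Fock

variable {V : Type} [Fintype V] [DecidableEq V]

/-- Hard-core boson annihilation operator `b_j`: it removes the particle at `j` if there is one,
and is zero on states in which `j` is empty. -/
def bosonAnn (j : V) : Matrix (Finset V) (Finset V) ℂ :=
  fun T S => if j ∈ S ∧ T = S.erase j then 1 else 0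

/-- Number of particles of the configuration `S` that precede the site `j` in a fixed
enumeration of the sites. -/
def precede (S : Finset V) (j : V) : ℕ :=
  (S.filter fun i => Fintype.equivFin V i < Fintype.equivFin V j).card

/-- Fermion annihilation operator `f_j`: it removes the particle at `j` if there is one, with the
fermionic sign `(-1) ^ #(particles preceding j)`. -/
def fermionAnn (j : V) : Matrix (Finset V) (Finset V) ℂ :=
  fun T S => if j ∈ S ∧ T = S.erase j then (-1) ^ precede S j else 0

/-- The tight-binding Hamiltonian `-∑_{⟨j,k⟩} (t_{jk} c_j† c_k + H.c.) - μ ∑_j c_j† c_j`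
for annihilation operators `c` and a real symmetric hopping matrix `t` with zero diagonal.
The sum runs over ordered pairs, so every bond contributes `t_{jk} (c_j† c_k + c_k† c_j)`. -/
def hamiltonian (c : V → Matrix (Finset V) (Finset V) ℂ) (t : V → V → ℝ) (μ : ℝ) :
    Matrix (Finset V) (Finset V) ℂ :=
  -(∑ j, ∑ k, (t j k : ℂ) • ((c j)ᴴ * c k)) - (μ : ℂ) • ∑ j, (c j)ᴴ * c j

/-- The Hamiltonian of hard-core bosons. -/
def bosonHamiltonian (t : V → V → ℝ) (μ : ℝ) : Matrix (Finset V) (Finset V) ℂ :=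
  hamiltonian bosonAnn t μ

/-- The Hamiltonian of free spinless fermions. -/
def fermionHamiltonian (t : V → V → ℝ) (μ : ℝ) : Matrix (Finset V) (Finset V) ℂ :=
  hamiltonian fermionAnn t μ

set_option linter.unusedSectionVars false in
theorem hamiltonian_isHermitian (c : V → Matrix (Finset V) (Finset V) ℂ) (t : V → V → ℝ)
    (ht : ∀ j k, t j k = t k j) (μ : ℝ) : (hamiltonian c t μ).IsHermitian := by
  unfold hamiltonian Matrix.IsHermitian
  simp only [Matrix.conjTranspose_sub, Matrix.conjTranspose_neg, Matrix.conjTranspose_sum,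
    Matrix.conjTranspose_smul, Matrix.conjTranspose_mul, Matrix.conjTranspose_conjTranspose,
    RCLike.star_def, Complex.conj_ofReal]
  rw [Finset.sum_comm]
  simp only [ht]

end Fock

/-- Ground-state energy: the smallest (real) eigenvalue of a Hermitian matrix.  On the full Fock
space this is the grand-canonical ground-state energy. -/
def groundEnergy {n : Type} [Fintype n] [DecidableEq n] (H : Matrix n n ℂ) : ℝ :=
  sInf {E : ℝ | Module.End.HasEigenvalue (Matrix.toLin' H) (E : ℂ)}

/-- For a Hermitian matrix the infimum in `groundEnergy` is a minimum. -/
theorem groundEnergy_isLeast {n : Type} [Fintype n] [DecidableEq n] [Nonempty n]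
    {H : Matrix n n ℂ} (hH : H.IsHermitian) :
    IsLeast {E : ℝ | Module.End.HasEigenvalue (Matrix.toLin' H) (E : ℂ)} (groundEnergy H) := by
  have hS : {E : ℝ | Module.End.HasEigenvalue (Matrix.toLin' H) (E : ℂ)}
      = Set.range hH.eigenvalues := by
    rw [← hH.spectrum_real_eq_range_eigenvalues]
    ext E
    rw [Set.mem_ofPred_eq, Module.End.hasEigenvalue_iff_mem_spectrum, Matrix.spectrum_toLin']
    exact spectrum.algebraMap_mem_iff (R := ℝ) ℂ (a := H)
  have hfin : (Set.range hH.eigenvalues).Finite := Set.finite_range _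
  have hne : (Set.range hH.eigenvalues).Nonempty := Set.range_nonempty _
  unfold groundEnergy
  rw [hS]
  exact ⟨hne.csInf_mem hfin, fun _ hx => csInf_le hfin.bddBelow hx⟩

/-! ## The square lattice with `π` flux per plaquette, and its cross-shaped clusters -/

/-- Sites of the `Lx × Ly` square lattice with periodic boundary conditions. -/
abbrev Site (Lx Ly : ℕ) : Type := ZMod Lx × ZMod Ly

section Torus

variable {Lx Ly : ℕ}

/-- Unit translation in the `x` direction. -/
def ex : Site Lx Ly := (1, 0)

/-- Unit translation in the `y` direction. -/
def ey : Site Lx Ly := (0, 1)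

/-- `j` and `k` are nearest neighbours. -/
def IsNeighbour (j k : Site Lx Ly) : Prop :=
  k = j + ex ∨ k = j - ex ∨ k = j + ey ∨ k = j - ey

/-- `t` is a choice of real nearest-neighbour hopping amplitudes `±1` with flux `π` through each
elementary plaquette: the product of the amplitudes around each plaquette is `-1 = exp (i π)`. -/
structure IsPiFlux (t : Site Lx Ly → Site Lx Ly → ℝ) : Prop where
  symm : ∀ j k, t j k = t k j
  bond : ∀ j k, IsNeighbour j k → t j k = 1 ∨ t j k = -1
  nonbond : ∀ j k, ¬ IsNeighbour j k → t j k = 0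
  flux : ∀ s, t s (s + ex) * t (s + ex) (s + ex + ey) * t (s + ex + ey) (s + ey) * t (s + ey) s = -1

/-- The elementary plaquette with lower left corner `p`. -/
def plaquette (p : Site Lx Ly) : Finset (Site Lx Ly) := {p, p + ex, p + ey, p + ex + ey}

/-- The five plaquettes of the cross: the central plaquette `a` and the four adjacent to it. -/
def crossPlaquettes (a : Site Lx Ly) : Finset (Site Lx Ly) := {a, a + ex, a - ex, a + ey, a - ey}

/-- The sites of the cross-shaped cluster with central plaquette `a`. -/
def crossSites (a : Site Lx Ly) : Finset (Site Lx Ly) := (crossPlaquettes a).biUnion plaquette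

open Classical in
/-- The hopping amplitudes of the cluster Hamiltonian `h_a`: one half of `t` on the links of the
cross, i.e. on the links that bound one of its five plaquettes, and zero elsewhere. -/
def crossHopping (t : Site Lx Ly → Site Lx Ly → ℝ) (a j k : Site Lx Ly) : ℝ :=
  if ∃ p ∈ crossPlaquettes a, j ∈ plaquette p ∧ k ∈ plaquette p then t j k / 2 else 0

/-- The centres of the clusters: the plaquettes whose lower left corner has even coordinates. -/
def centres (Lx Ly : ℕ) [NeZero Lx] [NeZero Ly] : Finset (Site Lx Ly) :=
  Finset.univ.filter fun a => Even a.1.val ∧ Even a.2.val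

end Torus

/-- Ground-state energy of the hard-core bosons at chemical potential `μ = 0`. -/
def bosonEnergy {Lx Ly : ℕ} [NeZero Lx] [NeZero Ly] (t : Site Lx Ly → Site Lx Ly → ℝ) : ℝ :=
  groundEnergy (bosonHamiltonian t 0)

/-- Ground-state energy of the free fermions at chemical potential `μ = 0`. -/
def fermionEnergy {Lx Ly : ℕ} [NeZero Lx] [NeZero Ly] (t : Site Lx Ly → Site Lx Ly → ℝ) : ℝ :=
  groundEnergy (fermionHamiltonian t 0)

/-- Hamiltonian of hard-core bosons on the cross-shaped cluster with central plaquette `a`. -/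
def crossHamiltonian {Lx Ly : ℕ} [NeZero Lx] [NeZero Ly] (t : Site Lx Ly → Site Lx Ly → ℝ)
    (a : Site Lx Ly) : Matrix (Finset (Site Lx Ly)) (Finset (Site Lx Ly)) ℂ :=
  bosonHamiltonian (crossHopping t a) 0

/-- The fermion ground-state energy per site in the thermodynamic limit: the negative band of
`ε(k) = ± 2 √(cos² k_x + cos² k_y)` is filled; there are two bands for `N` one-particle states,
whence the value `-(1/2) · (mean of 2 √(cos² k_x + cos² k_y))`. -/
def fermionLimit : ℝ :=
  -(1 / (4 * Real.pi ^ 2)) * ∫ x in (0 : ℝ)..(2 * Real.pi), ∫ y in (0 : ℝ)..(2 * Real.pi),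
    Real.sqrt (Real.cos x ^ 2 + Real.cos y ^ 2)

end PiFlux

end

/-! Bosons. Each link of the torus lies in exactly two crosses whose centres have even coordinates,
so with halved amplitudes the cross Hamiltonians add up to the full one. The global ground state is
then a trial state for every cross, which is Anderson's bound (`sum_groundEnergy_le`). A cross is a
simply connected patch of five plaquettes, so all sign choices of flux π on it are gauge equivalent
(`exists_gauge`), and each `h_α` is equivalent to minus one half of a single hopping operator M on
the Fock space of 12 sites. What remains is to enclose the largest eigenvalue of M between 7.218069
and 7.218071.

From above (`cross_eigen_sq_lt`): M changes the parity of the particle number on one sublattice, so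
a nonzero eigenvalue E of M yields an eigenvector of M² with eigenvalue E² among the states of even
parity. Particle number, particle-hole exchange and a quarter turn of the cross reduce the question
to at most six particles, and for six to particle-hole symmetric states. On such a space let P be
the Chebyshev polynomial of M² scaled to the interval [0, 48]. The trace of P² is at least P(E²)²,
and P increases beyond 48, so a numerical bound on the trace excludes E² ≥ 52.10054. The trace is an
exact integer. All start vectors are packed as digits, in a large base B, of one integer-valued
vector; the operator acts on binary tries modulo a power of B; an a priori sup-norm bound ensures
that the digits can be read off afterwards.

From below (`exists_cross_trial`): an explicit integer vector w of even parity satisfies ‖Mw‖ ≥ l‖w‖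
with l = 7.218069, and Mw + lw is a trial state with Rayleigh quotient at least l.

Fermions. The energy is minus half the sum of the absolute values of the eigenvalues of the hopping
matrix (`groundEnergy_fermionHamiltonian`). That matrix is X + X⁻¹ + Y + Y⁻¹ with unit steps X and Y
that anticommute because of the flux. Its square is therefore a sum of two commuting squares, and
each even moment shorter than the torus equals that of 4cos²x + 4cos²y, whatever the gauge or the
boundary phases (`sum_eigenvalues_sq_pow`, `torusMean_bandSq_pow`). Weierstrass approximation of the
square root on [0, 16] gives the limit, uniformly in t.

For the value, 4cos²x + 4cos²y = 4(1 + w) with w = (cos 2x + cos 2y)/2, and the binomial series of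
√(1 + w) is integrated term by term (`hasSum_bandCoeff`). Two telescoping estimates of the remainder
enclose the sum. The inversion is the comparison of the two numbers, which differ by more than
0.055. -/

noncomputable section

namespace PiFlux

/-! ## Sparse vectors on bit strings, evaluated by the kernel -/

/-- Sparse functions `List Bool → ℕ`, stored as binary tries. -/
inductive Trie where
  | nil : Trie
  | node (v : ℕ) (l r : Trie) : Trie

namespace Trie

/-- The value of a trie at a bit string. -/
def get : Trie → List Bool → ℕ
  | nil, _ => 0
  | node v _ _, [] => v
  | node _ l r, b :: s => get (cond b r l) s

@[simp] theorem get_nil (s : List Bool) : nil.get s = 0 := by cases s <;> rfl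
@[simp] theorem get_node_nil (v : ℕ) (l r : Trie) : (node v l r).get [] = v := rfl
@[simp] theorem get_node_cons (v : ℕ) (l r : Trie) (b : Bool) (s : List Bool) :
    (node v l r).get (b :: s) = cond b (r.get s) (l.get s) := by cases b <;> rfl

/-- `node 0 l r`, pruned if both branches are empty. -/
def mk (l r : Trie) : Trie :=
  -- This and the following operations are given by bare recursors, so that the kernel unfolds them
  -- by iota reduction alone.
  @Trie.rec (fun _ => Trie) (@Trie.rec (fun _ => Trie) nil (fun v a b _ _ => node 0 nil (node v a b)) r)
    (fun v a b _ _ => node 0 (node v a b) r) l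

@[simp] theorem get_mk_nil (l r : Trie) : (mk l r).get [] = 0 := by cases l <;> cases r <;> rfl
@[simp] theorem get_mk_cons (l r : Trie) (b : Bool) (s : List Bool) :
    (mk l r).get (b :: s) = cond b (r.get s) (l.get s) := by
  cases l <;> cases r <;> cases b <;> simp [mk]

/-- Occupy position `j`. -/
def cre (j : ℕ) : Trie → Trie :=
  @Nat.rec (fun _ => Trie → Trie)
    (fun t => @Trie.rec (fun _ => Trie) nil (fun _ l _ _ _ => mk nil l) t)
    (fun _ ih t => @Trie.rec (fun _ => Trie) nil (fun _ l r _ _ => mk (ih l) (ih r)) t) j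

/-- Empty position `j`. -/
def ann (j : ℕ) : Trie → Trie :=
  @Nat.rec (fun _ => Trie → Trie)
    (fun t => @Trie.rec (fun _ => Trie) nil (fun _ _ r _ _ => mk r nil) t)
    (fun _ ih t => @Trie.rec (fun _ => Trie) nil (fun _ l r _ _ => mk (ih l) (ih r)) t) j

/-- Pointwise sum. -/
def add (s : Trie) : Trie → Trie :=
  @Trie.rec (fun _ => Trie → Trie) (fun t => t)
    (fun v l r il ir t => @Trie.rec (fun _ => Trie) (node v l r)
      (fun v' l' r' _ _ => node (Nat.add v v') (il l') (ir r')) t) s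

theorem get_add (s t : Trie) (x : List Bool) : (add s t).get x = s.get x + t.get x := by
  induction s generalizing t x with
  | nil => simp [add]
  | node v l r il ir =>
    cases t with
    | nil => simp [add]
    | node v' l' r' =>
      change (node (v + v') (add l l') (add r r')).get x = _
      cases x with
      | nil => simp
      | cons b x => cases b <;> simp [il, ir]

/-- Evaluate a natural number before it is passed on. -/
def forceNat {α : Type} (v : ℕ) (f : ℕ → α) : α :=
  -- Matching on `v` makes the kernel compute it before `f` receives it; otherwise an unevaluated
  -- expression would be copied.
  @Nat.rec (fun _ => α) (f 0) (fun m _ => f (Nat.succ m)) v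

theorem forceNat_eq {α : Type} (v : ℕ) (f : ℕ → α) : forceNat v f = f v := by cases v <;> rfl

/-- Multiplication by `k`, modulo `Q`. -/
def scale (Q k : ℕ) (t : Trie) : Trie :=
  @Trie.rec (fun _ => Trie) nil
    (fun v _ _ il ir => forceNat (Nat.mod (Nat.mul k v) Q) fun w => node w il ir) t

theorem get_scale (Q k : ℕ) (t : Trie) (x : List Bool) :
    (scale Q k t).get x = k * t.get x % Q := by
  induction t generalizing x with
  | nil => simp [scale]
  | node v l r il ir =>
    have : scale Q k (node v l r) = node (k * v % Q) (scale Q k l) (scale Q k r) :=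
      forceNat_eq (k * v % Q) fun w => node w (scale Q k l) (scale Q k r)
    rw [this]
    cases x with
    | nil => simp
    | cons b x => cases b <;> simp [il, ir]

/-- Evaluate a trie completely before it is passed on. -/
def force {α : Type} (t : Trie) : (Trie → α) → α :=
  @Trie.rec (fun _ => (Trie → α) → α) (fun f => f nil) (fun v _ _ il ir f =>
    forceNat v fun v' => il fun l' => ir fun r' => f (node v' l' r')) t

theorem force_eq {α : Type} (t : Trie) (f : Trie → α) : force t f = f t := by
  induction t generalizing f with
  | nil => rfl
  | node v l r il ir =>
    change forceNat v (fun v' => force l fun l' => force r fun r' => f (node v' l' r')) = _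
    rw [forceNat_eq, il, ir]

/-- The sum of the signed images of `t` under the operators `op j`, over a list of signed bonds. -/
def fan (Q : ℕ) (op : ℕ → Trie → Trie) (a : List (ℕ × Bool)) (t : Trie) : Trie :=
  @List.rec _ (fun _ => Trie) nil
    -- Amplitudes are natural numbers, so a negative bond is multiplication by `Q - 1`, which is -1
    -- modulo `Q`.
    (fun p _ ih => add (@Bool.rec (fun _ => Trie) (scale Q (Nat.sub Q 1) (op p.1 t)) (op p.1 t) p.2) ih) a

/-- The hopping operator of a signed graph. The `i`-th list contains the pairs `(j, e)` of bonds
between the positions `i` and `i + j + 1` with sign `e`. -/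
def ham (Q : ℕ) (as : List (List (ℕ × Bool))) : Trie → Trie :=
  @List.rec _ (fun _ => Trie → Trie) (fun _ => nil)
   (fun a _ ih t => @Trie.rec (fun _ => Trie) nil
     (fun _ l r _ _ => mk (add (ih l) (fan Q cre a r)) (add (ih r) (fan Q ann a l))) t) as

/-- The function with value `v` at `s` and `0` elsewhere. -/
def single (v : ℕ) (s : List Bool) : Trie :=
  @List.rec _ (fun _ => Trie) (node v nil nil)
    (fun b _ ih => @Bool.rec (fun _ => Trie) (node 0 ih nil) (node 0 nil ih) b) s

theorem get_single (v : ℕ) (s x : List Bool) : (single v s).get x = if x = s then v else 0 := by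
  induction s generalizing x with
  | nil => cases x <;> simp [single]
  | cons b s ih =>
    have : single v (b :: s) = cond b (node 0 nil (single v s)) (node 0 (single v s) nil) := by
      cases b <;> rfl
    rw [this]
    cases x with
    | nil => cases b <;> simp
    | cons c x => cases b <;> cases c <;> simp [ih]

end Trie

/-! ### The hopping operator on functions of bit strings -/

section HamF
variable {R : Type*} [CommRing R]

/-- Occupying position `j`, on functions of bit strings. -/
def creF : ℕ → (List Bool → R) → List Bool → R
  | _, _, [] => 0
  | 0, f, b :: s => cond b (f (false :: s)) 0
  | j + 1, f, b :: s => creF j (fun s => f (b :: s)) s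

/-- Emptying position `j`, on functions of bit strings. -/
def annF : ℕ → (List Bool → R) → List Bool → R
  | _, _, [] => 0
  | 0, f, b :: s => cond b 0 (f (true :: s))
  | j + 1, f, b :: s => annF j (fun s => f (b :: s)) s

/-- The signed sum of the operators `op j` over a list of signed bonds. -/
def fanF (op : ℕ → (List Bool → R) → List Bool → R) :
    List (ℕ × Bool) → (List Bool → R) → List Bool → R
  | [], _, _ => 0
  | p :: a, f, s => cond p.2 (op p.1 f s) (-op p.1 f s) + fanF op a f s

/-- The hopping operator of a signed graph, on functions of bit strings. -/
def hamF : List (List (ℕ × Bool)) → (List Bool → R) → List Bool → R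
  | [], _, _ => 0
  | _ :: _, _, [] => 0
  | a :: as, f, b :: s => hamF as (fun s => f (b :: s)) s +
      cond b (fanF annF a (fun s => f (false :: s)) s) (fanF creF a (fun s => f (true :: s)) s)

@[simp] theorem creF_nil (j : ℕ) (f : List Bool → R) : creF j f [] = 0 := by cases j <;> rfl
@[simp] theorem annF_nil (j : ℕ) (f : List Bool → R) : annF j f [] = 0 := by cases j <;> rfl
@[simp] theorem hamF_nil (a : List (List (ℕ × Bool))) (f : List Bool → R) : hamF a f [] = 0 := by
  cases a <;> rfl

theorem creF_add (j : ℕ) (f g : List Bool → R) : creF j (f + g) = creF j f + creF j g := by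
  funext s
  induction s generalizing j f g with
  | nil => simp
  | cons b s ih =>
    cases j with
    | zero => cases b <;> simp [creF]
    | succ j => exact ih j _ _

theorem annF_add (j : ℕ) (f g : List Bool → R) : annF j (f + g) = annF j f + annF j g := by
  funext s
  induction s generalizing j f g with
  | nil => simp
  | cons b s ih =>
    cases j with
    | zero => cases b <;> simp [annF]
    | succ j => exact ih j _ _

theorem fanF_add {op : ℕ → (List Bool → R) → List Bool → R}
    (hop : ∀ j f g, op j (f + g) = op j f + op j g) (a : List (ℕ × Bool)) (f g : List Bool → R) :
    fanF op a (f + g) = fanF op a f + fanF op a g := by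
  funext s
  induction a with
  | nil => simp [fanF]
  | cons p a ih =>
    simp only [fanF, ih, hop, Pi.add_apply]
    cases p.2 <;> simp <;> ring

theorem hamF_add (as : List (List (ℕ × Bool))) (f g : List Bool → R) :
    hamF as (f + g) = hamF as f + hamF as g := by
  funext s
  induction as generalizing f g s with
  | nil => simp [hamF]
  | cons a as ih =>
    cases s with
    | nil => simp
    | cons b s =>
      have h1 := ih (fun s => f (b :: s)) (fun s => g (b :: s)) s
      have h2 := congrFun (fanF_add annF_add a (fun s => f (false :: s)) (fun s => g (false :: s))) s
      have h3 := congrFun (fanF_add creF_add a (fun s => f (true :: s)) (fun s => g (true :: s))) s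
      change hamF as ((fun s => f (b :: s)) + fun s => g (b :: s)) s +
        cond b (fanF annF a ((fun s => f (false :: s)) + fun s => g (false :: s)) s)
          (fanF creF a ((fun s => f (true :: s)) + fun s => g (true :: s)) s) = _
      rw [h1, h2, h3]
      cases b <;> simp [hamF] <;> ring

variable {S : Type*} [CommRing S]

theorem creF_map {φ : R → S} (h0 : φ 0 = 0) (j : ℕ) (f : List Bool → R) (s : List Bool) :
    φ (creF j f s) = creF j (fun s => φ (f s)) s := by
  induction s generalizing j f with
  | nil => simp [h0]
  | cons b s ih =>
    cases j with
    | zero => cases b <;> simp [creF, h0]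
    | succ j => exact ih j _

theorem annF_map {φ : R → S} (h0 : φ 0 = 0) (j : ℕ) (f : List Bool → R) (s : List Bool) :
    φ (annF j f s) = annF j (fun s => φ (f s)) s := by
  induction s generalizing j f with
  | nil => simp [h0]
  | cons b s ih =>
    cases j with
    | zero => cases b <;> simp [annF, h0]
    | succ j => exact ih j _

/-- All coefficients of the operator are 0 or ±1, so every additive map commutes with it. This
serves both for scalar multiples and for reduction modulo `Q`. -/
theorem hamF_map (φ : R →+ S) (as : List (List (ℕ × Bool))) (f : List Bool → R) (s : List Bool) :
    φ (hamF as f s) = hamF as (fun s => φ (f s)) s := by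
  have hfc : ∀ (a : List (ℕ × Bool)) (f : List Bool → R) s,
      φ (fanF creF a f s) = fanF creF a (fun s => φ (f s)) s := by
    intro a f s
    induction a with
    | nil => simp [fanF]
    | cons p a ih => rw [fanF, fanF, map_add, ih, ← creF_map φ.map_zero]; cases p.2 <;> simp
  have hfa : ∀ (a : List (ℕ × Bool)) (f : List Bool → R) s,
      φ (fanF annF a f s) = fanF annF a (fun s => φ (f s)) s := by
    intro a f s
    induction a with
    | nil => simp [fanF]
    | cons p a ih => rw [fanF, fanF, map_add, ih, ← annF_map φ.map_zero]; cases p.2 <;> simp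
  induction as generalizing f s with
  | nil => simp [hamF]
  | cons a as ih =>
    cases s with
    | nil => simp
    | cons b s => cases b <;> simp [hamF, ih, hfc, hfa]

theorem hamF_smul (as : List (List (ℕ × Bool))) (c : R) (f : List Bool → R) :
    hamF as (c • f) = c • hamF as f := by
  funext s
  exact (hamF_map (AddMonoidHom.mulLeft c) as f s).symm

/-- `hamF` as a linear map. -/
def hamL (R : Type*) [CommRing R] (as : List (List (ℕ × Bool))) :
    Module.End R (List Bool → R) where
  toFun := hamF as
  map_add' := hamF_add as
  map_smul' := hamF_smul as

theorem abs_creF_le {C : ℤ} (j : ℕ) (f : List Bool → ℤ) (hf : ∀ s, |f s| ≤ C) (s : List Bool) :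
    |creF j f s| ≤ C := by
  have hC : 0 ≤ C := (abs_nonneg _).trans (hf [])
  induction s generalizing j f with
  | nil => simpa
  | cons b s ih =>
    cases j with
    | zero => cases b <;> simp [creF, hC, hf]
    | succ j => exact ih j _ fun s => hf _

theorem abs_annF_le {C : ℤ} (j : ℕ) (f : List Bool → ℤ) (hf : ∀ s, |f s| ≤ C) (s : List Bool) :
    |annF j f s| ≤ C := by
  have hC : 0 ≤ C := (abs_nonneg _).trans (hf [])
  induction s generalizing j f with
  | nil => simpa
  | cons b s ih =>
    cases j with
    | zero => cases b <;> simp [annF, hC, hf]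
    | succ j => exact ih j _ fun s => hf _

theorem abs_fanF_le {op : ℕ → (List Bool → ℤ) → List Bool → ℤ} {C : ℤ} {f : List Bool → ℤ}
    (hop : ∀ j s, |op j f s| ≤ C) (a : List (ℕ × Bool)) (s : List Bool) :
    |fanF op a f s| ≤ a.length * C := by
  induction a with
  | nil => simp [fanF]
  | cons p a ih =>
    have h : |cond p.2 (op p.1 f s) (-op p.1 f s)| ≤ C := by
      cases p.2 <;> simp [hop]
    rw [fanF, List.length_cons]
    push_cast
    linarith [abs_add_le (cond p.2 (op p.1 f s) (-op p.1 f s)) (fanF op a f s)]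

/-- The number of bonds. -/
def bondCount (as : List (List (ℕ × Bool))) : ℤ := (as.map fun a => (a.length : ℤ)).sum

/-- At a fixed configuration each bond contributes at most one amplitude of `f`, up to sign. -/
theorem abs_hamF_le {C : ℤ} (as : List (List (ℕ × Bool))) (f : List Bool → ℤ)
    (hf : ∀ s, |f s| ≤ C) (s : List Bool) : |hamF as f s| ≤ bondCount as * C := by
  have hC : 0 ≤ C := (abs_nonneg _).trans (hf [])
  have hb : ∀ as, 0 ≤ bondCount as := fun as => by
    unfold bondCount
    exact List.sum_nonneg (by simp)
  induction as generalizing f s with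
  | nil => simp [hamF, bondCount]
  | cons a as ih =>
    cases s with
    | nil => simpa using mul_nonneg (hb (a :: as)) hC
    | cons b s =>
      have h1 := ih (fun s => f (b :: s)) (fun s => hf _) s
      have h2 : |cond b (fanF annF a (fun s => f (false :: s)) s)
          (fanF creF a (fun s => f (true :: s)) s)| ≤ a.length * C := by
        cases b
        · exact abs_fanF_le (fun j s => abs_creF_le j _ (fun s => hf _) s) a s
        · exact abs_fanF_le (fun j s => abs_annF_le j _ (fun s => hf _) s) a s
      have h3 : bondCount (a :: as) = a.length + bondCount as := by simp [bondCount]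
      rw [hamF, h3, add_mul]
      exact (abs_add_le _ _).trans (by linarith)

end HamF

/-! ### Correctness of the trie operators modulo `Q` -/

namespace Trie

/-- The residues of the values of a trie. -/
def ev (Q : ℕ) (t : Trie) (s : List Bool) : ZMod Q := t.get s

variable {Q : ℕ}

theorem ev_nil : ev Q nil = 0 := by funext s; simp [ev]

theorem ev_add (s t : Trie) : ev Q (add s t) = ev Q s + ev Q t := by
  funext x; simp [ev, get_add]

theorem ev_scale (k : ℕ) (t : Trie) : ev Q (scale Q k t) = (k : ZMod Q) • ev Q t := by
  funext x; simp [ev, get_scale]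

theorem ev_cre (j : ℕ) (t : Trie) (s : List Bool) : ev Q (cre j t) s = creF j (ev Q t) s := by
  induction j generalizing t s with
  | zero =>
    cases t with
    | nil => cases s <;> simp [ev, cre, creF]
    | node v l r =>
      change ev Q (mk nil l) s = _
      cases s with
      | nil => simp [ev]
      | cons b s => cases b <;> simp [ev, creF]
  | succ j ih =>
    cases t with
    | nil =>
      rw [show cre (j + 1) nil = nil from rfl, ev_nil]
      exact creF_map (φ := fun _ : ZMod Q => (0 : ZMod Q)) rfl _ 0 s
    | node v l r =>
      change ev Q (mk (cre j l) (cre j r)) s = _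
      cases s with
      | nil => simp [ev]
      | cons b s =>
        cases b
        · exact (congrArg Nat.cast (get_mk_cons _ _ _ _)).trans (ih l s)
        · exact (congrArg Nat.cast (get_mk_cons _ _ _ _)).trans (ih r s)

theorem ev_ann (j : ℕ) (t : Trie) (s : List Bool) : ev Q (ann j t) s = annF j (ev Q t) s := by
  induction j generalizing t s with
  | zero =>
    cases t with
    | nil => cases s <;> simp [ev, ann, annF]
    | node v l r =>
      change ev Q (mk r nil) s = _
      cases s with
      | nil => simp [ev]
      | cons b s => cases b <;> simp [ev, annF]
  | succ j ih =>
    cases t with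
    | nil =>
      rw [show ann (j + 1) nil = nil from rfl, ev_nil]
      exact annF_map (φ := fun _ : ZMod Q => (0 : ZMod Q)) rfl _ 0 s
    | node v l r =>
      change ev Q (mk (ann j l) (ann j r)) s = _
      cases s with
      | nil => simp [ev]
      | cons b s =>
        cases b
        · exact (congrArg Nat.cast (get_mk_cons _ _ _ _)).trans (ih l s)
        · exact (congrArg Nat.cast (get_mk_cons _ _ _ _)).trans (ih r s)

theorem ev_fan (hQ : 1 ≤ Q) {op : ℕ → Trie → Trie}
    {opF : ℕ → (List Bool → ZMod Q) → List Bool → ZMod Q}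
    (h : ∀ j t s, ev Q (op j t) s = opF j (ev Q t) s) (a : List (ℕ × Bool)) (t : Trie)
    (s : List Bool) : ev Q (fan Q op a t) s = fanF opF a (ev Q t) s := by
  induction a with
  | nil => simp [fan, fanF, ev_nil]
  | cons p a ih =>
    have : fan Q op (p :: a) t =
        add (cond p.2 (op p.1 t) (scale Q (Q - 1) (op p.1 t))) (fan Q op a t) := by
      change add (@Bool.rec (fun _ => Trie) _ _ p.2) _ = _
      cases p.2 <;> rfl
    rw [this, ev_add, Pi.add_apply, ih, fanF]
    cases p.2 <;> simp [ev_scale, h, Nat.cast_sub hQ]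

/-- Only residues are compared, because signs are encoded as `Q - 1` and sums are not reduced. The
pruned trie `nil` needs its own case, settled by linearity. -/
theorem ev_ham (hQ : 1 ≤ Q) (as : List (List (ℕ × Bool))) (t : Trie) :
    ev Q (ham Q as t) = hamL (ZMod Q) as (ev Q t) := by
  funext s
  change _ = hamF as (ev Q t) s
  induction as generalizing t s with
  | nil => simp [ham, hamF, ev_nil]
  | cons a as ih =>
    cases t with
    | nil =>
      rw [show ham Q (a :: as) nil = nil from rfl, ev_nil]
      exact (congrFun (hamL (ZMod Q) (a :: as)).map_zero s).symm
    | node v l r =>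
      change ev Q (mk (add (ham Q as l) (fan Q cre a r)) (add (ham Q as r) (fan Q ann a l))) s = _
      cases s with
      | nil => simp [ev]
      | cons b s =>
        have h1 := ih l s
        have h2 := ih r s
        have h3 := ev_fan hQ (ev_cre (Q := Q)) a r s
        have h4 := ev_fan hQ (ev_ann (Q := Q)) a l s
        cases b
        · change ev Q (mk _ _) (false :: s) = hamF as (ev Q l) s + fanF creF a (ev Q r) s
          rw [← h1, ← h3]; simp [ev, get_add]
        · change ev Q (mk _ _) (true :: s) = hamF as (ev Q r) s + fanF annF a (ev Q l) s
          rw [← h2, ← h4]; simp [ev, get_add]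

end Trie

/-! ### Chebyshev polynomials of the squared operator -/

section Cheb

/-- Chebyshev polynomials of `A² - c`, rescaled so that the interval `[0, 2 c]` of values of `A²`
corresponds to `[-1, 1]`: these are `c ^ k * T_k ((A² - c) / c)`. -/
def cheb {R V : Type*} [CommRing R] [AddCommGroup V] [Module R V] (A : Module.End R V) (c : R) :
    ℕ → Module.End R V
  | 0 => 1
  | 1 => A * A - c • 1
  | k + 2 => (2 : R) • (A * A * cheb A c (k + 1)) - (2 * c) • cheb A c (k + 1) -
      (c * c) • cheb A c k

/-- The scalar polynomials corresponding to `cheb`, in terms of `x = A²`. -/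
def chebS {R : Type*} [CommRing R] (x c : R) : ℕ → R
  | 0 => 1
  | 1 => x - c
  | k + 2 => 2 * (x * chebS x c (k + 1)) - 2 * c * chebS x c (k + 1) - c * c * chebS x c k

/-- Only the square of `A` enters the polynomial, so `v` need not be an eigenvector of `A` itself.
This permits projecting to a parity sector that `A` does not preserve. -/
theorem cheb_apply_of_sq {R V : Type*} [CommRing R] [AddCommGroup V] [Module R V]
    {A : Module.End R V} {x : R} {v : V} (h : A (A v) = x • v) (c : R) (k : ℕ) :
    cheb A c k v = chebS x c k • v := by
  induction k using Nat.strong_induction_on with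
  | _ k ih =>
    match k with
    | 0 => simp [cheb, chebS]
    | 1 => simp [cheb, chebS, h, sub_smul]
    | k + 2 =>
      simp only [cheb, chebS, LinearMap.sub_apply, LinearMap.smul_apply, Module.End.mul_apply,
        ih k (by omega), ih (k + 1) (by omega), map_smul, h]
      module

/-- The two scalar rings may differ: the lemma covers reduction modulo `Q` as well as the passage
from integer functions of bit strings to real functions of configurations. -/
theorem cheb_intertwine {R S V W : Type*} [CommRing R] [CommRing S] [AddCommGroup V]
    [AddCommGroup W] [Module R V] [Module S W] {A : Module.End R V} {A' : Module.End S W}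
    (φ : V →+ W) {c : R} {c' : S} (hA : ∀ v, φ (A v) = A' (φ v))
    (h2 : ∀ v, φ ((2 : R) • v) = (2 : S) • φ v)
    (hc : ∀ v, φ (c • v) = c' • φ v) (k : ℕ) (v : V) :
    φ (cheb A c k v) = cheb A' c' k (φ v) := by
  induction k using Nat.strong_induction_on with
  | _ k ih =>
    match k with
    | 0 => simp [cheb]
    | 1 => simp [cheb, hA, hc]
    | k + 2 =>
      simp only [cheb, LinearMap.sub_apply, LinearMap.smul_apply, Module.End.mul_apply, mul_smul,
        map_sub, h2, hc, hA, ih k (by omega), ih (k + 1) (by omega)]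

/-- In the sup norm the squared operator is bounded by the squared number of bonds, so one step of
the recursion costs at most this factor. For the 16 bonds of the cross and c = 24 it equals 2·16² +
3·24 = 584, the number in the digit bounds below. -/
theorem abs_cheb_hamL_le (as : List (List (ℕ × Bool))) {c : ℤ} (hc : 0 ≤ c) {C : ℤ}
    {f : List Bool → ℤ} (hf : ∀ s, |f s| ≤ C) (k : ℕ) (s : List Bool) :
    |cheb (hamL ℤ as) c k f s| ≤ (2 * bondCount as ^ 2 + 3 * c) ^ k * C := by
  have hC : 0 ≤ C := (abs_nonneg _).trans (hf [])
  have hA : ∀ (D : ℤ) (g : List Bool → ℤ), (∀ s, |g s| ≤ D) →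
      ∀ s, |hamL ℤ as (hamL ℤ as g) s| ≤ bondCount as ^ 2 * D := by
    intro D g hg s
    have := abs_hamF_le as (hamF as g) (abs_hamF_le as g hg) s
    rw [pow_two, mul_assoc]
    exact this
  set D := 2 * bondCount as ^ 2 + 3 * c with hD
  have hD0 : 0 ≤ D := by positivity
  induction k using Nat.strong_induction_on generalizing s with
  | _ k ih =>
    match k with
    | 0 => simpa [cheb] using hf s
    | 1 =>
      have h1 := hA C f hf s
      have h2 := hf s
      simp only [cheb, LinearMap.sub_apply, LinearMap.smul_apply, Module.End.mul_apply,
        Module.End.one_apply, Pi.sub_apply, Pi.smul_apply, smul_eq_mul, pow_one]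
      have h3 : |c * f s| ≤ c * C := by
        rw [abs_mul, abs_of_nonneg hc]; exact mul_le_mul_of_nonneg_left h2 hc
      have h4 := abs_sub (hamL ℤ as (hamL ℤ as f) s) (c * f s)
      have h5 : 0 ≤ bondCount as ^ 2 * C := by positivity
      have h6 : 0 ≤ c * C := by positivity
      rw [hD]; nlinarith
    | k + 2 =>
      have h1 := hA _ _ (ih (k + 1) (by omega)) s
      have h2 := ih (k + 1) (by omega) s
      have h3 := ih k (by omega) s
      simp only [cheb, LinearMap.sub_apply, LinearMap.smul_apply, Module.End.mul_apply,
        Pi.sub_apply, Pi.smul_apply, smul_eq_mul]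
      set a := hamL ℤ as (hamL ℤ as (cheb (hamL ℤ as) c (k + 1) f)) s
      set b := cheb (hamL ℤ as) c (k + 1) f s
      set e := cheb (hamL ℤ as) c k f s
      have h4 : |2 * a - 2 * c * b - c * c * e| ≤ 2 * |a| + 2 * c * |b| + c * c * |e| := by
        have e1 := abs_sub (2 * a - 2 * c * b) (c * c * e)
        have e2 := abs_sub (2 * a) (2 * c * b)
        rw [abs_mul 2 a, abs_two] at e2
        rw [abs_mul (2 * c) b, abs_of_nonneg (by positivity : 0 ≤ 2 * c)] at e2
        rw [abs_mul (c * c) e, abs_of_nonneg (by positivity : 0 ≤ c * c)] at e1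
        linarith
      have hX : 0 ≤ D ^ k * C := by positivity
      have e3 : c * |b| ≤ c * (D ^ (k + 1) * C) := mul_le_mul_of_nonneg_left h2 hc
      have e4 : c * c * |e| ≤ c * c * (D ^ k * C) := mul_le_mul_of_nonneg_left h3 (by positivity)
      -- The term two indices back is absorbed into the bound one index back, since c ≤ D.
      have e5 : c * c * (D ^ k * C) ≤ c * (D ^ (k + 1) * C) := by
        have : c ≤ D := by rw [hD]; nlinarith [sq_nonneg (bondCount as)]
        have := mul_le_mul_of_nonneg_right this (mul_nonneg hc hX)
        calc c * c * (D ^ k * C) = c * (c * (D ^ k * C)) := by ring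
          _ ≤ D * (c * (D ^ k * C)) := this
          _ = _ := by ring
      calc |2 * a - 2 * c * b - c * c * e| ≤ 2 * |a| + 2 * c * |b| + c * c * |e| := h4
        _ ≤ 2 * (bondCount as ^ 2 * (D ^ (k + 1) * C)) + 2 * (c * (D ^ (k + 1) * C)) +
            c * (D ^ (k + 1) * C) := by linarith
        _ = D ^ (k + 2) * C := by rw [hD]; ring

end Cheb

/-! ### Chebyshev iteration on tries -/

namespace Trie

/-- The recursion step of `cheb`. -/
def chebStep (Q : ℕ) (as : List (List (ℕ × Bool))) (c : ℕ) {α : Type} (x y : Trie)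
    (f : Trie → α) : α :=
  force (ham Q as x) fun s => force (ham Q as s) fun s =>
    force (add (scale Q 2 s) (add (scale Q (Q - 2 * c) x) (scale Q (Q - c * c) y))) f

/-- The iteration of `chebStep`. -/
def chebIter (Q : ℕ) (as : List (List (ℕ × Bool))) (c n : ℕ) : Trie → Trie → Trie :=
  @Nat.rec (fun _ => Trie → Trie → Trie) (fun x _ => x)
    (fun _ ih x y => chebStep Q as c x y fun x' => ih x' x) n

/-- `cheb` of index `k + 1`, on tries. -/
def chebT (Q : ℕ) (as : List (List (ℕ × Bool))) (c k : ℕ) (u : Trie) : Trie :=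
  force u fun u => force (ham Q as u) fun s =>
    force (add (ham Q as s) (scale Q (Q - c) u)) fun v => chebIter Q as c k v u

variable {Q : ℕ}

theorem ev_chebT (hQ : 1 ≤ Q) (as : List (List (ℕ × Bool))) {c : ℕ} (h1 : c ≤ Q) (h2 : 2 * c ≤ Q)
    (h3 : c * c ≤ Q) (k : ℕ) (u : Trie) :
    ev Q (chebT Q as c k u) = cheb (hamL (ZMod Q) as) (c : ZMod Q) (k + 1) (ev Q u) := by
  -- The state of the iteration is a pair of consecutive terms, of index `j + 1` and `j`. It starts
  -- at indices 1 and 0, whence the shift by one in the statement.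
  have hit : ∀ n j x y, ev Q x = cheb (hamL (ZMod Q) as) (c : ZMod Q) (j + 1) (ev Q u) →
      ev Q y = cheb (hamL (ZMod Q) as) (c : ZMod Q) j (ev Q u) →
      ev Q (chebIter Q as c n x y) =
        cheb (hamL (ZMod Q) as) (c : ZMod Q) (j + 1 + n) (ev Q u) := by
    intro n
    induction n with
    | zero => intro j x y hx hy; exact hx
    | succ n ih =>
      intro j x y hx hy
      have : chebIter Q as c (n + 1) x y = chebIter Q as c n
          (add (scale Q 2 (ham Q as (ham Q as x)))
            (add (scale Q (Q - 2 * c) x) (scale Q (Q - c * c) y))) x := by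
        change chebStep Q as c x y (fun x' => chebIter Q as c n x' x) = _
        simp only [chebStep, force_eq]
      rw [this, ih (j + 1) _ _ ?_ hx, add_assoc (j + 1), add_comm 1 n]
      simp only [ev_add, ev_scale, ev_ham hQ, hx, hy, Nat.cast_sub h2, Nat.cast_sub h3]
      simp only [cheb, CharP.cast_eq_zero, LinearMap.sub_apply, LinearMap.smul_apply,
        Module.End.mul_apply]
      push_cast
      module
  have : chebT Q as c k u = chebIter Q as c k (add (ham Q as (ham Q as u)) (scale Q (Q - c) u)) u := by
    simp only [chebT, force_eq]
  rw [this, hit k 0 _ _ _ (by simp [cheb]), zero_add, add_comm]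
  simp only [ev_add, ev_scale, ev_ham hQ, Nat.cast_sub h1, cheb, CharP.cast_eq_zero,
    LinearMap.sub_apply, LinearMap.smul_apply, Module.End.mul_apply, Module.End.one_apply]
  module

/-! ### Packing many start vectors into the digits of one -/

/-- Many vectors packed into one, as the digits in base `B`. -/
def pack (B : ℕ) (f : ℕ → List Bool → Trie) (L : List (List Bool)) : ℕ → Trie :=
  @List.rec _ (fun _ => ℕ → Trie) (fun _ => nil)
    (fun s _ ih x => forceNat x fun x => add (f x s) (ih (Nat.mul B x))) L

/-- The number with the given digits. -/
def horner (B : ℤ) : List ℤ → ℤ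
  | [] => 0
  | a :: l => a + B * horner B l

/-- The argument `x` is the current power of `B`, so the first start vector supplies the lowest
digit. -/
theorem get_pack (B : ℕ) (f : ℕ → List Bool → Trie) (β : List Bool → List Bool → ℤ)
    (hf : ∀ x s t, ((f x s).get t : ℤ) = x * β s t) (L : List (List Bool)) (x : ℕ) (t : List Bool) :
    ((pack B f L x).get t : ℤ) = x * horner B (L.map fun s => β s t) := by
  induction L generalizing x with
  | nil => simp [pack, horner]
  | cons s L ih =>
    have : pack B f (s :: L) x = add (f x s) (pack B f L (B * x)) :=
      forceNat_eq x fun x => add (f x s) (pack B f L (B * x))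
    rw [this, get_add]
    push_cast
    rw [hf, ih, List.map_cons, horner]
    push_cast
    ring

/-- By linearity one run of the iteration treats all start vectors at once. The resulting digits may
be negative and are not yet confined to the range of the base. -/
theorem cheb_horner (A : Module.End ℤ (List Bool → ℤ)) (c : ℤ) (k : ℕ) (B : ℤ)
    (β : List Bool → List Bool → ℤ) (L : List (List Bool)) (t : List Bool) :
    cheb A c k (fun t => horner B (L.map fun s => β s t)) t =
      horner B (L.map fun s => cheb A c k (β s) t) := by
  induction L generalizing t with
  | nil => exact congrFun (cheb A c k).map_zero t
  | cons s L ih =>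
    have : (fun t => horner B ((s :: L).map fun s => β s t)) =
        β s + B • fun t => horner B (L.map fun s => β s t) := by
      funext t; simp [horner]
    rw [this, map_add, map_smul, Pi.add_apply, Pi.smul_apply, ih]
    simp [horner]

/-- The sum of the squares of the `2 ^ n` digits of `x` in base `B`, which are shifted by `h`. -/
def sqDigits (B h : ℕ) (n : ℕ) : ℕ → ℕ :=
  @Nat.rec (fun _ => ℕ → ℕ) (fun x => (x - h) ^ 2 + (h - x) ^ 2)
    (fun n ih x => forceNat (Nat.mod x (B ^ 2 ^ n)) ih + forceNat (Nat.div x (B ^ 2 ^ n)) ih) n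

theorem sqDigits_succ (B h n x : ℕ) : sqDigits B h (n + 1) x =
    sqDigits B h n (x % B ^ 2 ^ n) + sqDigits B h n (x / B ^ 2 ^ n) := by
  change forceNat (x % B ^ 2 ^ n) (sqDigits B h n) + forceNat (x / B ^ 2 ^ n) (sqDigits B h n) = _
  rw [forceNat_eq, forceNat_eq]

theorem sum_digits_lt {B : ℕ} {d : ℕ → ℕ} (hd : ∀ i, d i < B) (n : ℕ) :
    ∑ i ∈ Finset.range n, d i * B ^ i < B ^ n := by
  induction n with
  | zero => simp
  | succ n ih =>
    rw [Finset.sum_range_succ, pow_succ]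
    have : (d n + 1) * B ^ n ≤ B * B ^ n := Nat.mul_le_mul_right _ (hd n)
    nlinarith

/-- The number is halved recursively at the middle digit. At a single digit one of the two truncated
differences vanishes, and the other is the absolute value of the balanced digit. -/
theorem sqDigits_sum {B h : ℕ} {a : ℕ → ℤ} {d : ℕ → ℕ} (hd : ∀ i, d i < B)
    (ha : ∀ i, (d i : ℤ) = a i + h) (n : ℕ) :
    (sqDigits B h n (∑ i ∈ Finset.range (2 ^ n), d i * B ^ i) : ℤ) =
      ∑ i ∈ Finset.range (2 ^ n), a i ^ 2 := by
  induction n generalizing a d with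
  | zero =>
    have h0 := ha 0
    change (((_ - h) ^ 2 + (h - _) ^ 2 : ℕ) : ℤ) = _
    simp only [pow_zero, Finset.range_one, Finset.sum_singleton, mul_one]
    rcases le_total h (d 0) with hh | hh
    · rw [Nat.sub_eq_zero_of_le hh]
      push_cast [Nat.cast_sub hh]
      rw [h0]; ring
    · rw [Nat.sub_eq_zero_of_le hh]
      push_cast [Nat.cast_sub hh]
      rw [h0]; ring
  | succ n ih =>
    have hs : ∑ i ∈ Finset.range (2 ^ (n + 1)), d i * B ^ i =
        (∑ i ∈ Finset.range (2 ^ n), d i * B ^ i) +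
          B ^ 2 ^ n * ∑ i ∈ Finset.range (2 ^ n), d (2 ^ n + i) * B ^ i := by
      rw [pow_succ, mul_two, Finset.sum_range_add, Finset.mul_sum]
      congr 1
      exact Finset.sum_congr rfl fun i _ => by rw [pow_add]; ring
    have hlt := sum_digits_lt hd (2 ^ n)
    rw [sqDigits_succ, hs, Nat.add_mul_mod_self_left, Nat.mod_eq_of_lt hlt,
      Nat.add_mul_div_left _ _ ((Nat.zero_le _).trans_lt hlt), Nat.div_eq_of_lt hlt, zero_add]
    push_cast
    rw [ih hd ha, ih (fun i => hd (2 ^ n + i)) (fun i => ha (2 ^ n + i)), pow_succ 2 n, mul_two,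
      Finset.sum_range_add]

/-- All bit strings of length `n`. -/
def boolLists : ℕ → List (List Bool)
  | 0 => [[]]
  | n + 1 => (boolLists n).map (false :: ·) ++ (boolLists n).map (true :: ·)

theorem mem_boolLists {n : ℕ} {s : List Bool} : s ∈ boolLists n ↔ s.length = n := by
  induction n generalizing s with
  | zero => simp [boolLists]
  | succ n ih =>
    cases s with
    | nil => simp [boolLists]
    | cons b s => cases b <;> simp [boolLists, ih]

theorem nodup_boolLists (n : ℕ) : (boolLists n).Nodup := by
  induction n with
  | zero => simp [boolLists]
  | succ n ih =>
    refine List.Nodup.append (ih.map ?_) (ih.map ?_) ?_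
    · exact fun a b h => by simpa using h
    · exact fun a b h => by simpa using h
    · intro s h1 h2
      simp only [List.mem_map] at h1 h2
      obtain ⟨a, -, rfl⟩ := h1
      obtain ⟨b, -, h⟩ := h2
      simp at h

/-- The sum of a function of the values of a trie at all strings of length `n`, where the
function vanishes at `0`. -/
def total (q : ℕ → ℕ) (n : ℕ) : Trie → ℕ :=
  @Nat.rec (fun _ => Trie → ℕ) (fun t => @Trie.rec (fun _ => ℕ) 0 (fun v _ _ _ _ => q v) t)
    (fun _ ih t => @Trie.rec (fun _ => ℕ) 0 (fun _ l r _ _ => ih l + ih r) t) n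

/-- A pruned branch stands for zero amplitudes, which is why `q` must vanish at 0. -/
theorem total_eq {q : ℕ → ℕ} (hq : q 0 = 0) (n : ℕ) (t : Trie) :
    total q n t = ((boolLists n).map fun s => q (t.get s)).sum := by
  induction n generalizing t with
  | zero => cases t <;> simp [total, boolLists, hq]
  | succ n ih =>
    cases t with
    | nil => simp [total, hq]
    | node v l r =>
      change total q n l + total q n r = _
      simp [boolLists, ih, Function.comp_def]

end Trie

namespace Trie

theorem horner_eq_sum (B : ℤ) (l : List ℤ) {N : ℕ} (hN : l.length ≤ N) :
    horner B l = ∑ i ∈ Finset.range N, l.getD i 0 * B ^ i := by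
  induction l generalizing N with
  | nil => simp [horner]
  | cons a l ih =>
    obtain ⟨N, rfl⟩ : ∃ M, N = M + 1 := ⟨N - 1, by simp at hN; omega⟩
    rw [Finset.sum_range_succ', horner, ih (by simpa using hN), Finset.mul_sum, add_comm]
    congr 1
    · refine Finset.sum_congr rfl fun i _ => ?_
      rw [List.getD_cons_succ, pow_succ]; ring
    · simp

theorem sum_sq_eq_sum (l : List ℤ) {N : ℕ} (hN : l.length ≤ N) :
    (l.map (· ^ 2)).sum = ∑ i ∈ Finset.range N, l.getD i 0 ^ 2 := by
  induction l generalizing N with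
  | nil => simp
  | cons a l ih =>
    obtain ⟨N, rfl⟩ : ∃ M, N = M + 1 := ⟨N - 1, by simp at hN; omega⟩
    rw [Finset.sum_range_succ', List.map_cons, List.sum_cons, ih (by simpa using hN), add_comm]
    simp

/-- The offset that makes all digits nonnegative. -/
def offset (B h n : ℕ) : ℕ := h * ((B ^ 2 ^ n - 1) / (B - 1))

/-- The sum of the squares of the balanced digits of a residue modulo `B ^ 2 ^ n`. -/
def sqBalanced (B h n v : ℕ) : ℕ := sqDigits B h n ((v + offset B h n) % B ^ 2 ^ n)

/-- Adding h to every digit moves all of them into [0, 2h], inside [0, B). The shifted number is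
then smaller than the modulus, so its residue determines it, and positional notation determines the
digits. -/
theorem sqBalanced_eq {B h n v : ℕ} (hB : 2 * h < B) (h2 : 2 ≤ B) {l : List ℤ}
    (hl : ∀ a ∈ l, |a| ≤ h) (hn : l.length ≤ 2 ^ n)
    (hv : (v : ZMod (B ^ 2 ^ n)) = (horner B l : ℤ)) :
    (sqBalanced B h n v : ℤ) = (l.map (· ^ 2)).sum := by
  set d : ℕ → ℕ := fun i => (l.getD i 0 + h).toNat with hd
  have hl' : ∀ i, |l.getD i 0| ≤ h := by
    intro i
    rw [List.getD_eq_getElem?_getD]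
    rcases hi : l[i]? with _ | a
    · simp
    · exact hl a (List.mem_of_getElem? hi)
  have had : ∀ i, (d i : ℤ) = l.getD i 0 + h := fun i => by
    rw [hd]
    exact Int.toNat_of_nonneg (by linarith [neg_le_of_abs_le (hl' i)])
  have hdB : ∀ i, d i < B := fun i => by
    have := had i
    have := le_of_abs_le (hl' i)
    omega
  rw [sum_sq_eq_sum l hn, ← sqDigits_sum hdB had n, sqBalanced]
  congr 2
  rw [← Nat.mod_eq_of_lt (sum_digits_lt hdB (2 ^ n))]
  change _ ≡ _ [MOD _]
  rw [← ZMod.natCast_eq_natCast_iff, Nat.cast_add, hv, horner_eq_sum B l hn, offset,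
    ← Nat.geomSum_eq h2]
  have key : (∑ i ∈ Finset.range (2 ^ n), l.getD i 0 * (B : ℤ) ^ i) +
      ((h * ∑ k ∈ Finset.range (2 ^ n), B ^ k : ℕ) : ℤ) =
      ((∑ i ∈ Finset.range (2 ^ n), d i * B ^ i : ℕ) : ℤ) := by
    push_cast
    rw [Finset.mul_sum, ← Finset.sum_add_distrib]
    exact Finset.sum_congr rfl fun i _ => by rw [had]; ring
  have := congrArg (Int.cast : ℤ → ZMod (B ^ 2 ^ n)) key
  rw [Int.cast_add, Int.cast_natCast, Int.cast_natCast] at this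
  exact this

/-- The sum over all bit strings `t` of length `m` and all start vectors `s ∈ L` of the squared
amplitude at `t` of `cheb` of index `k + 1` applied to the start vector. -/
def chebTrace (as : List (List (ℕ × Bool))) (c k B h n m : ℕ) (f : ℕ → List Bool → Trie)
    (L : List (List Bool)) : ℕ :=
  forceNat (B ^ 2 ^ n) fun Q => forceNat (offset B h n) fun o =>
    total (fun v => forceNat (Nat.mod (Nat.add v o) Q) (sqDigits B h n)) m
      (chebT Q as c k (pack B f L 1))

/-- The a priori growth bound keeps every final digit within h although nothing is controlled during
the modular computation. Hence the natural number found by the kernel is the exact integer trace. -/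
theorem chebTrace_eq {as : List (List (ℕ × Bool))} {c k B h n m : ℕ} {f : ℕ → List Bool → Trie}
    {β : List Bool → List Bool → ℤ} {L : List (List Bool)}
    (hf : ∀ x s t, ((f x s).get t : ℤ) = x * β s t) {C : ℤ} (hβ : ∀ s t, |β s t| ≤ C)
    (hh : (2 * bondCount as ^ 2 + 3 * c) ^ (k + 1) * C ≤ h) (hB : 2 * h < B)
    (hL : L.length ≤ 2 ^ n) (h1 : c ≤ B ^ 2 ^ n) (h2 : 2 * c ≤ B ^ 2 ^ n) (h3 : c * c ≤ B ^ 2 ^ n)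
    (h4 : 2 ≤ B) :
    (chebTrace as c k B h n m f L : ℤ) = ((boolLists m).map fun t =>
      (L.map fun s => cheb (hamL ℤ as) (c : ℤ) (k + 1) (β s) t ^ 2).sum).sum := by
  have hQ : 1 ≤ B ^ 2 ^ n := Nat.one_le_pow _ _ (by omega)
  have h0 : sqBalanced B h n 0 = 0 := by
    have := sqBalanced_eq (v := 0) (n := n) (l := []) hB h4 (by simp) (by simp) (by simp [horner])
    rw [List.map_nil, List.sum_nil] at this
    exact_mod_cast this
  have : chebTrace as c k B h n m f L =
      total (sqBalanced B h n) m (chebT (B ^ 2 ^ n) as c k (pack B f L 1)) := by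
    simp only [chebTrace, forceNat_eq]; rfl
  rw [this, total_eq h0, Nat.cast_list_sum, List.map_map]
  congr 1
  refine List.map_congr_left fun t _ => ?_
  set l := L.map fun s => cheb (hamL ℤ as) (c : ℤ) (k + 1) (β s) t with hl
  have hmap : (L.map fun s => cheb (hamL ℤ as) (c : ℤ) (k + 1) (β s) t ^ 2) = l.map (· ^ 2) := by
    simp [hl]
  rw [hmap]
  refine sqBalanced_eq hB h4 ?_ (by simpa [hl] using hL) ?_
  · intro a ha
    obtain ⟨s, -, rfl⟩ := List.mem_map.1 ha
    exact (abs_cheb_hamL_le as (by positivity) (hβ s) (k + 1) t).trans hh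
  · change ev (B ^ 2 ^ n) (chebT (B ^ 2 ^ n) as c k (pack B f L 1)) t = _
    rw [ev_chebT hQ as h1 h2 h3, hl, ← cheb_horner]
    have hu : ev (B ^ 2 ^ n) (pack B f L 1) =
        fun t => ((horner B (L.map fun s => β s t) : ℤ) : ZMod (B ^ 2 ^ n)) := by
      funext t
      have := get_pack B f β hf L 1 t
      rw [Nat.cast_one, one_mul] at this
      rw [← this, Int.cast_natCast]; rfl
    have := cheb_intertwine (A := hamL ℤ as) (A' := hamL (ZMod (B ^ 2 ^ n)) as)
      (c := (c : ℤ)) (c' := (c : ZMod (B ^ 2 ^ n)))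
      (((Int.castRingHom (ZMod (B ^ 2 ^ n))).toAddMonoidHom).compLeft (List Bool))
      (fun v => by
        funext s
        exact hamF_map ((Int.castRingHom (ZMod (B ^ 2 ^ n))).toAddMonoidHom) as v s)
      (fun v => by funext s; simp) (fun v => by funext s; simp) (k + 1)
      (fun t => horner B (L.map fun s => β s t))
    rw [hu]
    exact (congrFun this t).symm

end Trie

/-! ### Data of the cross and the kernel computations -/

/-- The bonds of the cross with their signs, for a gauge of flux `π`, in the format of `hamF`. The
sites are `(0,0), (1,0), (0,1), (1,1), (-1,0), (-1,1), (2,0), (2,1), (0,-1), (1,-1), (0,2), (1,2)`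
relative to the lower left corner of the central plaquette. -/
def crossBonds : List (List (ℕ × Bool)) :=
  [[(0, false), (1, true), (3, true), (7, true)], [(1, true), (4, true), (7, true)],
    [(0, true), (2, true), (7, true)], [(3, true), (7, true)], [(0, false)], [], [(0, false)], [],
    [(0, true)], [], [(0, false)], []]

/-- The number of particles. -/
def occ : List Bool → ℕ
  | [] => 0
  | b :: s => cond b (occ s + 1) (occ s)

/-- Whether the number of particles on the marked sites is odd. -/
def oddOn : List Bool → List Bool → Bool
  | a :: m, b :: s => xor (a && b) (oddOn m s)
  | _, _ => false

/-- The even sublattice of the cross. -/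
def evenSites : List Bool :=
  [true, false, false, true, false, true, true, false, false, true, true, false]

/-- The configurations of `n` particles with an even number of them on the even sublattice. -/
def sector (n : ℕ) : List (List Bool) :=
  (Trie.boolLists 12).filter fun s => Nat.beq (occ s) n && !oddOn evenSites s

/-- The configurations of `sector 6` in which the last site is empty. -/
def halfSector : List (List Bool) :=
  (Trie.boolLists 12).filter fun s =>
    (Nat.beq (occ s) 6 && !oddOn evenSites s) && !s.getLastD false

/-- The sum of a configuration and of its particle-hole conjugate. -/
def symSingle (x : ℕ) (s : List Bool) : Trie := (Trie.single x s).add (Trie.single x (s.map not))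

/-- Amplitudes of a trial vector on `halfSector`. -/
def trialWeights : List ℤ :=
  [
    1707, 867, 754, 143, -2266, 367, -86, -2818, -318, -415, -3702, 3322, -1150, -261, 473,
    760, 2912, -1742, -2757, -1150, -1267, -86, 1569, 473, 1922, 374, 1002, -768, 2489, 2609,
    0, -1002, -2489, 2609, 24, 1922, -374, -1002, 334, 1922, 1423, -1569, -369, 367, 95, -3322,
    79, 2912, -261, 318, -123, 1931, 2780, -629, -124, 318, 163, -629, 124, 2780, -318, 831,
    1931, 1931, -701, -436, 138, 48, 3879, -153, -1392, -10, -618, -5197, 3879, -950, -436,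
    618, 219, -48, -618, -436, 859, 401, 367, 86, -1569, -143, 2912, -2266, 1423, -760, -3322,
    -1150, -369, 1742, -2818, 165, 415, -760, -236, -123, 2757, 79, 320, -3702, -139, 318,
    -1267, 95, -473, -261, -10, 138, -48, -3879, -153, 9999, -436, -859, 2740, -3879, -950,
    -10, 859, 219, 48, -859, -10, 618, 401, 701, 831, 163, -2780, 3008, 124, 701, 1931, 3008,
    -124, -2780, -701, -123, 163, 163, -318, -473, -3702, 2757, -1150, -236, 415, -1267, 86,
    320, -2266, 1742, -760, 318, -760, -123, -2818, -139, -143, 165, 0, 374, 334, 24, 2489,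
    107, 1922, -334, -2489, 107, -768, 0, -374, -334, 1002, 0, -261, -318, 367, -95, 143, -139,
    3322, 79, -2818, 123, -369, -165, -3702, 1423, -2266, -320, -415, -236, -760, -2757, 79,
    2912, -236, 1569, 123, 760, 1423, -1267, -95, -1742, -369, -320, -760, -139, -165, 754,
    1707, 1707, -867, 867, 1707, 2339, -867, 2339]

/-- The trie of a linear combination of the vectors `symSingle 1 s`. -/
def spread (g : ℤ → ℕ) : List (List Bool) → List ℤ → Trie
  | s :: L, w :: ws => (symSingle (g w) s).add (spread g L ws)
  | _, _ => Trie.nil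

theorem get_symSingle (x : ℕ) (s t : List Bool) : ((symSingle x s).get t : ℤ) =
    x * ((if t = s then 1 else 0) + if t = s.map not then 1 else 0) := by
  rw [symSingle, Trie.get_add, Trie.get_single, Trie.get_single]
  split_ifs <;> simp
  ring

/-- A crude bound by the sum of the weights suffices, as it only has to keep the trial amplitudes
well below the modulus. -/
theorem get_spread_le (g : ℤ → ℕ) (L : List (List Bool)) (ws : List ℤ) (t : List Bool) :
    (spread g L ws).get t ≤ 2 * (ws.map g).sum := by
  induction ws generalizing L with
  | nil => cases L <;> simp [spread]
  | cons w ws ih =>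
    cases L with
    | nil => simp [spread]
    | cons s L =>
      have h := get_symSingle (g w) s t
      have h' : (symSingle (g w) s).get t ≤ 2 * g w := by
        zify
        rw [h]
        split_ifs <;> simp <;> linarith
      rw [spread, Trie.get_add, List.map_cons, List.sum_cons]
      linarith [ih L]

/-- The positive part of the trial vector. -/
def trialPos : Trie := spread Int.toNat halfSector trialWeights

/-- The negative part of the trial vector. -/
def trialNeg : Trie := spread (fun w => (-w).toNat) halfSector trialWeights

/-- The trial vector. -/
def trialF (t : List Bool) : ℤ := trialPos.get t - trialNeg.get t

theorem abs_trialF_le (t : List Bool) : |trialF t| ≤ 1000000 := by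
  have h1 := get_spread_le Int.toNat halfSector trialWeights t
  have h2 := get_spread_le (fun w => (-w).toNat) halfSector trialWeights t
  have h3 : (trialWeights.map Int.toNat).sum ≤ 500000 := by decide +kernel
  have h4 : (trialWeights.map fun w => (-w).toNat).sum ≤ 500000 := by decide +kernel
  rw [trialF, abs_le, trialPos, trialNeg]
  omega

/-- The trial vector modulo `B`. -/
def trialTrie (B : ℕ) : Trie := trialPos.add (trialNeg.scale B (B - 1))

theorem ev_add_scale_neg {B : ℕ} (hB : 1 ≤ B) (p n : Trie) (t : List Bool) :
    (p.add (n.scale B (B - 1))).ev B t = (((p.get t : ℤ) - n.get t : ℤ) : ZMod B) := by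
  rw [Trie.ev_add, Trie.ev_scale, Nat.cast_sub hB]
  simp [Trie.ev, sub_eq_add_neg]

theorem ev_trialTrie {B : ℕ} (hB : 1 ≤ B) :
    (trialTrie B).ev B = fun t => ((trialF t : ℤ) : ZMod B) :=
  funext fun t => ev_add_scale_neg hB trialPos trialNeg t

/-- The digit argument for a single vector: with n = 0 the only digit is the balanced residue
itself. -/
theorem total_sqBalanced {B h : ℕ} (hB : 2 * h < B) (h2 : 2 ≤ B) {u : Trie} {f : List Bool → ℤ}
    (hf : ∀ t, |f t| ≤ h) (hu : ∀ t, u.ev B t = ((f t : ℤ) : ZMod B)) (m : ℕ) :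
    (u.total (Trie.sqBalanced B h 0) m : ℤ) = ((Trie.boolLists m).map fun t => f t ^ 2).sum := by
  have key : ∀ (v : ℕ) (a : ℤ), |a| ≤ h → (v : ZMod B) = ((a : ℤ) : ZMod B) →
      (Trie.sqBalanced B h 0 v : ℤ) = a ^ 2 := by
    intro v a ha hv
    have := Trie.sqBalanced_eq (n := 0) (v := v) (l := [a]) hB h2 (by simpa using ha) (by simp)
      (by rw [pow_zero, pow_one]; simpa [Trie.horner] using hv)
    simpa using this
  have h0 : Trie.sqBalanced B h 0 0 = 0 := by exact_mod_cast key 0 0 (by simp) (by simp)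
  rw [Trie.total_eq h0, Nat.cast_list_sum, List.map_map]
  congr 1
  exact List.map_congr_left fun t _ => key _ _ (hf t) (hu t)

theorem bondCount_crossBonds : bondCount crossBonds = 16 := by decide +kernel

/-- The trial amplitudes are at most 10⁶, and one application of the operator multiplies this by at
most 16. All values stay below 10⁸, less than half the modulus, so residues determine them. -/
theorem trialTrie_bound :
    0 < (trialTrie 1000000007).total (Trie.sqBalanced 1000000007 100000000 0) 12 ∧
    7218069 ^ 2 * (trialTrie 1000000007).total (Trie.sqBalanced 1000000007 100000000 0) 12 ≤
      10 ^ 12 * (((trialTrie 1000000007).force fun u => u.ham 1000000007 crossBonds).total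
        (Trie.sqBalanced 1000000007 100000000 0) 12) := by
  decide +kernel

theorem trialF_even_check : ((Trie.boolLists 12).all fun t =>
    !oddOn evenSites t || (Nat.beq (trialPos.get t) 0 && Nat.beq (trialNeg.get t) 0)) = true := by
  decide +kernel

theorem trialF_eq_zero {t : List Bool} (ht : t.length = 12) (ho : oddOn evenSites t = true) :
    trialF t = 0 := by
  have := List.all_eq_true.1 trialF_even_check t (Trie.mem_boolLists.2 ht)
  rw [ho] at this
  simp only [Bool.not_true, Bool.false_or, Bool.and_eq_true] at this
  rw [trialF, Nat.eq_of_beq_eq_true this.1, Nat.eq_of_beq_eq_true this.2, sub_self]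

theorem trialF_spec_aux {B h : ℕ} (hB : 2 * h < B) (h2 : 2 ≤ B) (hh : (16 * 1000000 : ℤ) ≤ h)
    (hb : 0 < (trialTrie B).total (Trie.sqBalanced B h 0) 12 ∧
      7218069 ^ 2 * (trialTrie B).total (Trie.sqBalanced B h 0) 12 ≤
        10 ^ 12 * (((trialTrie B).force fun u => u.ham B crossBonds).total
          (Trie.sqBalanced B h 0) 12)) :
    0 < ((Trie.boolLists 12).map fun t => trialF t ^ 2).sum ∧
    7218069 ^ 2 * ((Trie.boolLists 12).map fun t => trialF t ^ 2).sum ≤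
      10 ^ 12 * ((Trie.boolLists 12).map fun t => hamF crossBonds trialF t ^ 2).sum := by
  obtain ⟨h3, h4⟩ := hb
  have h1 : 1 ≤ B := by omega
  rw [Trie.force_eq] at h4
  have e1 := total_sqBalanced hB h2 (fun t => (abs_trialF_le t).trans (by linarith))
    (fun t => congrFun (ev_trialTrie h1) t) 12
  have e2 := total_sqBalanced (u := (trialTrie B).ham B crossBonds)
    (f := hamF crossBonds trialF) hB h2 (fun t => by
      have := abs_hamF_le crossBonds trialF abs_trialF_le t
      rw [bondCount_crossBonds] at this
      exact this.trans hh) (fun t => by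
      rw [Trie.ev_ham h1, ev_trialTrie h1]
      exact (hamF_map (Int.castRingHom (ZMod B)).toAddMonoidHom crossBonds trialF t).symm) 12
  rw [← e1, ← e2]
  exact ⟨by exact_mod_cast h3, by exact_mod_cast h4⟩

/-- For the trial vector `w` and the hopping operator `M`, `‖M w‖ ≥ 7.218069 ‖w‖`. -/
theorem trialF_spec :
    0 < ((Trie.boolLists 12).map fun t => trialF t ^ 2).sum ∧
    7218069 ^ 2 * ((Trie.boolLists 12).map fun t => trialF t ^ 2).sum ≤
      10 ^ 12 * ((Trie.boolLists 12).map fun t => hamF crossBonds trialF t ^ 2).sum :=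
  trialF_spec_aux (by norm_num) (by norm_num) (by norm_num) trialTrie_bound

theorem length_sector_zero : (sector 0).length ≤ 2 ^ 7 := by decide +kernel
theorem length_sector_one : (sector 1).length ≤ 2 ^ 7 := by decide +kernel
theorem length_sector_two : (sector 2).length ≤ 2 ^ 7 := by decide +kernel
theorem length_sector_three : (sector 3).length ≤ 2 ^ 7 := by decide +kernel
theorem length_sector_four : (sector 4).length ≤ 2 ^ 8 := by decide +kernel
theorem length_sector_five : (sector 5).length ≤ 2 ^ 9 := by decide +kernel
theorem length_halfSector : halfSector.length ≤ 2 ^ 8 := by decide +kernel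

/-- A digit bound for `cheb` of index `6`. -/
def digitBound : ℕ := 584 ^ 6

/-- A base for `digitBound`. It is odd, since the kernel hashes numbers by their low bits. -/
def digitBase : ℕ := 2 * 584 ^ 6 + 1140071481932319849

/-- A digit bound for `cheb` of index `15`. -/
def digitBound' : ℕ := 2 * 584 ^ 15

/-- A base for `digitBound'`. -/
def digitBase' : ℕ := 4 * 584 ^ 15 + 1140071481932319849

/-- The right-hand side lies below the square of the polynomial of index 6 at 52.10054, see
`chebS_six`. The arguments 7, 8 and 9 are exponents of two that leave room for all start vectors. -/
theorem chebTrace_sector_zero : Trie.chebTrace crossBonds 24 5 digitBase digitBound 7 12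
    Trie.single (sector 0) ≤ 9000000000000000000 := by decide +kernel
theorem chebTrace_sector_one : Trie.chebTrace crossBonds 24 5 digitBase digitBound 7 12
    Trie.single (sector 1) ≤ 9000000000000000000 := by decide +kernel
theorem chebTrace_sector_two : Trie.chebTrace crossBonds 24 5 digitBase digitBound 7 12
    Trie.single (sector 2) ≤ 9000000000000000000 := by decide +kernel
theorem chebTrace_sector_three : Trie.chebTrace crossBonds 24 5 digitBase digitBound 7 12
    Trie.single (sector 3) ≤ 9000000000000000000 := by decide +kernel
theorem chebTrace_sector_four : Trie.chebTrace crossBonds 24 5 digitBase digitBound 8 12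
    Trie.single (sector 4) ≤ 9000000000000000000 := by decide +kernel
theorem chebTrace_sector_five : Trie.chebTrace crossBonds 24 5 digitBase digitBound 9 12
    Trie.single (sector 5) ≤ 9000000000000000000 := by decide +kernel
-- The trial vector lives in this sector, so the estimate is nearly attained; index 15 makes the top
-- eigenvalue dominate the trace.
theorem chebTrace_halfSector : Trie.chebTrace crossBonds 24 14 digitBase' digitBound' 8 12
    symSingle halfSector ≤ 4139860000000000000000000000000000000000000000000 := by decide +kernel

/-! ### Hopping on configurations and its symmetries -/

section HopOp
variable {V : Type*} [Fintype V] [DecidableEq V] {R : Type*} [CommRing R]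

/-- Hopping of hard-core bosons with amplitudes `T`, on functions of the set of occupied sites. -/
def hopOp (T : V → V → R) (φ : Finset V → R) (S : Finset V) : R :=
  ∑ j, ∑ k, if j ∈ S ∧ k ∉ S then T j k * φ (insert k (S.erase j)) else 0

/-- `hopOp` as a linear map. -/
def hopL (T : V → V → R) : Module.End R (Finset V → R) where
  toFun := hopOp T
  map_add' φ ψ := by
    funext S
    simp only [hopOp, Pi.add_apply, ← Finset.sum_add_distrib, mul_add]
    exact Finset.sum_congr rfl fun j _ => Finset.sum_congr rfl fun k _ => by split_ifs <;> simp
  map_smul' c φ := by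
    funext S
    simp only [hopOp, Pi.smul_apply, smul_eq_mul, Finset.mul_sum, RingHom.id_apply]
    exact Finset.sum_congr rfl fun j _ => Finset.sum_congr rfl fun k _ => by
      split_ifs
      · ring
      · simp

theorem hopL_apply (T : V → V → R) (φ : Finset V → R) : hopL T φ = hopOp T φ := rfl

/-- A selection rule: only states with `p` feed into states with `q`. It is used for the parity,
which each hop flips, and for the particle number, which is conserved. -/
theorem hopOp_ite (T : V → V → R) {p q : Finset V → Prop} [DecidablePred p] [DecidablePred q]
    (h : ∀ j k S, T j k ≠ 0 → j ∈ S → k ∉ S → (p (insert k (S.erase j)) ↔ q S))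
    (φ : Finset V → R) (S : Finset V) :
    hopOp T (fun S => if p S then φ S else 0) S = if q S then hopOp T φ S else 0 := by
  have hz : (if q S then hopOp T φ S else 0) = ∑ j, ∑ k, if q S then
      (if j ∈ S ∧ k ∉ S then T j k * φ (insert k (S.erase j)) else 0) else 0 := by
    split_ifs
    · rfl
    · simp
  rw [hz, hopOp]
  refine Finset.sum_congr rfl fun j _ => Finset.sum_congr rfl fun k _ => ?_
  by_cases hjk : j ∈ S ∧ k ∉ S
  · by_cases hT : T j k = 0
    · simp [hT]
    · simp only [hjk, h j k S hT hjk.1 hjk.2]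
      split_ifs <;> simp
  · simp [hjk]

theorem compl_insert_erase {S : Finset V} {j k : V} (hj : j ∈ S) (hk : k ∉ S) :
    (insert k (S.erase j))ᶜ = insert j (Sᶜ.erase k) := by
  ext i
  simp only [Finset.mem_compl, Finset.mem_insert, Finset.mem_erase, not_or, not_and]
  constructor
  · rintro ⟨h1, h2⟩
    by_cases h : i = j
    · exact Or.inl h
    · exact Or.inr ⟨h1, fun hi => h (by_contra fun _ => absurd (h2 h) (by simpa using hi))⟩
  · rintro (rfl | ⟨h1, h2⟩)
    · exact ⟨fun h => hk (h ▸ hj), fun h => absurd rfl h⟩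
    · exact ⟨h1, fun _ => h2⟩

/-- A particle moving from j to k is a hole moving from k to j, and the amplitudes are symmetric. -/
theorem hopOp_compl {T : V → V → R} (hT : ∀ j k, T j k = T k j) (φ : Finset V → R)
    (S : Finset V) : hopOp T (fun S => φ Sᶜ) S = hopOp T φ Sᶜ := by
  rw [hopOp, hopOp, Finset.sum_comm]
  refine Finset.sum_congr rfl fun j _ => Finset.sum_congr rfl fun k _ => ?_
  simp only [Finset.mem_compl, not_not, and_comm (a := k ∈ S)]
  split_ifs with h
  · rw [compl_insert_erase h.2 h.1, hT]
  · rfl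

/-- Since η squares to 1, a hop from j to k multiplies the product of signs over the configuration
by η j η k. The identity permutation gives gauge transformations, others give lattice symmetries up
to gauge. -/
theorem hopOp_signedPerm {T T' : V → V → R} (σ : Equiv.Perm V) (η : V → R)
    (hη : ∀ i, η i * η i = 1) (hT : ∀ j k, T' (σ j) (σ k) = η j * η k * T j k)
    (φ : Finset V → R) (S : Finset V) :
    hopOp T (fun S => (∏ i ∈ S, η i) * φ (S.map σ.toEmbedding)) S =
      (∏ i ∈ S, η i) * hopOp T' φ (S.map σ.toEmbedding) := by
  have hr : hopOp T' φ (S.map σ.toEmbedding) = ∑ j, ∑ k, if j ∈ S ∧ k ∉ S then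
      T' (σ j) (σ k) * φ (insert (σ k) ((S.map σ.toEmbedding).erase (σ j))) else 0 := by
    rw [hopOp, ← Equiv.sum_comp σ]
    refine Finset.sum_congr rfl fun j _ => ?_
    rw [← Equiv.sum_comp σ]
    simp
  rw [hr, hopOp, Finset.mul_sum]
  refine Finset.sum_congr rfl fun j _ => ?_
  rw [Finset.mul_sum]
  refine Finset.sum_congr rfl fun k _ => ?_
  split_ifs with h
  · have hk : k ∉ S.erase j := fun hk => h.2 (Finset.mem_of_mem_erase hk)
    have hp : (∏ i ∈ insert k (S.erase j), η i) = η j * η k * ∏ i ∈ S, η i := by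
      rw [Finset.prod_insert hk, ← Finset.mul_prod_erase S η h.1]
      linear_combination (-η k * ∏ i ∈ S.erase j, η i) * hη j
    have hm : (insert k (S.erase j)).map σ.toEmbedding =
        insert (σ k) ((S.map σ.toEmbedding).erase (σ j)) := by
      rw [Finset.map_insert, Finset.map_erase]; rfl
    rw [hp, hm, hT]; ring
  · simp

/-- Self-adjointness: a hop and its reverse are mutually inverse between the configurations with
only j occupied and those with only k occupied among the two sites. -/
theorem sum_mul_hopOp {T : V → V → R} (hT : ∀ j k, T j k = T k j) (φ ψ : Finset V → R) :
    ∑ S, φ S * hopOp T ψ S = ∑ S, hopOp T φ S * ψ S := by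
  simp only [hopOp, Finset.mul_sum, Finset.sum_mul]
  rw [Finset.sum_comm, Finset.sum_comm (s := Finset.univ (α := Finset V))]
  simp_rw [Finset.sum_comm (s := Finset.univ (α := Finset V))]
  rw [Finset.sum_comm]
  refine Finset.sum_congr rfl fun k _ => Finset.sum_congr rfl fun j _ => ?_
  simp only [mul_ite, mul_zero, ite_mul, zero_mul, ← Finset.sum_filter]
  refine Finset.sum_bij' (fun S _ => insert k (S.erase j)) (fun S _ => insert j (S.erase k))
    ?_ ?_ ?_ ?_ ?_
  · intro S hS
    simp only [Finset.mem_filter, Finset.mem_univ, true_and] at hS ⊢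
    refine ⟨Finset.mem_insert_self _ _, ?_⟩
    simp only [Finset.mem_insert, Finset.mem_erase, not_or]
    exact ⟨fun h => hS.2 (h ▸ hS.1), fun h => h.1 rfl⟩
  · intro S hS
    simp only [Finset.mem_filter, Finset.mem_univ, true_and] at hS ⊢
    refine ⟨Finset.mem_insert_self _ _, ?_⟩
    simp only [Finset.mem_insert, Finset.mem_erase, not_or]
    exact ⟨fun h => hS.2 (h ▸ hS.1), fun h => h.1 rfl⟩
  · intro S hS
    simp only [Finset.mem_filter, Finset.mem_univ, true_and] at hS
    rw [Finset.erase_insert fun h => hS.2 (Finset.mem_of_mem_erase h), Finset.insert_erase hS.1]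
  · intro S hS
    simp only [Finset.mem_filter, Finset.mem_univ, true_and] at hS
    rw [Finset.erase_insert fun h => hS.2 (Finset.mem_of_mem_erase h), Finset.insert_erase hS.1]
  · intro S hS
    simp only [Finset.mem_filter, Finset.mem_univ, true_and] at hS
    rw [Finset.erase_insert fun h => hS.2 (Finset.mem_of_mem_erase h), Finset.insert_erase hS.1, hT]
    ring

end HopOp

/-! ## The cross -/

/-- The links of the cross, and whether their amplitude is positive. -/
def crossLinks : List (Fin 12 × Fin 12 × Bool) :=
  [(0, 1, false), (0, 2, true), (0, 4, true), (0, 8, true), (1, 3, true), (1, 6, true),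
    (1, 9, true), (2, 3, true), (2, 5, true), (2, 10, true), (3, 7, true), (3, 11, true),
    (4, 5, false), (6, 7, false), (8, 9, true), (10, 11, false)]

/-- The hopping amplitudes on the cross in a fixed gauge. -/
def crossT (i j : Fin 12) : ℤ :=
  (crossLinks.map fun l => if (l.1 = i ∧ l.2.1 = j) ∨ (l.1 = j ∧ l.2.1 = i)
    then cond l.2.2 1 (-1) else 0).sum

/-- The bit string of a configuration. -/
def toBits (A : Finset (Fin 12)) : List Bool := List.ofFn fun i => decide (i ∈ A)

theorem hopOp_crossT_eq_sum (φ : Finset (Fin 12) → ℤ) (A : Finset (Fin 12)) :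
    hopOp crossT φ A = (crossLinks.map fun l => cond l.2.2 1 (-1) *
      ((if l.1 ∈ A ∧ l.2.1 ∉ A then φ (insert l.2.1 (A.erase l.1)) else 0) +
        if l.2.1 ∈ A ∧ l.1 ∉ A then φ (insert l.1 (A.erase l.2.1)) else 0)).sum := by
  have hne : ∀ l ∈ crossLinks, l.1 ≠ l.2.1 := by decide +kernel
  unfold hopOp crossT
  generalize crossLinks = L at hne ⊢
  induction L with
  | nil => simp
  | cons l L ih =>
    rw [List.map_cons, List.sum_cons, ← ih fun l hl => hne l (List.mem_cons_of_mem _ hl)]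
    have hl := hne l (List.mem_cons_self ..)
    have h1 : ∀ a b : Fin 12, a ≠ b → ∀ c : ℤ, c * ((if a ∈ A ∧ b ∉ A then φ (insert b (A.erase a)) else 0) +
        if b ∈ A ∧ a ∉ A then φ (insert a (A.erase b)) else 0) =
        ∑ j, ∑ k, if j ∈ A ∧ k ∉ A then (if (a = j ∧ b = k) ∨ (a = k ∧ b = j) then c else 0) *
          φ (insert k (A.erase j)) else 0 := by
      intro a b hab c
      have : ∀ j k, (if j ∈ A ∧ k ∉ A then (if (a = j ∧ b = k) ∨ (a = k ∧ b = j) then c else 0) *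
          φ (insert k (A.erase j)) else 0) =
          (if a = j then if b = k then
            c * (if a ∈ A ∧ b ∉ A then φ (insert b (A.erase a)) else 0) else 0 else 0) +
          (if b = j then if a = k then
            c * (if b ∈ A ∧ a ∉ A then φ (insert a (A.erase b)) else 0) else 0 else 0) := by
        intro j k
        by_cases h1 : a = j <;> by_cases h2 : b = k <;> by_cases h3 : a = k <;>
          by_cases h4 : b = j <;> subst_vars <;> simp_all
      have hX : ∀ (a b : Fin 12) (X : ℤ),
          (∑ j, ∑ k, if a = j then if b = k then X else 0 else 0) = X := by
        intro a b X
        rw [Finset.sum_eq_single a (fun j _ hj => by simp [hj.symm]) (by simp)]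
        simp
      simp only [this, Finset.sum_add_distrib, hX, mul_add]
    rw [h1 _ _ hl, ← Finset.sum_add_distrib]
    refine Finset.sum_congr rfl fun j _ => ?_
    rw [← Finset.sum_add_distrib]
    refine Finset.sum_congr rfl fun k _ => ?_
    by_cases hA : j ∈ A ∧ k ∉ A
    · simp only [hA, not_false_eq_true, and_self, if_true, List.map_cons, List.sum_cons]
      ring
    · simp [hA]

set_option maxHeartbeats 1000000 in
-- Both sides are expanded over the 16 links in terms of the 12 occupation bits, after which they
-- are the same sum. This ties the list encoding to the lattice operator.
theorem hopOp_crossT (f : List Bool → ℤ) (A : Finset (Fin 12)) :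
    hopOp crossT (fun A => f (toBits A)) A = hamF crossBonds f (toBits A) := by
  rw [hopOp_crossT_eq_sum]
  have hA : ∀ B : Finset (Fin 12), toBits B = [decide (0 ∈ B), decide (1 ∈ B), decide (2 ∈ B),
    decide (3 ∈ B), decide (4 ∈ B), decide (5 ∈ B), decide (6 ∈ B), decide (7 ∈ B),
    decide (8 ∈ B), decide (9 ∈ B), decide (10 ∈ B), decide (11 ∈ B)] := fun B => rfl
  have hp : ∀ (p q : Prop) [Decidable p] [Decidable q] (x y : ℤ),
      ((if p ∧ ¬q then x else 0) + if q ∧ ¬p then y else 0) =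
        if p then (if q then 0 else x) else if q then y else 0 := by
    intro p q _ _ x y
    by_cases p <;> by_cases q <;> simp [*]
  have hs : ∀ (p : Prop) [Decidable p] (x y z w : ℤ), (if p then x + y else z + w) =
      (if p then x else z) + if p then y else w := by
    intro p _ x y z w
    split_ifs <;> rfl
  have hn : ∀ (p q : Prop) [Decidable p] [Decidable q] (x y : ℤ),
      (if p then (-if q then 0 else x) else -if q then y else 0) =
        -(if p then (if q then 0 else x) else if q then y else 0) := by
    intro p q _ _ x y
    by_cases p <;> by_cases q <;> simp [*]
  simp only [hA, crossLinks, crossBonds, hamF, fanF, creF, annF, List.map_cons, List.map_nil,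
    List.sum_cons, List.sum_nil, cond_true, cond_false, Bool.cond_decide, hp, hs, hn, one_mul,
    neg_one_mul, add_zero, ite_self]
  simp
  abel

/-- The configuration of a bit string. -/
def ofBits (s : List Bool) : Finset (Fin 12) := Finset.univ.filter fun i => s.getD i false = true

theorem getD_toBits (A : Finset (Fin 12)) (i : Fin 12) : (toBits A).getD i false = decide (i ∈ A) := by
  rw [toBits, List.getD_eq_getElem?_getD, List.getElem?_ofFn]
  simp

theorem ofBits_toBits (A : Finset (Fin 12)) : ofBits (toBits A) = A := by
  ext i
  rw [ofBits, Finset.mem_filter, getD_toBits]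
  simp

theorem toBits_injective : Function.Injective toBits :=
  Function.LeftInverse.injective ofBits_toBits

theorem length_toBits (A : Finset (Fin 12)) : (toBits A).length = 12 := by simp [toBits]

theorem toBits_ofBits {s : List Bool} (hs : s.length = 12) : toBits (ofBits s) = s := by
  refine List.ext_getElem (by rw [length_toBits, hs]) fun i h1 h2 => ?_
  simp only [toBits, List.getElem_ofFn, ofBits, Finset.mem_filter, Finset.mem_univ, true_and]
  rw [List.getD_eq_getElem _ _ h2, Bool.decide_eq_true]

theorem sum_toBits {R : Type*} [AddCommMonoid R] (G : List Bool → R) :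
    ∑ A, G (toBits A) = ((Trie.boolLists 12).map G).sum := by
  rw [← List.sum_toFinset G (Trie.nodup_boolLists 12),
    ← Finset.sum_image (s := Finset.univ) (g := toBits) (f := G) (toBits_injective.injOn)]
  refine Finset.sum_congr ?_ fun _ _ => rfl
  ext s
  simp only [Finset.mem_image, Finset.mem_univ, true_and, List.mem_toFinset, Trie.mem_boolLists]
  exact ⟨fun ⟨A, hA⟩ => hA ▸ length_toBits A, fun h => ⟨ofBits s, toBits_ofBits h⟩⟩

theorem occ_ofFn {n : ℕ} (b : Fin n → Bool) : occ (List.ofFn b) = ∑ i, cond (b i) 1 0 := by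
  induction n with
  | zero => simp [occ]
  | succ n ih =>
    rw [List.ofFn_succ, occ, ih, Fin.sum_univ_succ]
    cases b 0 <;> simp [add_comm]

theorem occ_toBits (A : Finset (Fin 12)) : occ (toBits A) = A.card := by
  rw [toBits, occ_ofFn]
  simp only [Bool.cond_decide]
  simp

/-- The sites of the even sublattice of the cross. -/
def isEven (i : Fin 12) : Bool := evenSites.getD i false

/-- The parity of the number of particles on the even sublattice. -/
def par (A : Finset (Fin 12)) : ZMod 2 := ∑ i ∈ A, if isEven i then 1 else 0

theorem oddOn_ofFn {n : ℕ} (a b : Fin n → Bool) :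
    (if oddOn (List.ofFn a) (List.ofFn b) then 1 else 0 : ZMod 2) =
      ∑ i, if b i then (if a i then 1 else 0) else 0 := by
  induction n with
  | zero => simp [oddOn]
  | succ n ih =>
    rw [List.ofFn_succ, List.ofFn_succ, oddOn, Fin.sum_univ_succ, ← ih]
    cases a 0 <;> cases b 0 <;>
      cases oddOn (List.ofFn fun i => a i.succ) (List.ofFn fun i => b i.succ) <;> (simp; try rfl)

theorem oddOn_toBits (A : Finset (Fin 12)) :
    (if oddOn evenSites (toBits A) then 1 else 0 : ZMod 2) = par A := by
  have h : evenSites = List.ofFn isEven := by decide +kernel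
  rw [h, toBits, oddOn_ofFn, par, ← Finset.sum_filter]
  simp

theorem oddOn_toBits_eq_false (A : Finset (Fin 12)) :
    oddOn evenSites (toBits A) = false ↔ par A = 0 := by
  rw [← oddOn_toBits]
  cases oddOn evenSites (toBits A) <;> simp

/-- The even sublattice of the cross has six sites, an even number, so particles and holes on it
have equal parity. -/
theorem par_compl (A : Finset (Fin 12)) : par Aᶜ = par A := by
  have h : par A + par Aᶜ = 0 := by
    rw [par, par, Finset.sum_add_sum_compl]
    decide +kernel
  rw [← neg_eq_of_add_eq_zero_right h, ZModModule.neg_eq_self]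

theorem crossT_symm : ∀ j k, crossT j k = crossT k j := by decide +kernel

theorem isEven_of_crossT : ∀ j k, crossT j k ≠ 0 → isEven j ≠ isEven k := by decide +kernel

/-- Every link joins the two sublattices, so one hop moves exactly one particle onto or off the even
one. -/
theorem par_insert_erase {A : Finset (Fin 12)} {j k : Fin 12} (h : crossT j k ≠ 0) (hj : j ∈ A)
    (hk : k ∉ A) : par (insert k (A.erase j)) = par A + 1 := by
  rw [par, Finset.sum_insert fun h => hk (Finset.mem_of_mem_erase h), par,
    ← Finset.add_sum_erase _ _ hj]
  have := isEven_of_crossT j k h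
  have h2 : (1 : ZMod 2) + 1 = 0 := rfl
  cases h1 : isEven j <;> cases h3 : isEven k <;> simp_all
  · ring
  · linear_combination (-1 : ZMod 2) * h2

theorem mem_sector {A : Finset (Fin 12)} {n : ℕ} : toBits A ∈ sector n ↔ A.card = n ∧ par A = 0 := by
  rw [sector, List.mem_filter, Trie.mem_boolLists, ← oddOn_toBits_eq_false, ← occ_toBits]
  simp [length_toBits]

theorem mem_halfSector {A : Finset (Fin 12)} :
    toBits A ∈ halfSector ↔ (A.card = 6 ∧ par A = 0) ∧ 11 ∉ A := by
  have : (toBits A).getLastD false = decide (11 ∈ A) := rfl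
  rw [halfSector, List.mem_filter, Trie.mem_boolLists, ← oddOn_toBits_eq_false, ← occ_toBits, this]
  simp [length_toBits]

theorem toBits_compl (A : Finset (Fin 12)) : toBits Aᶜ = (toBits A).map not := by
  rw [toBits, toBits, List.map_ofFn]
  congr 1
  funext i
  simp

/-- The hopping amplitudes of the cross as real numbers. -/
def crossTR (i j : Fin 12) : ℝ := crossT i j

theorem crossTR_symm (j k : Fin 12) : crossTR j k = crossTR k j := by
  rw [crossTR, crossT_symm]; rfl

theorem hopOp_crossTR (f : List Bool → ℤ) (A : Finset (Fin 12)) :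
    hopOp crossTR (fun A => (f (toBits A) : ℝ)) A = (hamF crossBonds f (toBits A) : ℤ) := by
  rw [← hopOp_crossT]
  simp only [hopOp, crossTR]
  push_cast
  rfl

theorem cheb_hopL_toBits (c : ℤ) (k : ℕ) (f : List Bool → ℤ) (A : Finset (Fin 12)) :
    cheb (hopL crossTR) (c : ℝ) k (fun A => (f (toBits A) : ℝ)) A =
      (cheb (hamL ℤ crossBonds) c k f (toBits A) : ℤ) := by
  let Φ : (List Bool → ℤ) →+ (Finset (Fin 12) → ℝ) :=
    { toFun := fun f A => (f (toBits A) : ℝ)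
      map_zero' := by funext A; simp
      map_add' := fun f g => by funext A; simp }
  have := cheb_intertwine (A := hamL ℤ crossBonds) (A' := hopL crossTR) Φ (c := c) (c' := (c : ℝ))
    (fun v => funext fun A => (hopOp_crossTR v A).symm)
    (fun v => by funext A; simp [Φ]) (fun v => by funext A; simp [Φ]) k f
  exact (congrFun this A).symm

/-! ### From traces to eigenvalue bounds -/

/-- If an eigenvector of the square of the hopping operator is a combination of start vectors, then
the trace of the square of `cheb` over the start vectors bounds the square of its eigenvalue. -/
theorem sq_chebS_le {L : List (List Bool)} (hL : L.Nodup) (β : List Bool → List Bool → ℤ)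
    (a : List Bool → ℝ) {φ : Finset (Fin 12) → ℝ} {x κ : ℝ}
    (hφ : ∀ A, φ A = ∑ s ∈ L.toFinset, a s * β s (toBits A))
    (hκ : κ * ∑ s ∈ L.toFinset, a s ^ 2 ≤ ∑ A, φ A ^ 2) (hpos : 0 < ∑ A, φ A ^ 2)
    (hx : hopL crossTR (hopL crossTR φ) = x • φ) (c : ℤ) (k : ℕ) :
    κ * chebS x c k ^ 2 ≤ ((((Trie.boolLists 12).map fun t =>
      (L.map fun s => cheb (hamL ℤ crossBonds) c k (β s) t ^ 2).sum).sum : ℤ) : ℝ) := by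
  set G : List Bool → List Bool → ℤ := fun s t => cheb (hamL ℤ crossBonds) c k (β s) t with hG
  have hφ' : φ = ∑ s ∈ L.toFinset, a s • fun A => (β s (toBits A) : ℝ) := by
    funext A; simp [hφ A]
  have h1 : ∀ A, chebS x c k * φ A = ∑ s ∈ L.toFinset, a s * G s (toBits A) := by
    intro A
    have h := congrFun (cheb_apply_of_sq hx (c : ℝ) k) A
    rw [Pi.smul_apply, smul_eq_mul] at h
    rw [← h]
    conv_lhs => rw [hφ']
    rw [map_sum, Finset.sum_apply]
    refine Finset.sum_congr rfl fun s _ => ?_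
    rw [map_smul, Pi.smul_apply, cheb_hopL_toBits, smul_eq_mul]
  have h2 : ((((Trie.boolLists 12).map fun t => (L.map fun s => G s t ^ 2).sum).sum : ℤ) : ℝ) =
      ∑ A, ∑ s ∈ L.toFinset, (G s (toBits A) : ℝ) ^ 2 := by
    rw [← sum_toBits (fun t => (L.map fun s => G s t ^ 2).sum)]
    simp only [← List.sum_toFinset _ hL]
    push_cast
    rfl
  rw [h2]
  set S := ∑ s ∈ L.toFinset, a s ^ 2
  set T := ∑ A, ∑ s ∈ L.toFinset, (G s (toBits A) : ℝ) ^ 2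
  have hT : 0 ≤ T := by positivity
  -- Cauchy–Schwarz over the start vectors at each configuration. Only the square sum of the
  -- coefficients remains, and κ compares it with the norm of the eigenvector.
  have h3 : chebS x c k ^ 2 * ∑ A, φ A ^ 2 ≤ S * T := by
    rw [Finset.mul_sum, Finset.mul_sum]
    refine Finset.sum_le_sum fun A _ => ?_
    rw [← mul_pow, h1]
    exact Finset.sum_mul_sq_le_sq_mul_sq _ _ _
  rcases le_or_gt κ 0 with hk | hk
  · exact (mul_nonpos_of_nonpos_of_nonneg hk (sq_nonneg _)).trans hT
  · refine le_of_mul_le_mul_right ?_ hpos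
    calc κ * chebS x c k ^ 2 * ∑ A, φ A ^ 2 = κ * (chebS x c k ^ 2 * ∑ A, φ A ^ 2) := by ring
      _ ≤ κ * (S * T) := mul_le_mul_of_nonneg_left h3 hk.le
      _ = (κ * S) * T := by ring
      _ ≤ (∑ A, φ A ^ 2) * T := mul_le_mul_of_nonneg_right hκ hT
      _ = _ := by ring

/-- The induction also carries that the excess of each term over c times its predecessor is
nonnegative and increasing in x; this excess satisfies a recursion with nonnegative coefficients
once x ≥ 2c. -/
theorem chebS_mono {c x y : ℝ} (hc : 0 ≤ c) (hx : 2 * c ≤ x) (hxy : x ≤ y) (k : ℕ) :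
    0 ≤ chebS x c k ∧ chebS x c k ≤ chebS y c k := by
  have key : ∀ k, (0 ≤ chebS x c k ∧ chebS x c k ≤ chebS y c k) ∧
      0 ≤ chebS x c (k + 1) - c * chebS x c k ∧
      chebS x c (k + 1) - c * chebS x c k ≤ chebS y c (k + 1) - c * chebS y c k := by
    intro k
    induction k with
    | zero => simp only [chebS]; refine ⟨⟨?_, ?_⟩, ?_, ?_⟩ <;> linarith
    | succ k ih =>
      obtain ⟨⟨h1, h2⟩, h3, h4⟩ := ih
      have h5 : c * chebS x c k ≤ c * chebS y c k := mul_le_mul_of_nonneg_left h2 hc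
      have h6 : 0 ≤ c * chebS x c k := mul_nonneg hc h1
      have e : ∀ z, chebS z c (k + 1 + 1) - c * chebS z c (k + 1) =
          2 * ((z - 2 * c) * chebS z c (k + 1)) + c * (chebS z c (k + 1) - c * chebS z c k) := by
        intro z; simp only [chebS]; ring
      rw [e, e]
      have h7 : 0 ≤ (x - 2 * c) * chebS x c (k + 1) := mul_nonneg (by linarith) (by linarith)
      have h8 : (x - 2 * c) * chebS x c (k + 1) ≤ (y - 2 * c) * chebS y c (k + 1) :=
        mul_le_mul (by linarith) (by linarith) (by linarith) (by linarith)
      have h9 := mul_nonneg hc h3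
      have h10 := mul_le_mul_of_nonneg_left h4 hc
      refine ⟨⟨?_, ?_⟩, ?_, ?_⟩ <;> linarith
  exact (key k).1

/-- The point 52.10054 lies beyond 2c = 48, and its root is just below 7.218071, twice the energy
bound. By monotonicity only this one value has to be evaluated. -/
theorem chebS_six {x : ℝ} (hx : 5210054 / 100000 ≤ x) : 9000000000000000000 < chebS x 24 6 ^ 2 := by
  obtain ⟨h1, h2⟩ := chebS_mono (c := 24) (by norm_num) (by norm_num) hx 6
  refine lt_of_lt_of_le ?_ (pow_le_pow_left₀ h1 h2 2)
  norm_num [chebS]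

theorem chebS_fifteen {x : ℝ} (hx : 5210054 / 100000 ≤ x) :
    4139860000000000000000000000000000000000000000000 < 2 * chebS x 24 15 ^ 2 := by
  obtain ⟨h1, h2⟩ := chebS_mono (c := 24) (by norm_num) (by norm_num) hx 15
  refine lt_of_lt_of_le ?_ (mul_le_mul_of_nonneg_left (pow_le_pow_left₀ h1 h2 2) zero_le_two)
  norm_num [chebS]

theorem sum_sq_pos {ι : Type*} [Fintype ι] {φ : ι → ℝ} (h : φ ≠ 0) : 0 < ∑ A, φ A ^ 2 := by
  obtain ⟨A, hA⟩ := Function.ne_iff.1 h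
  exact Finset.sum_pos' (fun _ _ => sq_nonneg _) ⟨A, Finset.mem_univ _, by
    have : φ A ≠ 0 := hA
    positivity⟩

theorem length_of_mem_sector {s : List Bool} {n : ℕ} (h : s ∈ sector n) : s.length = 12 :=
  Trie.mem_boolLists.1 (List.mem_of_mem_filter h)

theorem length_of_mem_halfSector {s : List Bool} (h : s ∈ halfSector) : s.length = 12 :=
  Trie.mem_boolLists.1 (List.mem_of_mem_filter h)

theorem ofBits_injOn {L : List (List Bool)} (hL : ∀ s ∈ L, s.length = 12) :
    Set.InjOn ofBits (L.toFinset : Set (List Bool)) := by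
  intro s hs t ht h
  simp only [List.coe_toFinset, Set.mem_ofPred_eq] at hs ht
  rw [← toBits_ofBits (hL s hs), ← toBits_ofBits (hL t ht), h]

/-- The amplitudes of the start vector of a configuration. -/
def startF (s t : List Bool) : ℤ := if t = s then 1 else 0

/-- The amplitudes of the particle-hole symmetric start vector of a configuration. -/
def symStartF (s t : List Bool) : ℤ := (if t = s then 1 else 0) + if t = s.map not then 1 else 0

/-- The start vectors are the basis configurations of the sector, an orthonormal family, so κ = 1.
-/
theorem sector_bound {φ : Finset (Fin 12) → ℝ} (h0 : φ ≠ 0) {x : ℝ} {n m : ℕ}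
    (hn : ∀ A, φ A ≠ 0 → A.card = n ∧ par A = 0)
    (hx : hopL crossTR (hopL crossTR φ) = x • φ) (hm : (sector n).length ≤ 2 ^ m)
    (hB : 576 ≤ digitBase ^ 2 ^ m)
    (hT : Trie.chebTrace crossBonds 24 5 digitBase digitBound m 12 Trie.single (sector n) ≤
      9000000000000000000) : x < 5210054 / 100000 := by
  by_contra hlt
  push Not at hlt
  have key := sq_chebS_le (L := sector n) (κ := 1) (φ := φ) (x := x)
    ((Trie.nodup_boolLists 12).filter _) startF (fun s => φ (ofBits s)) ?_ ?_ (sum_sq_pos h0) hx 24 6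
  · have ht := Trie.chebTrace_eq (as := crossBonds) (c := 24) (k := 5) (B := digitBase)
      (h := digitBound) (n := m) (m := 12) (f := Trie.single) (β := startF) (L := sector n)
      (fun x s t => by rw [Trie.get_single, startF]; split_ifs <;> simp) (C := 1)
      (fun s t => by rw [startF]; split_ifs <;> simp)
      (by rw [bondCount_crossBonds]; norm_num [digitBound]) (by norm_num [digitBound, digitBase])
      hm (by omega) (by omega) (by omega) (by norm_num [digitBase])
    have h3 : ((Trie.chebTrace crossBonds 24 5 digitBase digitBound m 12 Trie.single
        (sector n) : ℤ) : ℝ) ≤ 9000000000000000000 := by exact_mod_cast hT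
    rw [ht] at h3
    have h4 := chebS_six hlt
    push_cast at key h3
    linarith
  · intro A
    by_cases hA : toBits A ∈ sector n
    · rw [Finset.sum_eq_single (toBits A)]
      · simp [startF, ofBits_toBits]
      · intro s _ hs; simp [startF, hs.symm]
      · intro h; exact absurd (List.mem_toFinset.2 hA) h
    · rw [Finset.sum_eq_zero]
      · by_contra h
        exact hA (mem_sector.2 (hn A h))
      · intro s hs
        have : toBits A ≠ s := fun h => hA (h ▸ List.mem_toFinset.1 hs)
        simp [startF, this]
  · rw [one_mul, ← Finset.sum_image (f := fun A => φ A ^ 2)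
      (ofBits_injOn fun s hs => length_of_mem_sector hs)]
    exact Finset.sum_le_sum_of_subset_of_nonneg (Finset.subset_univ _) fun _ _ _ => sq_nonneg _

/-- Of a configuration and its complement exactly one leaves site 11 empty, so the symmetrised start
vectors span the symmetric states. Each has squared norm 2, hence κ = 2. -/
theorem halfSector_bound {φ : Finset (Fin 12) → ℝ} (h0 : φ ≠ 0) {x : ℝ}
    (hn : ∀ A, φ A ≠ 0 → A.card = 6 ∧ par A = 0) (hC : ∀ A, φ Aᶜ = φ A)
    (hx : hopL crossTR (hopL crossTR φ) = x • φ) : x < 5210054 / 100000 := by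
  by_contra hlt
  push Not at hlt
  have hmem : ∀ s ∈ halfSector, 11 ∉ ofBits s := fun s hs => by
    have := toBits_ofBits (length_of_mem_halfSector hs)
    exact (mem_halfSector.1 (this.symm ▸ hs)).2
  have key := sq_chebS_le (L := halfSector) (κ := 2) (φ := φ) (x := x)
    ((Trie.nodup_boolLists 12).filter _) symStartF (fun s => φ (ofBits s)) ?_ ?_ (sum_sq_pos h0)
    hx 24 15
  · have hB : 576 ≤ digitBase' ^ 2 ^ 8 :=
      le_trans (by norm_num [digitBase']) (Nat.le_self_pow (by norm_num) _)
    have ht := Trie.chebTrace_eq (as := crossBonds) (c := 24) (k := 14) (B := digitBase')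
      (h := digitBound') (n := 8) (m := 12) (f := symSingle) (β := symStartF) (L := halfSector)
      (fun x s t => by rw [get_symSingle, symStartF]) (C := 2)
      (fun s t => by rw [symStartF]; split_ifs <;> simp)
      (by rw [bondCount_crossBonds]; norm_num [digitBound']) (by norm_num [digitBound', digitBase'])
      length_halfSector (by omega) (by omega) (by omega) (by norm_num [digitBase'])
    have h3 : ((Trie.chebTrace crossBonds 24 14 digitBase' digitBound' 8 12 symSingle
        halfSector : ℤ) : ℝ) ≤ 4139860000000000000000000000000000000000000000000 := by
      exact_mod_cast chebTrace_halfSector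
    rw [ht] at h3
    have h4 := chebS_fifteen hlt
    push_cast at key h3
    linarith
  · have hval : ∀ A, 11 ∉ A → φ A = ∑ s ∈ halfSector.toFinset,
        φ (ofBits s) * (if toBits A = s then 1 else 0) := by
      intro A h11
      by_cases hA : toBits A ∈ halfSector
      · rw [Finset.sum_eq_single (toBits A)]
        · simp [ofBits_toBits]
        · intro s _ hs; simp [hs.symm]
        · intro h; exact absurd (List.mem_toFinset.2 hA) h
      · rw [Finset.sum_eq_zero]
        · by_contra h
          exact hA (mem_halfSector.2 ⟨hn A h, h11⟩)
        · intro s hs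
          have : toBits A ≠ s := fun h => hA (h ▸ List.mem_toFinset.1 hs)
          simp [this]
    have hzero : ∀ A, 11 ∈ A → ∑ s ∈ halfSector.toFinset,
        φ (ofBits s) * (if toBits A = s then 1 else 0) = 0 := by
      intro A h11
      refine Finset.sum_eq_zero fun s hs => ?_
      have : toBits A ≠ s := fun h => by
        have := hmem s (List.mem_toFinset.1 hs)
        rw [← h, ofBits_toBits] at this
        exact this h11
      simp [this]
    have hflip : ∀ A s, (toBits A = s.map not) ↔ (toBits Aᶜ = s) := by
      intro A s
      rw [toBits_compl]
      constructor
      · rintro h; rw [h, List.map_map, show (not ∘ not : Bool → Bool) = id from funext Bool.not_not, List.map_id]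
      · rintro rfl; rw [List.map_map, show (not ∘ not : Bool → Bool) = id from funext Bool.not_not, List.map_id]
    intro A
    simp only [symStartF, hflip]
    push_cast
    simp only [mul_add, Finset.sum_add_distrib]
    by_cases h11 : 11 ∈ A
    · rw [hzero A h11, ← hval Aᶜ (by simpa using h11), hC, zero_add]
    · rw [← hval A h11, hzero Aᶜ (by simpa using h11), add_zero]
  · rw [← Finset.sum_image (f := fun A => φ A ^ 2)
      (ofBits_injOn fun s hs => length_of_mem_halfSector hs)]
    have h1 : ∑ A ∈ halfSector.toFinset.image ofBits, φ A ^ 2 ≤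
        ∑ A ∈ Finset.univ.filter (fun A : Finset (Fin 12) => 11 ∉ A), φ A ^ 2 := by
      refine Finset.sum_le_sum_of_subset_of_nonneg ?_ fun _ _ _ => sq_nonneg _
      intro A hA
      obtain ⟨s, hs, rfl⟩ := Finset.mem_image.1 hA
      exact Finset.mem_filter.2 ⟨Finset.mem_univ _, hmem s (List.mem_toFinset.1 hs)⟩
    have h2 : ∑ A ∈ Finset.univ.filter (fun A : Finset (Fin 12) => 11 ∉ A), φ A ^ 2 =
        ∑ A ∈ Finset.univ.filter (fun A : Finset (Fin 12) => ¬ 11 ∉ A), φ A ^ 2 := by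
      refine Finset.sum_bij' (fun A _ => Aᶜ) (fun A _ => Aᶜ) ?_ ?_ ?_ ?_ ?_ <;>
        simp [hC]
    rw [← Finset.sum_filter_add_sum_filter_not Finset.univ fun A : Finset (Fin 12) => 11 ∉ A]
    linarith

/-! ### Symmetry reduction of the eigenvalue problem on the cross -/

theorem hopOp_crossTR_even (φ : Finset (Fin 12) → ℝ) (A : Finset (Fin 12)) :
    hopOp crossTR (fun A => if par A = 0 then φ A else 0) A =
      if par A = 1 then hopOp crossTR φ A else 0 := by
  refine hopOp_ite (p := fun A => par A = 0) (q := fun A => par A = 1) _ (fun j k S h hj hk => ?_) φ A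
  have h : crossT j k ≠ 0 := fun h0 => h (by simp [crossTR, h0])
  rw [par_insert_erase h hj hk]
  generalize par S = x
  revert x; decide

theorem hopOp_crossTR_odd (φ : Finset (Fin 12) → ℝ) (A : Finset (Fin 12)) :
    hopOp crossTR (fun A => if par A = 1 then φ A else 0) A =
      if par A = 0 then hopOp crossTR φ A else 0 := by
  refine hopOp_ite (p := fun A => par A = 1) (q := fun A => par A = 0) _ (fun j k S h hj hk => ?_) φ A
  have h : crossT j k ≠ 0 := fun h0 => h (by simp [crossTR, h0])
  rw [par_insert_erase h hj hk]
  generalize par S = x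
  revert x; decide

/-- The operator exchanges the even and odd parts of φ up to the factor E. Its square therefore
fixes the even part up to E², and E ≠ 0 forbids that part to vanish. -/
theorem exists_even_eigenvector {φ : Finset (Fin 12) → ℝ} {E : ℝ} (h0 : φ ≠ 0) (hE : E ≠ 0)
    (h : hopL crossTR φ = E • φ) :
    (fun A => if par A = 0 then φ A else 0) ≠ 0 ∧
      hopL crossTR (hopL crossTR fun A => if par A = 0 then φ A else 0) =
        E ^ 2 • fun A => if par A = 0 then φ A else 0 := by
  have h' : ∀ A, hopOp crossTR φ A = E * φ A := fun A => congrFun h A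
  constructor
  · intro hz
    have hz' : ∀ A, par A = 0 → φ A = 0 := fun A hA => by
      have := congrFun hz A
      simpa [hA] using this
    refine h0 (funext fun A => ?_)
    by_cases hA : par A = 0
    · exact hz' A hA
    · have hodd : φ = fun A => if par A = 1 then φ A else 0 := by
        funext B
        split_ifs with hB
        · rfl
        · refine hz' B ?_
          revert hB; generalize par B = x; revert x; decide
      have h2 := h' A
      rw [hodd, hopOp_crossTR_odd, if_neg hA, ← hodd] at h2
      exact (mul_eq_zero.1 h2.symm).resolve_left hE
  · have h1 : (hopL crossTR fun A => if par A = 0 then φ A else 0) =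
        E • fun A => if par A = 1 then φ A else 0 := by
      funext A
      rw [hopL_apply, hopOp_crossTR_even, Pi.smul_apply, smul_eq_mul, h']
      split_ifs <;> simp
    rw [h1, map_smul]
    funext A
    rw [Pi.smul_apply, hopL_apply, hopOp_crossTR_odd, Pi.smul_apply, smul_eq_mul, smul_eq_mul, h']
    split_ifs
    · ring
    · simp

theorem card_insert_erase {V : Type*} [DecidableEq V] {S : Finset V} {j k : V} (hj : j ∈ S)
    (hk : k ∉ S) : (insert k (S.erase j)).card = S.card := by
  rw [Finset.card_insert_of_notMem fun h => hk (Finset.mem_of_mem_erase h),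
    Finset.card_erase_add_one hj]

/-- A symmetry of the cross, up to the gauge transformation `crossSign`. -/
def crossPerm : Equiv.Perm (Fin 12) where
  toFun := ![1, 3, 0, 2, 9, 8, 11, 10, 6, 7, 4, 5]
  invFun := ![2, 0, 3, 1, 10, 11, 8, 9, 5, 4, 7, 6]
  left_inv := by decide
  right_inv := by decide

/-- The gauge transformation that goes with `crossPerm`. -/
def crossSign (i : Fin 12) : ℤ := if i = 0 ∨ i = 4 ∨ i = 8 then -1 else 1

theorem crossT_crossPerm : ∀ i j, crossT (crossPerm i) (crossPerm j) =
    crossSign i * crossSign j * crossT i j := by decide +kernel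

/-- If symmetrising under particle-hole exchange kills φ, then φ is antisymmetric. The signed
quarter turn `crossPerm` anticommutes with the exchange, so it turns φ into a symmetric eigenvector
for the same E. -/
theorem exists_symmetric_eigenvector {φ : Finset (Fin 12) → ℝ} {E : ℝ} (h0 : φ ≠ 0)
    (h : hopL crossTR φ = E • φ) (hn : ∀ A, φ A ≠ 0 → A.card = 6) :
    ∃ ψ : Finset (Fin 12) → ℝ, ψ ≠ 0 ∧ hopL crossTR ψ = E • ψ ∧ (∀ A, ψ A ≠ 0 → A.card = 6) ∧
      ∀ A, ψ Aᶜ = ψ A := by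
  have h' : ∀ A, hopOp crossTR φ A = E * φ A := fun A => congrFun h A
  have hcompl : (hopL crossTR fun A => φ Aᶜ) = E • fun A => φ Aᶜ := by
    funext A
    rw [hopL_apply, hopOp_compl crossTR_symm, h']; rfl
  by_cases hz : φ + (fun A => φ Aᶜ) = 0
  · have hz' : ∀ A, φ Aᶜ = -φ A := fun A => by
      have := congrFun hz A
      simp only [Pi.add_apply, Pi.zero_apply] at this
      linarith
    have hs : ∀ i, (crossSign i : ℝ) * crossSign i = 1 := fun i => by
      have : crossSign i * crossSign i = 1 := by revert i; decide
      exact_mod_cast this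
    refine ⟨fun A => (∏ i ∈ A, (crossSign i : ℝ)) * φ (A.map crossPerm.toEmbedding), ?_, ?_, ?_, ?_⟩
    · obtain ⟨A, hA⟩ := Function.ne_iff.1 h0
      refine Function.ne_iff.2 ⟨A.map crossPerm.symm.toEmbedding, ?_⟩
      have hA' : (A.map crossPerm.symm.toEmbedding).map crossPerm.toEmbedding = A := by
        rw [Finset.map_map]; ext i; simp
      rw [hA']
      refine mul_ne_zero (Finset.prod_ne_zero_iff.2 fun i _ hi => ?_) hA
      have := hs i
      rw [hi] at this
      norm_num at this
    · funext A
      rw [hopL_apply, hopOp_signedPerm (T' := crossTR) crossPerm (fun i => (crossSign i : ℝ)) hs fun j k => by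
        rw [crossTR, crossT_crossPerm]; push_cast; rfl]
      rw [h', Pi.smul_apply, smul_eq_mul]
      ring
    · intro A hA
      have := hn _ (right_ne_zero_of_mul hA)
      rwa [Finset.card_map] at this
    · intro A
      -- Three of the twelve signs are negative. The products over a configuration and over its
      -- complement are thus opposite, which compensates the antisymmetry.
      have hp : (∏ i ∈ A, (crossSign i : ℝ)) * ∏ i ∈ Aᶜ, (crossSign i : ℝ) = -1 := by
        rw [Finset.prod_mul_prod_compl]
        have : ∏ i, crossSign i = -1 := by decide
        exact_mod_cast this
      have hq : (∏ i ∈ A, (crossSign i : ℝ)) * ∏ i ∈ A, (crossSign i : ℝ) = 1 := by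
        rw [← Finset.prod_mul_distrib]
        exact Finset.prod_eq_one fun i _ => hs i
      have hm : Aᶜ.map crossPerm.toEmbedding = (A.map crossPerm.toEmbedding)ᶜ := by
        ext i; simp
      simp only [hm, hz']
      have : ∏ i ∈ Aᶜ, (crossSign i : ℝ) = - ∏ i ∈ A, (crossSign i : ℝ) := by
        linear_combination (∏ i ∈ A, (crossSign i : ℝ)) * hp - (∏ i ∈ Aᶜ, (crossSign i : ℝ)) * hq
      rw [this]; ring
  · refine ⟨_, hz, by rw [map_add, h, hcompl, smul_add], fun A hA => ?_, fun A => ?_⟩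
    · by_cases hA' : φ A = 0
      · have : φ Aᶜ ≠ 0 := fun h => hA (by simp [hA', h])
        have := hn _ this
        rw [Finset.card_compl, Fintype.card_fin] at this
        have := Finset.card_le_univ A
        rw [Fintype.card_fin] at this
        omega
      · exact hn A hA'
    · simp [add_comm]

theorem eigen_sq_lt_of_card_le {φ : Finset (Fin 12) → ℝ} {E : ℝ} (h0 : φ ≠ 0)
    (h : hopL crossTR φ = E • φ) {n : ℕ} (hn : ∀ A, φ A ≠ 0 → A.card = n) (hn6 : n ≤ 6) :
    E ^ 2 < 5210054 / 100000 := by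
  by_cases hE : E = 0
  · rw [hE]; norm_num
  have hB : ∀ m, 576 ≤ digitBase ^ 2 ^ m := fun m =>
    le_trans (by norm_num [digitBase]) (Nat.le_self_pow (by positivity) _)
  have hsup : ∀ {ψ : Finset (Fin 12) → ℝ} {n : ℕ}, (∀ A, ψ A ≠ 0 → A.card = n) → ∀ A,
      (if par A = 0 then ψ A else 0) ≠ 0 → A.card = n ∧ par A = 0 := by
    intro ψ n hn A hA
    split_ifs at hA with hp
    · exact ⟨hn A hA, hp⟩
    · exact absurd rfl hA
  obtain rfl | hn5 := hn6.eq_or_lt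
  · obtain ⟨ψ, hψ0, hψ, hψn, hψC⟩ := exists_symmetric_eigenvector h0 h hn
    obtain ⟨h1, h2⟩ := exists_even_eigenvector hψ0 hE hψ
    convert halfSector_bound (x := E ^ 2) (φ := fun A => if par A = 0 then ψ A else 0) ?_ ?_ ?_ ?_
    · convert h1
    · exact hsup hψn
    · intro A; simp only [par_compl, hψC]
    · convert h2
  · obtain ⟨h1, h2⟩ := exists_even_eigenvector h0 hE h
    have h1' : (fun A => if par A = 0 then φ A else 0) ≠ 0 := by convert h1
    have h2' : hopL crossTR (hopL crossTR fun A => if par A = 0 then φ A else 0) =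
        E ^ 2 • fun A => if par A = 0 then φ A else 0 := by convert h2
    interval_cases n
    · exact sector_bound h1' (hsup hn) h2' length_sector_zero (hB _) chebTrace_sector_zero
    · exact sector_bound h1' (hsup hn) h2' length_sector_one (hB _) chebTrace_sector_one
    · exact sector_bound h1' (hsup hn) h2' length_sector_two (hB _) chebTrace_sector_two
    · exact sector_bound h1' (hsup hn) h2' length_sector_three (hB _) chebTrace_sector_three
    · exact sector_bound h1' (hsup hn) h2' length_sector_four (hB _) chebTrace_sector_four
    · exact sector_bound h1' (hsup hn) h2' length_sector_five (hB _) chebTrace_sector_five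

/-- A nonvanishing component of fixed particle number is again an eigenvector; more than six
particles are traded for fewer than six holes. -/
theorem cross_eigen_sq_lt {φ : Finset (Fin 12) → ℝ} {E : ℝ} (h0 : φ ≠ 0)
    (h : hopL crossTR φ = E • φ) : E ^ 2 < 5210054 / 100000 := by
  have h' : ∀ A, hopOp crossTR φ A = E * φ A := fun A => congrFun h A
  obtain ⟨A, hA⟩ := Function.ne_iff.1 h0
  have heq : (hopL crossTR fun B => if B.card = A.card then φ B else 0) =
      E • fun B => if B.card = A.card then φ B else 0 := by
    funext B
    rw [hopL_apply]
    rw [hopOp_ite (p := fun B => B.card = A.card) (q := fun B => B.card = A.card) _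
      (fun j k S _ hj hk => by rw [card_insert_erase hj hk]), h', Pi.smul_apply, smul_eq_mul]
    split_ifs <;> simp
  have hne : (fun B => if B.card = A.card then φ B else 0) ≠ 0 :=
    Function.ne_iff.2 ⟨A, by simpa using hA⟩
  have hsupp : ∀ B, (if B.card = A.card then φ B else 0) ≠ 0 → B.card = A.card := by
    intro B hB
    by_contra hc
    simp [hc] at hB
  by_cases h6 : A.card ≤ 6
  · exact eigen_sq_lt_of_card_le hne heq hsupp h6
  · have hc : ∀ B : Finset (Fin 12), Bᶜ.card + B.card = 12 := fun B => by
      rw [Finset.card_compl_add_card, Fintype.card_fin]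
    refine eigen_sq_lt_of_card_le (n := Aᶜ.card)
      (φ := fun B => if Bᶜ.card = A.card then φ Bᶜ else 0) ?_ ?_ ?_ ?_
    · exact Function.ne_iff.2 ⟨Aᶜ, by simpa using hA⟩
    · funext B
      rw [hopL_apply, hopOp_compl crossTR_symm (fun B => if B.card = A.card then φ B else 0)]
      exact congrFun heq Bᶜ
    · intro B hB
      have := hsupp _ hB
      have := hc A
      have := hc B
      omega
    · have := hc A
      omega

/-- Let x = Mw and l = 7.218069. As w is even and x is odd, the cross terms vanish: ψ = x + lw has
squared norm ‖x‖² + l²‖w‖² and expectation 2l‖x‖². From ‖x‖ ≥ l‖w‖ the quotient is at least l. A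
bound on the norm of Mw, which is quadratic in M, thus becomes one on the top of the spectrum. -/
theorem exists_cross_trial : ∃ ψ : Finset (Fin 12) → ℝ, ψ ≠ 0 ∧
    7218069 / 1000000 * ∑ A, ψ A ^ 2 ≤ ∑ A, ψ A * hopOp crossTR ψ A := by
  set w : Finset (Fin 12) → ℝ := fun A => (trialF (toBits A) : ℝ) with hw
  set x : Finset (Fin 12) → ℝ := hopOp crossTR w with hx
  set l : ℝ := 7218069 / 1000000 with hl
  obtain ⟨hpos, hle⟩ := trialF_spec
  have hwp : 0 < ∑ A, w A ^ 2 := by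
    rw [← sum_toBits fun t => trialF t ^ 2] at hpos
    have := Int.cast_pos (R := ℝ).2 hpos
    rw [Int.cast_sum] at this
    simpa only [Int.cast_pow] using this
  have hxx : ∀ A, x A = (hamF crossBonds trialF (toBits A) : ℤ) := hopOp_crossTR trialF
  have hxw : l ^ 2 * ∑ A, w A ^ 2 ≤ ∑ A, x A ^ 2 := by
    rw [← sum_toBits fun t => trialF t ^ 2, ← sum_toBits fun t => hamF crossBonds trialF t ^ 2]
      at hle
    have h2 : (7218069 : ℝ) ^ 2 * ∑ A, w A ^ 2 ≤ 10 ^ 12 * ∑ A, x A ^ 2 := by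
      have := Int.cast_le (R := ℝ).2 hle
      rw [Int.cast_mul, Int.cast_mul, Int.cast_sum, Int.cast_sum] at this
      simp only [Int.cast_pow, Int.cast_ofNat, ← hxx] at this
      exact this
    rw [hl]
    linarith
  have hwe : ∀ A, par A ≠ 0 → w A = 0 := fun A hA => by
    have : oddOn evenSites (toBits A) = true := by
      by_contra h
      exact hA ((oddOn_toBits_eq_false A).1 (by simpa using h))
    simp [hw, trialF_eq_zero (length_toBits A) this]
  have hwe' : w = fun A => if par A = 0 then w A else 0 := by
    funext A
    split_ifs with h
    · rfl
    · exact hwe A h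
  have hxo : ∀ A, par A ≠ 1 → x A = 0 := fun A hA => by
    rw [hx, hwe']
    convert (hopOp_crossTR_even w A).trans (if_neg hA)
  have hxo' : x = fun A => if par A = 1 then x A else 0 := by
    funext A
    split_ifs with h
    · rfl
    · exact hxo A h
  have hyo : ∀ A, par A ≠ 0 → hopOp crossTR x A = 0 := fun A hA => by
    rw [hxo']
    convert (hopOp_crossTR_odd x A).trans (if_neg hA)
  have hne : (0 : ZMod 2) ≠ 1 := by decide
  have hz1 : ∀ A, w A * x A = 0 := fun A => by
    by_cases h : par A = 0
    · rw [hxo A (by rw [h]; exact hne), mul_zero]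
    · rw [hwe A h, zero_mul]
  have hz2 : ∀ A, x A * hopOp crossTR x A = 0 := fun A => by
    by_cases h : par A = 0
    · rw [hxo A (by rw [h]; exact hne), zero_mul]
    · rw [hyo A h, mul_zero]
  have hM : ∀ A, hopOp crossTR (x + l • w) A = hopOp crossTR x A + l * x A := fun A => by
    have := congrFun ((hopL crossTR).map_add x (l • w)) A
    rw [map_smul] at this
    exact this
  have hsym : ∑ A, w A * hopOp crossTR x A = ∑ A, x A ^ 2 := by
    rw [sum_mul_hopOp crossTR_symm]
    exact Finset.sum_congr rfl fun A _ => (sq _).symm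
  have e1 : ∑ A, (x + l • w) A ^ 2 = ∑ A, x A ^ 2 + l ^ 2 * ∑ A, w A ^ 2 := by
    rw [Finset.mul_sum, ← Finset.sum_add_distrib]
    refine Finset.sum_congr rfl fun A _ => ?_
    simp only [Pi.add_apply, Pi.smul_apply, smul_eq_mul]
    linear_combination 2 * l * hz1 A
  have e2 : ∑ A, (x + l • w) A * hopOp crossTR (x + l • w) A = 2 * l * ∑ A, x A ^ 2 := by
    have : ∀ A, (x + l • w) A * hopOp crossTR (x + l • w) A =
        l * x A ^ 2 + l * (w A * hopOp crossTR x A) := fun A => by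
      rw [hM]
      simp only [Pi.add_apply, Pi.smul_apply, smul_eq_mul]
      linear_combination hz2 A + l ^ 2 * hz1 A
    simp only [this, Finset.sum_add_distrib, ← Finset.mul_sum, hsym]
    ring
  have hl0 : 0 < l := by rw [hl]; norm_num
  have hx0 : 0 ≤ ∑ A, x A ^ 2 := Finset.sum_nonneg fun A _ => sq_nonneg _
  refine ⟨x + l • w, ?_, ?_⟩
  · intro h
    have : ∑ A, (x + l • w) A ^ 2 = 0 := by rw [h]; simp
    rw [e1] at this
    have := mul_pos (pow_pos hl0 2) hwp
    linarith
  · rw [e1, e2]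
    revert hxw
    generalize ∑ A, x A ^ 2 = X, ∑ A, w A ^ 2 = W
    clear_value l
    intro hxw
    have := mul_le_mul_of_nonneg_left hxw hl0.le
    linarith

/-! ### The variational principle -/

section GroundEnergy
variable {n : Type} [Fintype n] [DecidableEq n]

theorem exists_eigenvector_groundEnergy [Nonempty n] {H : Matrix n n ℂ} (hH : H.IsHermitian) :
    ∃ ψ : n → ℂ, ψ ≠ 0 ∧ H *ᵥ ψ = (groundEnergy H : ℂ) • ψ := by
  obtain ⟨ψ, hψ⟩ := (groundEnergy_isLeast hH).1.exists_hasEigenvector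
  exact ⟨ψ, hψ.2, by simpa [Matrix.toLin'_apply] using hψ.apply_eq_smul⟩

-- Every eigenvalue of H minus its ground energy, raised by that energy, is an eigenvalue of H, so
-- the difference is positive semidefinite.
open scoped ComplexOrder in
theorem groundEnergy_mul_le [Nonempty n] {H : Matrix n n ℂ} (hH : H.IsHermitian) (ψ : n → ℂ) :
    groundEnergy H * (star ψ ⬝ᵥ ψ).re ≤ (star ψ ⬝ᵥ (H *ᵥ ψ)).re := by
  have hK : (H - (groundEnergy H : ℂ) • (1 : Matrix n n ℂ)).IsHermitian := by
    refine hH.sub ?_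
    rw [Matrix.IsHermitian, Matrix.conjTranspose_smul, Matrix.conjTranspose_one]
    simp
  have hpos : (H - (groundEnergy H : ℂ) • (1 : Matrix n n ℂ)).PosSemidef := by
    rw [hK.posSemidef_iff_eigenvalues_nonneg]
    intro i
    have h1 := hK.mulVec_eigenvectorBasis i
    have h2 : H *ᵥ (hK.eigenvectorBasis i).ofLp =
        ((hK.eigenvalues i + groundEnergy H : ℝ) : ℂ) • (hK.eigenvectorBasis i).ofLp := by
      rw [Matrix.sub_mulVec, Matrix.smul_mulVec, Matrix.one_mulVec, sub_eq_iff_eq_add] at h1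
      rw [h1]
      push_cast
      rw [add_smul]
      rfl
    have h3 : Module.End.HasEigenvalue (Matrix.toLin' H)
        ((hK.eigenvalues i + groundEnergy H : ℝ) : ℂ) := by
      refine Module.End.hasEigenvalue_of_hasEigenvector (x := (hK.eigenvectorBasis i).ofLp)
        ⟨Module.End.mem_eigenspace_iff.2 (by rw [Matrix.toLin'_apply, h2]), fun h => ?_⟩
      exact hK.eigenvectorBasis.orthonormal.ne_zero i (by ext j; exact congrFun h j)
    have := (groundEnergy_isLeast hH).2 h3
    simp only [Pi.zero_apply]
    linarith
  have := hpos.re_dotProduct_nonneg ψ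
  rw [Matrix.sub_mulVec, Matrix.smul_mulVec, Matrix.one_mulVec, dotProduct_sub, dotProduct_smul]
    at this
  simp only [map_sub, RCLike.re_to_complex, smul_eq_mul, Complex.re_ofReal_mul] at this
  linarith

end GroundEnergy

/-! ### Hard-core bosons in terms of the hopping operator -/

section Boson
variable {V : Type} [Fintype V] [DecidableEq V]

theorem bosonAnn_mulVec (k : V) (ψ : Finset V → ℂ) (U : Finset V) :
    (bosonAnn k *ᵥ ψ) U = if k ∈ U then 0 else ψ (insert k U) := by
  simp only [Matrix.mulVec, dotProduct, bosonAnn, ite_mul, one_mul, zero_mul]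
  split_ifs with h
  · refine Finset.sum_eq_zero fun S _ => if_neg ?_
    rintro ⟨_, rfl⟩
    exact Finset.notMem_erase k S h
  · rw [Finset.sum_eq_single (insert k U)]
    · simp [Finset.erase_insert h]
    · rintro S _ hS
      refine if_neg ?_
      rintro ⟨h1, rfl⟩
      exact hS (Finset.insert_erase h1).symm
    · simp

theorem bosonAnn_conjTranspose_mulVec (j : V) (ψ : Finset V → ℂ) (S : Finset V) :
    ((bosonAnn j)ᴴ *ᵥ ψ) S = if j ∈ S then ψ (S.erase j) else 0 := by
  simp only [Matrix.mulVec, dotProduct, bosonAnn, Matrix.conjTranspose_apply, RCLike.star_def,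
    apply_ite (starRingEnd ℂ), map_one, map_zero, ite_mul, one_mul, zero_mul]
  split_ifs with h
  · simp [h]
  · simp [h]

/-- `hopOp` has no terms that return a particle to its own site; this is where the diagonal of t
must vanish. -/
theorem bosonHamiltonian_mulVec {t : V → V → ℝ} (ht : ∀ j, t j j = 0) (ψ : Finset V → ℂ)
    (S : Finset V) :
    (bosonHamiltonian t 0 *ᵥ ψ) S = -hopOp (fun j k => (t j k : ℂ)) ψ S := by
  rw [bosonHamiltonian, hamiltonian, Complex.ofReal_zero, zero_smul, sub_zero, Matrix.neg_mulVec,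
    Pi.neg_apply, Matrix.sum_mulVec, Finset.sum_apply, hopOp]
  congr 1
  refine Finset.sum_congr rfl fun j _ => ?_
  rw [Matrix.sum_mulVec, Finset.sum_apply]
  refine Finset.sum_congr rfl fun k _ => ?_
  rw [Matrix.smul_mulVec, Pi.smul_apply, ← Matrix.mulVec_mulVec, bosonAnn_conjTranspose_mulVec,
    bosonAnn_mulVec, smul_eq_mul]
  by_cases hjk : j = k
  · subst hjk
    simp [ht]
  · by_cases hj : j ∈ S <;> by_cases hk : k ∈ S <;> simp [hj, hk, Ne.symm hjk]

theorem hopOp_ofReal (t : V → V → ℝ) (φ : Finset V → ℝ) (S : Finset V) :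
    hopOp (fun j k => (t j k : ℂ)) (fun S => (φ S : ℂ)) S = (hopOp t φ S : ℝ) := by
  simp only [hopOp, Complex.ofReal_sum]
  refine Finset.sum_congr rfl fun j _ => Finset.sum_congr rfl fun k _ => ?_
  split_ifs <;> simp

theorem re_hopOp (t : V → V → ℝ) (ψ : Finset V → ℂ) (S : Finset V) :
    (hopOp (fun j k => (t j k : ℂ)) ψ S).re = hopOp t (fun S => (ψ S).re) S := by
  simp only [hopOp, Complex.re_sum]
  refine Finset.sum_congr rfl fun j _ => Finset.sum_congr rfl fun k _ => ?_
  split_ifs <;> simp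

theorem im_hopOp (t : V → V → ℝ) (ψ : Finset V → ℂ) (S : Finset V) :
    (hopOp (fun j k => (t j k : ℂ)) ψ S).im = hopOp t (fun S => (ψ S).im) S := by
  simp only [hopOp, Complex.im_sum]
  refine Finset.sum_congr rfl fun j _ => Finset.sum_congr rfl fun k _ => ?_
  split_ifs <;> simp

theorem bosonHamiltonian_isHermitian {t : V → V → ℝ} (hs : ∀ j k, t j k = t k j) :
    (bosonHamiltonian t 0).IsHermitian :=
  hamiltonian_isHermitian _ t hs 0

/-- The matrix is real, so the real and imaginary parts of an eigenvector satisfy the same equation,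
and one of them is nonzero. -/
theorem exists_real_groundstate {t : V → V → ℝ} (hs : ∀ j k, t j k = t k j) (ht : ∀ j, t j j = 0) :
    ∃ φ : Finset V → ℝ, φ ≠ 0 ∧
      ∀ S, hopOp t φ S = -groundEnergy (bosonHamiltonian t 0) * φ S := by
  obtain ⟨ψ, h0, hψ⟩ := exists_eigenvector_groundEnergy (bosonHamiltonian_isHermitian hs)
  have h : ∀ S, hopOp (fun j k => (t j k : ℂ)) ψ S =
      ((-groundEnergy (bosonHamiltonian t 0) : ℝ) : ℂ) * ψ S := fun S => by
    have := congrFun hψ S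
    rw [bosonHamiltonian_mulVec ht, Pi.smul_apply, smul_eq_mul] at this
    push_cast
    linear_combination -this
  by_cases hre : (fun S => (ψ S).re) = 0
  · refine ⟨fun S => (ψ S).im, fun him => h0 (funext fun S => ?_), fun S => ?_⟩
    · exact Complex.ext (congrFun hre S) (congrFun him S)
    · rw [← im_hopOp, h, Complex.im_ofReal_mul]
  · exact ⟨fun S => (ψ S).re, hre, fun S => by rw [← re_hopOp, h, Complex.re_ofReal_mul]⟩

theorem groundEnergy_mul_sum_sq_le {t : V → V → ℝ} (hs : ∀ j k, t j k = t k j)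
    (ht : ∀ j, t j j = 0) (φ : Finset V → ℝ) :
    groundEnergy (bosonHamiltonian t 0) * ∑ S, φ S ^ 2 ≤ -∑ S, φ S * hopOp t φ S := by
  have h := groundEnergy_mul_le (bosonHamiltonian_isHermitian hs) fun S => (φ S : ℂ)
  have h1 : ∀ S, (bosonHamiltonian t 0 *ᵥ fun S => (φ S : ℂ)) S = ((-hopOp t φ S : ℝ) : ℂ) :=
    fun S => by rw [bosonHamiltonian_mulVec ht, hopOp_ofReal]; push_cast; rfl
  simp only [dotProduct, h1, Pi.star_apply, RCLike.star_def, Complex.conj_ofReal,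
    ← Complex.ofReal_mul, ← Complex.ofReal_sum, Complex.ofReal_re] at h
  simpa [sq] using h

end Boson

/-! ### Clusters inside a larger system -/

section Embedding
variable {V W : Type*} [Fintype V] [DecidableEq V] [Fintype W] [DecidableEq W]

/-- Hopping within an embedded cluster, at a fixed configuration outside of it. -/
theorem hopOp_map_union {R : Type*} [CommRing R] {T : V → V → R} (e : W ↪ V)
    (hT : ∀ j k, T j k ≠ 0 → j ∈ Set.range e ∧ k ∈ Set.range e) (φ : Finset V → R)
    {Q : Finset V} (hQ : ∀ i, e i ∉ Q) (A : Finset W) :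
    hopOp T φ (A.map e ∪ Q) = hopOp (fun i j => T (e i) (e j)) (fun A => φ (A.map e ∪ Q)) A := by
  have hmem : ∀ i, e i ∈ A.map e ∪ Q ↔ i ∈ A := fun i => by simp [hQ]
  have hred : ∀ f : V → R, (∀ j, j ∉ Set.range e → f j = 0) → ∑ j, f j = ∑ i, f (e i) := by
    intro f hf
    rw [← Finset.sum_map Finset.univ e f]
    refine (Finset.sum_subset (Finset.subset_univ _) fun j _ hj => hf j fun ⟨i, hi⟩ => ?_).symm
    exact hj (Finset.mem_map.2 ⟨i, Finset.mem_univ _, hi⟩)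
  rw [hopOp, hopOp, hred _ fun j hj => Finset.sum_eq_zero fun k _ => ?_]
  · refine Finset.sum_congr rfl fun i _ => ?_
    rw [hred _ fun k hk => ?_]
    · refine Finset.sum_congr rfl fun k _ => ?_
      simp only [hmem]
      split_ifs with h
      · congr 2
        ext v
        simp only [Finset.mem_insert, Finset.mem_erase, Finset.mem_union, Finset.mem_map]
        constructor
        · rintro (rfl | ⟨h1, ⟨w, hw, rfl⟩ | h2⟩)
          · exact Or.inl ⟨k, Or.inl rfl, rfl⟩
          · exact Or.inl ⟨w, Or.inr ⟨fun hwi => h1 (hwi ▸ rfl), hw⟩, rfl⟩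
          · exact Or.inr h2
        · rintro (⟨w, rfl | ⟨h1, h2⟩, rfl⟩ | h2)
          · exact Or.inl rfl
          · exact Or.inr ⟨fun h => h1 (e.injective h), Or.inl ⟨w, h2, rfl⟩⟩
          · exact Or.inr ⟨fun h => hQ i (h ▸ h2), Or.inr h2⟩
      · rfl
    · have : T (e i) k = 0 := by
        by_contra h
        exact hk (hT _ _ h).2
      simp [this]
  · have : T j k = 0 := by
      by_contra h
      exact hj (hT _ _ h).1
    simp [this]

end Embedding

/-- For a cluster state extended by zero, with no particles outside, sums over all configurations
reduce to the cluster. The general `F` covers both the norm and the energy. -/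
theorem sum_extend_map {V W : Type*} [Fintype V] [Fintype W] (e : W ↪ V) (ψ : Finset W → ℝ) (F : ℝ → Finset V → ℝ) (hF : ∀ S, F 0 S = 0) :
    ∑ S, F (Function.extend (Finset.map e) ψ 0 S) S = ∑ A, F (ψ A) (A.map e) := by
  have hinj : Function.Injective (Finset.map e) := Finset.map_injective e
  rw [show ∑ A, F (ψ A) (A.map e) = ∑ A, (fun S => F (Function.extend (Finset.map e) ψ 0 S) S)
    (A.map e) from Finset.sum_congr rfl fun A _ => by simp only [hinj.extend_apply]]
  refine Eq.trans ?_ (Finset.sum_map Finset.univ ⟨Finset.map e, hinj⟩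
    (fun S => F (Function.extend (Finset.map e) ψ 0 S) S))
  refine (Finset.sum_subset (Finset.subset_univ _) fun S _ hS => ?_).symm
  rw [Function.extend_apply', Pi.zero_apply, hF]
  rintro ⟨A, rfl⟩
  exact hS (Finset.mem_map.2 ⟨A, Finset.mem_univ _, rfl⟩)

/-- The ground-state energy of a cluster that is a cross with amplitudes one half, up to a gauge
transformation. -/
theorem abs_groundEnergy_cluster_le {V : Type} [Fintype V] [DecidableEq V] {T : V → V → ℝ}
    (hs : ∀ j k, T j k = T k j) (ht : ∀ j, T j j = 0) (e : Fin 12 ↪ V)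
    (hT : ∀ j k, T j k ≠ 0 → j ∈ Set.range e ∧ k ∈ Set.range e) (η : Fin 12 → ℝ)
    (hη : ∀ i, η i * η i = 1) (hTe : ∀ i j, 2 * T (e i) (e j) = η i * η j * crossTR i j) :
    |groundEnergy (bosonHamiltonian T 0) - (-3.609035)| ≤ 0.0000005 := by
  have hgauge : ∀ (ψ : Finset (Fin 12) → ℝ) A,
      hopOp crossTR (fun A => (∏ i ∈ A, η i) * ψ A) A =
        (∏ i ∈ A, η i) * (2 * hopOp (fun i j => T (e i) (e j)) ψ A) := by
    intro ψ A
    have := hopOp_signedPerm (T := crossTR) (T' := fun i j => 2 * T (e i) (e j)) (Equiv.refl _) η hη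
      hTe ψ A
    simp only [Equiv.refl_toEmbedding, Finset.map_refl] at this
    rw [this]
    congr 1
    simp only [hopOp, Finset.mul_sum]
    exact Finset.sum_congr rfl fun i _ => Finset.sum_congr rfl fun j _ => by
      split_ifs
      · ring
      · simp
  have hP : ∀ A : Finset (Fin 12), (∏ i ∈ A, η i) * ∏ i ∈ A, η i = 1 := fun A => by
    rw [← Finset.prod_mul_distrib]
    exact Finset.prod_eq_one fun i _ => hη i
  -- The cluster never moves particles outside it. Freezing the exterior of a configuration at which
  -- the ground state does not vanish leaves a nonzero eigenvector on the 12 sites.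
  have hlow : (2 * groundEnergy (bosonHamiltonian T 0)) ^ 2 < 5210054 / 100000 := by
    obtain ⟨φ, h0, hφ⟩ := exists_real_groundstate hs ht
    obtain ⟨S, hS⟩ := Function.ne_iff.1 h0
    set A₀ : Finset (Fin 12) := Finset.univ.filter fun i => e i ∈ S with hA₀
    set Q : Finset V := S \ Finset.univ.map e with hQ
    have hSA : A₀.map e ∪ Q = S := by
      ext v
      simp only [hA₀, hQ, Finset.mem_union, Finset.mem_map, Finset.mem_filter, Finset.mem_univ,
        true_and, Finset.mem_sdiff, not_exists]
      constructor
      · rintro (⟨i, hi, rfl⟩ | h)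
        · exact hi
        · exact h.1
      · intro hv
        by_cases h : ∃ i, e i = v
        · obtain ⟨i, rfl⟩ := h
          exact Or.inl ⟨i, hv, rfl⟩
        · exact Or.inr ⟨hv, fun i hi => h ⟨i, hi⟩⟩
    have hQ' : ∀ i, e i ∉ Q := fun i h => by simp [hQ] at h
    have hE : hopL crossTR (fun A => (∏ i ∈ A, η i) * φ (A.map e ∪ Q)) =
        (-(2 * groundEnergy (bosonHamiltonian T 0))) •
          fun A => (∏ i ∈ A, η i) * φ (A.map e ∪ Q) := by
      funext A
      rw [hopL_apply, hgauge, ← hopOp_map_union e hT φ hQ', hφ, Pi.smul_apply, smul_eq_mul]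
      ring
    have := cross_eigen_sq_lt (φ := fun A => (∏ i ∈ A, η i) * φ (A.map e ∪ Q)) ?_ hE
    · linarith
    · refine Function.ne_iff.2 ⟨A₀, mul_ne_zero (fun h => ?_) ?_⟩
      · have := hP A₀
        rw [h] at this
        norm_num at this
      · rw [hSA]; exact hS
  -- The trial state of the cross is transported by the gauge transformation and extended by empty
  -- sites.
  have hup : groundEnergy (bosonHamiltonian T 0) ≤ -(7218069 / 2000000) := by
    obtain ⟨ψ, h0, hψ⟩ := exists_cross_trial
    set χ : Finset (Fin 12) → ℝ := fun A => (∏ i ∈ A, η i) * ψ A with hχ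
    have hψχ : ψ = fun A => (∏ i ∈ A, η i) * χ A := by
      funext A
      rw [hχ]
      linear_combination -ψ A * hP A
    have h1 := groundEnergy_mul_sum_sq_le hs ht (Function.extend (Finset.map e) χ 0)
    rw [sum_extend_map e χ (fun x _ => x ^ 2) (by simp),
      sum_extend_map e χ (fun x S => x * hopOp T (Function.extend (Finset.map e) χ 0) S)
        (by simp)] at h1
    have h2 : ∀ A, χ A * hopOp T (Function.extend (Finset.map e) χ 0) (A.map e) =
        (1 / 2) * (ψ A * hopOp crossTR ψ A) := by
      intro A
      have := hopOp_map_union e hT (Function.extend (Finset.map e) χ 0) (Q := ∅) (by simp) A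
      simp only [Finset.union_empty, (Finset.map_injective e).extend_apply] at this
      rw [this]
      have h3 : ψ A = (∏ i ∈ A, η i) * χ A := congrFun hψχ A
      rw [h3, hψχ, hgauge χ A]
      linear_combination (-χ A * hopOp (fun i j => T (e i) (e j)) χ A) * hP A
    have h3 : ∀ A, χ A ^ 2 = ψ A ^ 2 := fun A => by
      rw [hχ]
      linear_combination ψ A ^ 2 * hP A
    simp only [h2, h3, ← Finset.mul_sum] at h1
    have hpos := sum_sq_pos h0
    by_contra hlt
    push Not at hlt
    have := mul_lt_mul_of_pos_right hlt hpos
    linarith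
  rw [abs_le]
  constructor
  -- Here 7.218071² > 52.10054, and half of 7.218071 is 3.6090355.
  · have : |2 * groundEnergy (bosonHamiltonian T 0)| < 7.218071 :=
      abs_lt_of_sq_lt_sq (by norm_num at hlow ⊢; linarith) (by norm_num)
    have := (abs_lt.1 this).1
    norm_num at this ⊢
    linarith
  · norm_num at hup ⊢
    linarith

/-! ## Crosses on the torus -/

section Shift
variable {Lx Ly : ℕ}

/-- The translation by an integer vector. -/
def shift (v : ℤ × ℤ) : Site Lx Ly := ((v.1 : ZMod Lx), (v.2 : ZMod Ly))

theorem shift_add (v w : ℤ × ℤ) : (shift (v + w) : Site Lx Ly) = shift v + shift w := by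
  simp [shift]

theorem shift_neg (v : ℤ × ℤ) : (shift (-v) : Site Lx Ly) = -shift v := by
  simp [shift]

theorem ex_eq_shift : (ex : Site Lx Ly) = shift (1, 0) := by simp [ex, shift]

theorem ey_eq_shift : (ey : Site Lx Ly) = shift (0, 1) := by simp [ey, shift]

theorem intCast_inj_of_abs_lt {L : ℕ} {m n : ℤ} (h : |m - n| < L)
    (hmn : (m : ZMod L) = n) : m = n := by
  rw [← sub_eq_zero]
  refine Int.eq_zero_of_abs_lt_dvd ?_ h
  exact (ZMod.intCast_eq_intCast_iff_dvd_sub n m L).1 hmn.symm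

/-- A cross is four sites wide in each direction, so displacements within it differ by at most 3 per
coordinate and cannot be identified by wrapping once the sides are at least 4. -/
theorem shift_inj (hx : 4 ≤ Lx) (hy : 4 ≤ Ly) {v w : ℤ × ℤ} (h1 : |v.1 - w.1| ≤ 3)
    (h2 : |v.2 - w.2| ≤ 3) (h : (shift v : Site Lx Ly) = shift w) : v = w := by
  obtain ⟨ha, hb⟩ := Prod.ext_iff.1 h
  exact Prod.ext (intCast_inj_of_abs_lt (by omega) ha) (intCast_inj_of_abs_lt (by omega) hb)

/-- The steps to the nearest neighbours. -/
def steps : Finset (ℤ × ℤ) := {(1, 0), (-1, 0), (0, 1), (0, -1)}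

theorem isNeighbour_iff {j k : Site Lx Ly} : IsNeighbour j k ↔ ∃ w ∈ steps, k = j + shift w := by
  have h1 : (shift (-1, 0) : Site Lx Ly) = -ex := by rw [ex_eq_shift, ← shift_neg]; rfl
  have h2 : (shift (0, -1) : Site Lx Ly) = -ey := by rw [ey_eq_shift, ← shift_neg]; rfl
  simp only [IsNeighbour, steps, Finset.mem_insert, Finset.mem_singleton, exists_eq_or_imp,
    exists_eq_left, h1, h2, ← ex_eq_shift, ← ey_eq_shift, sub_eq_add_neg]

theorem isNeighbour_add_shift (hx : 4 ≤ Lx) (hy : 4 ≤ Ly) {j : Site Lx Ly} {v : ℤ × ℤ}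
    (h1 : |v.1| ≤ 1) (h2 : |v.2| ≤ 1) : IsNeighbour j (j + shift v) ↔ v ∈ steps := by
  rw [isNeighbour_iff]
  refine ⟨?_, fun h => ⟨v, h, rfl⟩⟩
  rintro ⟨w, hw, h⟩
  have hw' := (by decide : ∀ w ∈ steps, |w.1| ≤ 1 ∧ |w.2| ≤ 1) w hw
  rw [abs_le] at h1 h2 hw'
  rw [abs_le] at hw'
  rw [shift_inj hx hy (abs_le.2 ⟨by omega, by omega⟩) (abs_le.2 ⟨by omega, by omega⟩)
    (add_left_cancel h)]
  exact hw

/-- The corners of a plaquette. -/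
def corner : Fin 4 → ℤ × ℤ := ![(0, 0), (1, 0), (0, 1), (1, 1)]

/-- The positions of the plaquettes of a cross. -/
def arm : Fin 5 → ℤ × ℤ := ![(0, 0), (1, 0), (-1, 0), (0, 1), (0, -1)]

/-- The positions of the sites of a cross. -/
def crossPos : Fin 12 → ℤ × ℤ :=
  ![(0, 0), (1, 0), (0, 1), (1, 1), (-1, 0), (-1, 1), (2, 0), (2, 1), (0, -1), (1, -1), (0, 2),
    (1, 2)]

/-- The sites of the plaquettes of a cross. -/
def armCorner : Fin 5 → Fin 4 → Fin 12 :=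
  ![![0, 1, 2, 3], ![1, 6, 3, 7], ![4, 0, 5, 2], ![2, 3, 10, 11], ![8, 9, 0, 1]]

theorem crossPos_armCorner : ∀ p c, crossPos (armCorner p c) = arm p + corner c := by decide

theorem mem_plaquette {p j : Site Lx Ly} : j ∈ plaquette p ↔ ∃ c, j = p + shift (corner c) := by
  have h0 : (shift (0, 0) : Site Lx Ly) = 0 := by simp [shift]
  have h1 : (shift (1, 1) : Site Lx Ly) = ex + ey := by
    rw [ex_eq_shift, ey_eq_shift, ← shift_add]; rfl
  simp only [plaquette, Finset.mem_insert, Finset.mem_singleton, Fin.exists_fin_succ, corner]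
  simp [h0, h1, ← ex_eq_shift, ← ey_eq_shift, add_assoc]

theorem mem_crossPlaquettes {a p : Site Lx Ly} :
    p ∈ crossPlaquettes a ↔ ∃ q, p = a + shift (arm q) := by
  have h0 : (shift (0, 0) : Site Lx Ly) = 0 := by simp [shift]
  have h1 : (shift (-1, 0) : Site Lx Ly) = -ex := by rw [ex_eq_shift, ← shift_neg]; rfl
  have h2 : (shift (0, -1) : Site Lx Ly) = -ey := by rw [ey_eq_shift, ← shift_neg]; rfl
  simp only [crossPlaquettes, Finset.mem_insert, Finset.mem_singleton, Fin.exists_fin_succ, arm]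
  simp [h0, h1, h2, ← ex_eq_shift, ← ey_eq_shift, sub_eq_add_neg]

/-- The sites of the cross with central plaquette `a`. -/
def crossSite (hx : 4 ≤ Lx) (hy : 4 ≤ Ly) (a : Site Lx Ly) : Fin 12 ↪ Site Lx Ly where
  toFun i := a + shift (crossPos i)
  inj' i j h := by
    have hb : ∀ i j, |(crossPos i).1 - (crossPos j).1| ≤ 3 ∧ |(crossPos i).2 - (crossPos j).2| ≤ 3 := by
      decide
    have hp : ∀ i j, crossPos i = crossPos j → i = j := by decide
    exact hp i j (shift_inj hx hy (hb i j).1 (hb i j).2 (add_left_cancel h))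

theorem crossSite_armCorner (hx : 4 ≤ Lx) (hy : 4 ≤ Ly) (a : Site Lx Ly) (p : Fin 5) (c : Fin 4) :
    crossSite hx hy a (armCorner p c) = a + shift (arm p) + shift (corner c) := by
  change a + shift (crossPos (armCorner p c)) = _
  rw [crossPos_armCorner, shift_add, add_assoc]

theorem exists_mem_crossPlaquettes (hx : 4 ≤ Lx) (hy : 4 ≤ Ly) {a j k : Site Lx Ly} :
    (∃ p ∈ crossPlaquettes a, j ∈ plaquette p ∧ k ∈ plaquette p) ↔
      ∃ p c d, j = crossSite hx hy a (armCorner p c) ∧ k = crossSite hx hy a (armCorner p d) := by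
  simp only [crossSite_armCorner, mem_crossPlaquettes, mem_plaquette]
  constructor
  · rintro ⟨_, ⟨q, rfl⟩, ⟨c, rfl⟩, ⟨d, rfl⟩⟩
    exact ⟨q, c, d, rfl, rfl⟩
  · rintro ⟨q, c, d, rfl, rfl⟩
    exact ⟨_, ⟨q, rfl⟩, ⟨c, rfl⟩, ⟨d, rfl⟩⟩

theorem card_crossSites (hx : 4 ≤ Lx) (hy : 4 ≤ Ly) (a : Site Lx Ly) : (crossSites a).card = 12 := by
  have : crossSites a = Finset.univ.map (crossSite hx hy a) := by
    ext j
    simp only [crossSites, Finset.mem_biUnion, Finset.mem_map, Finset.mem_univ, true_and,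
      mem_crossPlaquettes, mem_plaquette]
    have hs : ∀ i, ∃ p c, armCorner p c = i := by decide
    constructor
    · rintro ⟨_, ⟨q, rfl⟩, ⟨c, rfl⟩⟩
      exact ⟨armCorner q c, crossSite_armCorner ..⟩
    · rintro ⟨i, rfl⟩
      obtain ⟨q, c, rfl⟩ := hs i
      exact ⟨_, ⟨q, rfl⟩, c, crossSite_armCorner ..⟩
  rw [this, Finset.card_map, Finset.card_univ, Fintype.card_fin]

end Shift

/-- Every choice of amplitudes of flux `π` on the cross is a gauge transform of `crossT`. -/
theorem exists_gauge {u : Fin 12 → Fin 12 → ℝ} (hs : ∀ i j, u i j = u j i)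
    (h1 : ∀ i j, crossT i j ≠ 0 → u i j = 1 ∨ u i j = -1) (h0 : ∀ i j, crossT i j = 0 → u i j = 0)
    (hf : ∀ p, u (armCorner p 0) (armCorner p 1) * u (armCorner p 1) (armCorner p 3) *
      u (armCorner p 3) (armCorner p 2) * u (armCorner p 2) (armCorner p 0) = -1) :
    ∃ η : Fin 12 → ℝ, (∀ i, η i * η i = 1) ∧ ∀ i j, u i j = η i * η j * crossTR i j := by
  have hsq : ∀ i j, crossT i j ≠ 0 → u i j * u i j = 1 := fun i j h => by
    rcases h1 i j h with h | h <;> rw [h] <;> norm_num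
  have a01 := hsq 0 1 (by decide)
  have a02 := hsq 0 2 (by decide)
  have a04 := hsq 0 4 (by decide)
  have a08 := hsq 0 8 (by decide)
  have a13 := hsq 1 3 (by decide)
  have a16 := hsq 1 6 (by decide)
  have a19 := hsq 1 9 (by decide)
  have a23 := hsq 2 3 (by decide)
  have a25 := hsq 2 5 (by decide)
  have a2t := hsq 2 10 (by decide)
  have a37 := hsq 3 7 (by decide)
  have a3e := hsq 3 11 (by decide)
  have f0 : u 0 1 * u 1 3 * u 2 3 * u 0 2 = -1 := by rw [hs 2 3, hs 0 2]; exact hf 0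
  have f1 : u 1 6 * u 6 7 * u 3 7 * u 1 3 = -1 := by rw [hs 3 7, hs 1 3]; exact hf 1
  have f2 : u 0 4 * u 0 2 * u 2 5 * u 4 5 = -1 := by rw [hs 0 4, hs 4 5]; exact hf 2
  have f3 : u 2 3 * u 3 11 * u 10 11 * u 2 10 = -1 := by rw [hs 10 11, hs 2 10]; exact hf 3
  have f4 : u 8 9 * u 1 9 * u 0 1 * u 0 8 = -1 := by rw [hs 1 9, hs 0 1]; exact hf 4
  -- Signs are their own inverses, so the flux condition determines the fourth link of a plaquette
  -- from the other three.
  have hclose : ∀ a b c d : ℝ, a * a = 1 → b * b = 1 → c * c = 1 → a * b * c * d = -1 →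
      d = -(a * b * c) := by
    intro a b c d ha hb hc h
    linear_combination a * b * c * h - d * ha * b * b * c * c - d * hb * c * c - d * hc
  have c23 := hclose (u 0 1) (u 1 3) (u 0 2) (u 2 3) a01 a13 a02 (by linear_combination f0)
  have c67 := hclose (u 1 6) (u 3 7) (u 1 3) (u 6 7) a16 a37 a13 (by linear_combination f1)
  have c45 := hclose _ _ _ _ a04 a02 a25 f2
  have cte := hclose (u 2 3) (u 3 11) (u 2 10) (u 10 11) a23 a3e a2t (by linear_combination f3)
  have c89 := hclose (u 1 9) (u 0 1) (u 0 8) (u 8 9) a19 a01 a08 (by linear_combination f4)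
  -- The gauge is the product of the amplitudes along the path from site 0 in a spanning tree,
  -- corrected by the sign of the reference link 0–1. The eleven tree links then agree by
  -- construction, and the other five, 2–3, 4–5, 6–7, 8–9 and 10–11, one per plaquette, agree by the
  -- flux.
  let η : Fin 12 → ℝ := ![1, -u 0 1, u 0 2, -u 0 1 * u 1 3, u 0 4, u 0 2 * u 2 5, -u 0 1 * u 1 6,
    -u 0 1 * u 1 3 * u 3 7, u 0 8, -u 0 1 * u 1 9, u 0 2 * u 2 10, -u 0 1 * u 1 3 * u 3 11]
  have e0 : η 0 = 1 := rfl
  have e1 : η 1 = -u 0 1 := rfl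
  have e2 : η 2 = u 0 2 := rfl
  have e3 : η 3 = -u 0 1 * u 1 3 := rfl
  have e4 : η 4 = u 0 4 := rfl
  have e5 : η 5 = u 0 2 * u 2 5 := rfl
  have e6 : η 6 = -u 0 1 * u 1 6 := rfl
  have e7 : η 7 = -u 0 1 * u 1 3 * u 3 7 := rfl
  have e8 : η 8 = u 0 8 := rfl
  have e9 : η 9 = -u 0 1 * u 1 9 := rfl
  have et : η 10 = u 0 2 * u 2 10 := rfl
  have ee : η 11 = -u 0 1 * u 1 3 * u 3 11 := rfl
  have hη : ∀ i, η i * η i = 1 := by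
    have hm : ∀ {a b : ℝ}, a * a = 1 → b * b = 1 → (a * b) * (a * b) = 1 := fun ha hb => by
      rw [mul_mul_mul_comm, ha, hb, one_mul]
    have hneg : (-u 0 1) * (-u 0 1) = 1 := by rw [neg_mul_neg, a01]
    intro i
    fin_cases i
    exacts [one_mul 1, hneg, a02, hm hneg a13, a04, hm a02 a25, hm hneg a16,
      hm (hm hneg a13) a37, a08, hm hneg a19, hm a02 a2t, hm (hm hneg a13) a3e]
  have hlinks : ∀ l ∈ crossLinks, u l.1 l.2.1 = η l.1 * η l.2.1 * (cond l.2.2 1 (-1) : ℤ) := by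
    simp only [crossLinks, List.forall_mem_cons, List.not_mem_nil, IsEmpty.forall_iff, implies_true,
      and_true, cond_true, cond_false, Int.cast_one, Int.cast_neg, e0, e1, e2, e3, e4, e5, e6, e7,
      e8, e9, et, ee, mul_one]
    refine ⟨?_, ?_, ?_, ?_, ?_, ?_, ?_, ?_, ?_, ?_, ?_, ?_, ?_, ?_, ?_, ?_⟩
    · ring
    · ring
    · ring
    · ring
    · linear_combination -u 1 3 * a01
    · linear_combination -u 1 6 * a01
    · linear_combination -u 1 9 * a01
    · linear_combination c23
    · linear_combination -u 2 5 * a02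
    · linear_combination -u 2 10 * a02
    · linear_combination -u 3 7 * a01 * u 1 3 * u 1 3 - u 3 7 * a13
    · linear_combination -u 3 11 * a01 * u 1 3 * u 1 3 - u 3 11 * a13
    · linear_combination c45
    · linear_combination c67 + u 1 6 * u 1 3 * u 3 7 * a01
    · linear_combination c89
    · linear_combination cte - u 3 11 * u 2 10 * c23
  refine ⟨η, hη, fun i j => ?_⟩
  by_cases hc : crossT i j = 0
  · rw [h0 i j hc, crossTR, hc]; simp
  · have : ∀ i j, crossT i j ≠ 0 → ∃ l ∈ crossLinks, crossT i j = cond l.2.2 1 (-1) ∧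
        ((l.1 = i ∧ l.2.1 = j) ∨ (l.1 = j ∧ l.2.1 = i)) := by decide +kernel
    obtain ⟨l, hl, h2, ⟨rfl, rfl⟩ | ⟨rfl, rfl⟩⟩ := this i j hc
    · rw [hlinks l hl, crossTR, h2]
    · rw [hs, hlinks l hl, crossTR, h2, mul_comm (η l.1)]

section Cross
variable {Lx Ly : ℕ} {t : Site Lx Ly → Site Lx Ly → ℝ}

theorem crossHopping_symm (ht : IsPiFlux t) (a j k : Site Lx Ly) :
    crossHopping t a j k = crossHopping t a k j := by
  simp only [crossHopping, ht.symm j k, and_comm (a := j ∈ _)]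

theorem IsPiFlux.diag (ht : IsPiFlux t) (hx : 4 ≤ Lx) (hy : 4 ≤ Ly) (j : Site Lx Ly) :
    t j j = 0 := by
  refine ht.nonbond _ _ fun h => ?_
  have := (isNeighbour_add_shift hx hy (j := j) (v := 0) (by simp) (by simp)).1
    (by rwa [show (shift 0 : Site Lx Ly) = 0 from Prod.ext (by simp [shift]) (by simp [shift]), add_zero])
  revert this
  decide

theorem crossHopping_diag (ht : IsPiFlux t) (hx : 4 ≤ Lx) (hy : 4 ≤ Ly) (a j : Site Lx Ly) :
    crossHopping t a j j = 0 := by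
  rw [crossHopping, ht.diag hx hy, zero_div, ite_self]

/-- The links of the reference cross are precisely the neighbouring pairs in a common plaquette. The
torus amplitudes, pulled back to the 12 positions, therefore satisfy the hypotheses of
`exists_gauge`. -/
theorem exists_crossHopping_gauge (ht : IsPiFlux t) (hx : 4 ≤ Lx) (hy : 4 ≤ Ly) (a : Site Lx Ly) :
    ∃ η : Fin 12 → ℝ, (∀ i, η i * η i = 1) ∧ ∀ i j,
      2 * crossHopping t a (crossSite hx hy a i) (crossSite hx hy a j) =
        η i * η j * crossTR i j := by
  have hin : ∀ p c d, 2 * crossHopping t a (crossSite hx hy a (armCorner p c))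
      (crossSite hx hy a (armCorner p d)) =
        t (crossSite hx hy a (armCorner p c)) (crossSite hx hy a (armCorner p d)) := fun p c d => by
    rw [crossHopping, if_pos ((exists_mem_crossPlaquettes hx hy).2 ⟨p, c, d, rfl, rfl⟩)]
    ring
  have hn : ∀ p c d, IsNeighbour (crossSite hx hy a (armCorner p c))
      (crossSite hx hy a (armCorner p d)) ↔ corner d - corner c ∈ steps := fun p c d => by
    have hb : ∀ c d, |(corner d - corner c).1| ≤ 1 ∧ |(corner d - corner c).2| ≤ 1 := by decide
    rw [← isNeighbour_add_shift hx hy (hb c d).1 (hb c d).2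
      (j := crossSite hx hy a (armCorner p c))]
    rw [crossSite_armCorner, crossSite_armCorner, add_assoc _ (shift (corner c)), ← shift_add,
      add_sub_cancel]
  have hlink : ∀ p c d, corner d - corner c ∈ steps ↔ crossT (armCorner p c) (armCorner p d) ≠ 0 := by
    decide +kernel
  have hex : ∀ i j, crossT i j ≠ 0 → ∃ p c d, armCorner p c = i ∧ armCorner p d = j := by
    decide +kernel
  refine exists_gauge (fun i j => by rw [crossHopping_symm ht]) (fun i j h => ?_) (fun i j h => ?_)
    fun p => ?_
  · obtain ⟨p, c, d, rfl, rfl⟩ := hex i j h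
    rw [hin]
    exact ht.bond _ _ ((hn p c d).2 ((hlink p c d).2 h))
  · by_cases hp : ∃ p ∈ crossPlaquettes a, crossSite hx hy a i ∈ plaquette p ∧
        crossSite hx hy a j ∈ plaquette p
    · obtain ⟨p, c, d, h1, h2⟩ := (exists_mem_crossPlaquettes hx hy).1 hp
      obtain rfl := (crossSite hx hy a).injective h1
      obtain rfl := (crossSite hx hy a).injective h2
      rw [hin]
      exact ht.nonbond _ _ fun hh => (hlink p c d).1 ((hn p c d).1 hh) h
    · rw [crossHopping, if_neg hp, mul_zero]
  · simp only [hin]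
    simp only [crossSite_armCorner]
    have h0 : (shift (corner 0) : Site Lx Ly) = 0 := by simp [corner, shift]
    have h1 : (shift (corner 1) : Site Lx Ly) = ex := ex_eq_shift.symm
    have h2 : (shift (corner 2) : Site Lx Ly) = ey := ey_eq_shift.symm
    have h3 : (shift (corner 3) : Site Lx Ly) = ex + ey := by
      rw [ex_eq_shift, ey_eq_shift, ← shift_add]; rfl
    rw [h0, h1, h2, h3, add_zero, ← add_assoc]
    exact ht.flux _

theorem abs_groundEnergy_cross_le [NeZero Lx] [NeZero Ly] (ht : IsPiFlux t) (hx : 4 ≤ Lx)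
    (hy : 4 ≤ Ly) (a : Site Lx Ly) :
    |groundEnergy (crossHamiltonian t a) - (-3.609035)| ≤ 0.0000005 := by
  obtain ⟨η, hη, h⟩ := exists_crossHopping_gauge ht hx hy a
  refine abs_groundEnergy_cluster_le (crossHopping_symm ht a) (crossHopping_diag ht hx hy a)
    (crossSite hx hy a) (fun j k hjk => ?_) η hη h
  by_cases hp : ∃ p ∈ crossPlaquettes a, j ∈ plaquette p ∧ k ∈ plaquette p
  · obtain ⟨p, c, d, rfl, rfl⟩ := (exists_mem_crossPlaquettes hx hy).1 hp
    exact ⟨⟨_, rfl⟩, ⟨_, rfl⟩⟩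
  · exact absurd (if_neg hp) hjk

end Cross

/-! ## The covering of the torus by crosses -/

/-- Parity of a coordinate on an even cycle. -/
def parity {L : ℕ} (h : Even L) : ZMod L →+* ZMod 2 := ZMod.castHom h.two_dvd (ZMod 2)

theorem parity_eq_zero {L : ℕ} [NeZero L] (h : Even L) (x : ZMod L) :
    parity h x = 0 ↔ Even x.val := by
  have : parity h x = ((x.val : ℕ) : ZMod 2) := by
    conv_lhs => rw [← ZMod.natCast_zmod_val x]
    exact map_natCast _ _
  rw [this, ZMod.natCast_eq_zero_iff_even]

/-- Translation by one exchanges even and odd coordinates; parity is well defined on the cycle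
because its length is even. -/
theorem two_mul_card_even {L : ℕ} [NeZero L] (h : Even L) :
    2 * (Finset.univ.filter fun x : ZMod L => Even x.val).card = L := by
  have hc : (Finset.univ.filter fun x : ZMod L => Even x.val).card =
      (Finset.univ.filter fun x : ZMod L => ¬ Even x.val).card := by
    have h2 : ∀ x : ZMod 2, (x = 0 ↔ ¬ x + 1 = 0) ∧ (x = 0 ↔ ¬ x - 1 = 0) := by decide
    refine Finset.card_bij' (fun x _ => x + 1) (fun x _ => x - 1) ?_ ?_ ?_ ?_
    · intro x hx
      rw [Finset.mem_filter, ← parity_eq_zero h] at hx ⊢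
      rw [map_add, map_one]
      exact ⟨Finset.mem_univ _, (h2 _).1.1 hx.2⟩
    · intro x hx
      rw [Finset.mem_filter, ← parity_eq_zero h] at hx ⊢
      rw [map_sub, map_one]
      exact ⟨Finset.mem_univ _, by_contra fun hn => hx.2 ((h2 _).2.2 hn)⟩
    · intro x _; ring
    · intro x _; ring
  have := Finset.card_filter_add_card_filter_not (s := Finset.univ) fun x : ZMod L => Even x.val
  rw [Finset.card_univ, ZMod.card] at this
  omega

theorem four_mul_card_centres {Lx Ly : ℕ} [NeZero Lx] [NeZero Ly] (hx : Even Lx) (hy : Even Ly) :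
    4 * (centres Lx Ly).card = Lx * Ly := by
  have : centres Lx Ly = (Finset.univ.filter fun x : ZMod Lx => Even x.val) ×ˢ
      Finset.univ.filter fun y : ZMod Ly => Even y.val := by
    ext a
    simp [centres]
  rw [this, Finset.card_product]
  conv_rhs => rw [← two_mul_card_even hx, ← two_mul_card_even hy]
  ring

/-- The positions, relative to a site, of the centres of the crosses that contain the link in a
given direction. -/
def linkCentres (w : ℤ × ℤ) : Finset (ℤ × ℤ) :=
  (Finset.univ.filter fun x : Fin 5 × Fin 4 × Fin 4 => corner x.2.2 - corner x.2.1 = w).image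
    fun x => -(arm x.1 + corner x.2.1)

/-- This count is the reason for the factor one half: whatever the parities of its end point, a link
in any direction lies in two of the chosen crosses. -/
theorem card_linkCentres : ∀ w ∈ steps, ∀ x y : ZMod 2,
    ((linkCentres w).filter fun v => x + (v.1 : ZMod 2) = 0 ∧ y + (v.2 : ZMod 2) = 0).card = 2 := by
  decide +kernel

theorem linkCentres_bound : ∀ w ∈ steps, ∀ v ∈ linkCentres w, ∀ v' ∈ linkCentres w,
    |v.1 - v'.1| ≤ 3 ∧ |v.2 - v'.2| ≤ 3 := by decide +kernel

section
variable {Lx Ly : ℕ} {t : Site Lx Ly → Site Lx Ly → ℝ}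

theorem link_mem_cross_iff (hx : 4 ≤ Lx) (hy : 4 ≤ Ly) {a j : Site Lx Ly} {w : ℤ × ℤ}
    (hw : w ∈ steps) :
    (∃ p ∈ crossPlaquettes a, j ∈ plaquette p ∧ j + shift w ∈ plaquette p) ↔
      ∃ v ∈ linkCentres w, a = j + shift v := by
  rw [exists_mem_crossPlaquettes hx hy]
  simp only [crossSite_armCorner, linkCentres, Finset.mem_image, Finset.mem_filter,
    Finset.mem_univ, true_and]
  constructor
  · rintro ⟨q, c, d, rfl, h⟩
    have hb : ∀ w ∈ steps, ∀ c d, |(corner c + w).1 - (corner d).1| ≤ 3 ∧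
      |(corner c + w).2 - (corner d).2| ≤ 3 := by decide
    rw [add_assoc _ (shift (corner c)), ← shift_add] at h
    have := shift_inj hx hy (hb w hw c d).1 (hb w hw c d).2 (add_left_cancel h)
    refine ⟨_, ⟨(q, c, d), ?_, rfl⟩, ?_⟩
    · rw [← this]; simp
    · rw [shift_neg, shift_add]; abel
  · rintro ⟨_, ⟨⟨q, c, d⟩, h, rfl⟩, rfl⟩
    refine ⟨q, c, d, ?_, ?_⟩
    · rw [shift_neg, shift_add]; abel
    · rw [← h, shift_neg, shift_add, sub_eq_add_neg, shift_add, shift_neg]; abel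

theorem sum_crossHopping [NeZero Lx] [NeZero Ly] (ht : IsPiFlux t) (hx : 4 ≤ Lx) (hy : 4 ≤ Ly)
    (hxe : Even Lx) (hye : Even Ly) (j k : Site Lx Ly) :
    ∑ a ∈ centres Lx Ly, crossHopping t a j k = t j k := by
  classical
  by_cases hn : IsNeighbour j k
  · obtain ⟨w, hw, rfl⟩ := isNeighbour_iff.1 hn
    have hcard : ((centres Lx Ly).filter fun a =>
        ∃ v ∈ linkCentres w, a = j + shift v).card = 2 := by
      rw [← card_linkCentres w hw (parity hxe j.1) (parity hye j.2)]
      symm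
      refine Finset.card_bij (fun v _ => j + shift v) ?_ ?_ ?_
      · intro v hv
        rw [Finset.mem_filter] at hv
        rw [Finset.mem_filter, centres, Finset.mem_filter]
        refine ⟨⟨Finset.mem_univ _, ?_, ?_⟩, v, hv.1, rfl⟩
        · rw [← parity_eq_zero hxe, Prod.fst_add, map_add, shift, map_intCast]; exact hv.2.1
        · rw [← parity_eq_zero hye, Prod.snd_add, map_add, shift, map_intCast]; exact hv.2.2
      · intro v hv v' hv' h
        rw [Finset.mem_filter] at hv hv'
        have hb := linkCentres_bound w hw v hv.1 v' hv'.1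
        exact shift_inj hx hy hb.1 hb.2 (add_left_cancel h)
      · intro a ha
        rw [Finset.mem_filter, centres, Finset.mem_filter] at ha
        obtain ⟨⟨_, h1, h2⟩, v, hv, rfl⟩ := ha
        rw [← parity_eq_zero hxe, Prod.fst_add, map_add, shift, map_intCast] at h1
        rw [← parity_eq_zero hye, Prod.snd_add, map_add, shift, map_intCast] at h2
        exact ⟨v, Finset.mem_filter.2 ⟨hv, h1, h2⟩, rfl⟩
    simp only [crossHopping, link_mem_cross_iff hx hy hw]
    rw [← Finset.sum_filter, Finset.sum_const, hcard]
    simp; ring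
  · rw [ht.nonbond _ _ hn]
    refine Finset.sum_eq_zero fun a _ => ?_
    rw [crossHopping, ht.nonbond _ _ hn, zero_div, ite_self]

theorem bosonHamiltonian_sum {V : Type} [Fintype V] [DecidableEq V] {ι : Type*} (s : Finset ι)
    (T : ι → V → V → ℝ) :
    bosonHamiltonian (fun j k => ∑ a ∈ s, T a j k) 0 = ∑ a ∈ s, bosonHamiltonian (T a) 0 := by
  simp only [bosonHamiltonian, hamiltonian, Complex.ofReal_zero, zero_smul, sub_zero,
    Finset.sum_neg_distrib, Complex.ofReal_sum, Finset.sum_smul]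
  congr 1
  conv_rhs => rw [Finset.sum_comm]
  refine Finset.sum_congr rfl fun j _ => ?_
  conv_rhs => rw [Finset.sum_comm]

theorem bosonHamiltonian_eq_sum_cross [NeZero Lx] [NeZero Ly] (ht : IsPiFlux t) (hx : 4 ≤ Lx)
    (hy : 4 ≤ Ly) (hxe : Even Lx) (hye : Even Ly) :
    bosonHamiltonian t 0 = ∑ a ∈ centres Lx Ly, crossHamiltonian t a := by
  simp only [crossHamiltonian]
  rw [← bosonHamiltonian_sum]
  congr 1
  funext j k
  exact (sum_crossHopping ht hx hy hxe hye j k).symm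

/-- The Anderson bound. -/
theorem sum_groundEnergy_le {n : Type} [Fintype n] [DecidableEq n] [Nonempty n] {ι : Type*}
    (s : Finset ι) {H : Matrix n n ℂ} {h : ι → Matrix n n ℂ} (hH : H.IsHermitian)
    (hh : ∀ a ∈ s, (h a).IsHermitian) (hs : H = ∑ a ∈ s, h a) :
    ∑ a ∈ s, groundEnergy (h a) ≤ groundEnergy H := by
  obtain ⟨ψ, h0, hψ⟩ := exists_eigenvector_groundEnergy hH
  have hn : 0 < (star ψ ⬝ᵥ ψ).re := by
    simp only [dotProduct, Pi.star_apply, RCLike.star_def, ← Complex.normSq_eq_conj_mul_self,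
      ← Complex.ofReal_sum, Complex.ofReal_re]
    obtain ⟨i, hi⟩ := Function.ne_iff.1 h0
    exact Finset.sum_pos' (fun _ _ => Complex.normSq_nonneg _)
      ⟨i, Finset.mem_univ _, Complex.normSq_pos.2 hi⟩
  have h1 : (star ψ ⬝ᵥ (H *ᵥ ψ)).re = groundEnergy H * (star ψ ⬝ᵥ ψ).re := by
    rw [hψ, dotProduct_smul, smul_eq_mul, Complex.re_ofReal_mul]
  have h2 : (star ψ ⬝ᵥ (H *ᵥ ψ)).re = ∑ a ∈ s, (star ψ ⬝ᵥ (h a *ᵥ ψ)).re := by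
    rw [hs, Matrix.sum_mulVec, dotProduct_sum, Complex.re_sum]
  have h3 := Finset.sum_le_sum fun a ha => groundEnergy_mul_le (hh a ha) ψ
  rw [← h2, h1, ← Finset.sum_mul] at h3
  exact le_of_mul_le_mul_right h3 hn

theorem sum_groundEnergy_cross_le [NeZero Lx] [NeZero Ly] (ht : IsPiFlux t) (hx : 4 ≤ Lx)
    (hy : 4 ≤ Ly) (hxe : Even Lx) (hye : Even Ly) :
    ∑ a ∈ centres Lx Ly, groundEnergy (crossHamiltonian t a) ≤ bosonEnergy t :=
  sum_groundEnergy_le _ (bosonHamiltonian_isHermitian ht.symm)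
    (fun a _ => bosonHamiltonian_isHermitian (crossHopping_symm ht a))
    (bosonHamiltonian_eq_sum_cross ht hx hy hxe hye)

theorem le_bosonEnergy_div [NeZero Lx] [NeZero Ly] (ht : IsPiFlux t) (hx : 4 ≤ Lx)
    (hy : 4 ≤ Ly) (hxe : Even Lx) (hye : Even Ly) :
    -0.902259 ≤ bosonEnergy t / ((Lx : ℝ) * (Ly : ℝ)) := by
  have h1 := sum_groundEnergy_cross_le ht hx hy hxe hye
  -- There are N/4 crosses, and -3.6090355/4 = -0.902258875 is just above -0.902259.
  have h2 : ∑ _a ∈ centres Lx Ly, (-3.6090355 : ℝ) ≤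
      ∑ a ∈ centres Lx Ly, groundEnergy (crossHamiltonian t a) := by
    refine Finset.sum_le_sum fun a _ => ?_
    have := (abs_le.1 (abs_groundEnergy_cross_le ht hx hy a)).1
    norm_num at this ⊢
    linarith
  have h3 : (4 : ℝ) * (centres Lx Ly).card = Lx * Ly := by
    exact_mod_cast four_mul_card_centres hxe hye
  rw [Finset.sum_const, nsmul_eq_mul] at h2
  have hpos : 0 < (Lx : ℝ) * Ly := by
    have := NeZero.pos Lx
    have := NeZero.pos Ly
    positivity
  rw [le_div_iff₀ hpos]
  norm_num at h2 ⊢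
  linarith

end

/-! ## Free fermions -/

/-- Of two distinct sites exactly one precedes the other. Exchanging two fermion operators thus
changes exactly one of the ordering signs, which is the source of the anticommutation relations. -/
theorem sign_cancel {V : Type} [Fintype V] {j k : V} (h : j ≠ k) (x : ℂ) :
    (-1) ^ (if Fintype.equivFin V j < Fintype.equivFin V k then 1 else 0) * x +
      (-1) ^ (if Fintype.equivFin V k < Fintype.equivFin V j then 1 else 0) * x = 0 := by
  rcases lt_trichotomy (Fintype.equivFin V j) (Fintype.equivFin V k) with h1 | h1 | h1
  · rw [if_pos h1, if_neg h1.not_gt]; ring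
  · exact absurd ((Fintype.equivFin V).injective h1) h
  · rw [if_neg h1.not_gt, if_pos h1]; ring

section Fermion
variable {V : Type} [Fintype V] [DecidableEq V]

theorem precede_insert {U : Finset V} {j k : V} (hj : j ∉ U) :
    precede (insert j U) k =
      precede U k + if Fintype.equivFin V j < Fintype.equivFin V k then 1 else 0 := by
  rw [precede, Finset.filter_insert]
  split_ifs
  · rw [Finset.card_insert_of_notMem fun h => hj (Finset.mem_filter.1 h).1, precede]
  · rfl

theorem precede_insert_self (U : Finset V) (k : V) : precede (insert k U) k = precede U k := by
  rw [precede, Finset.filter_insert, if_neg (lt_irrefl _), precede]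

theorem fermionAnn_mulVec (k : V) (ψ : Finset V → ℂ) (U : Finset V) :
    (fermionAnn k *ᵥ ψ) U = if k ∈ U then 0 else (-1) ^ precede U k * ψ (insert k U) := by
  simp only [Matrix.mulVec, dotProduct, fermionAnn, ite_mul, zero_mul]
  split_ifs with h
  · refine Finset.sum_eq_zero fun S _ => if_neg ?_
    rintro ⟨_, rfl⟩
    exact Finset.notMem_erase k S h
  · rw [Finset.sum_eq_single (insert k U)]
    · simp [Finset.erase_insert h, precede_insert_self]
    · rintro S _ hS
      refine if_neg ?_
      rintro ⟨h1, rfl⟩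
      exact hS (Finset.insert_erase h1).symm
    · simp

theorem fermionAnn_conjTranspose_mulVec (j : V) (ψ : Finset V → ℂ) (S : Finset V) :
    ((fermionAnn j)ᴴ *ᵥ ψ) S = if j ∈ S then (-1) ^ precede S j * ψ (S.erase j) else 0 := by
  simp only [Matrix.mulVec, dotProduct, fermionAnn, Matrix.conjTranspose_apply, RCLike.star_def,
    apply_ite (starRingEnd ℂ), map_pow, map_neg, map_one, map_zero, ite_mul, zero_mul]
  split_ifs with h
  · simp [h]
  · simp [h]

theorem matrix_ext_mulVec {m n : Type*} [Fintype n] [DecidableEq n] {A B : Matrix m n ℂ}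
    (h : ∀ ψ i, (A *ᵥ ψ) i = (B *ᵥ ψ) i) : A = B := by
  ext i j
  have := h (Pi.single j 1) i
  simpa using this

theorem fermionAnn_mul_fermionAnn (j k : V) :
    fermionAnn j * fermionAnn k = -(fermionAnn k * fermionAnn j) := by
  refine matrix_ext_mulVec fun ψ U => ?_
  rw [Matrix.neg_mulVec, Pi.neg_apply, ← Matrix.mulVec_mulVec, ← Matrix.mulVec_mulVec,
    fermionAnn_mulVec, fermionAnn_mulVec, fermionAnn_mulVec, fermionAnn_mulVec]
  by_cases hjk : j = k
  · subst hjk; simp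
  by_cases hj : j ∈ U
  · simp [hj]
  by_cases hk : k ∈ U
  · simp [hk]
  simp only [hj, hk, if_false, Finset.mem_insert, Ne.symm hjk, hjk, or_self, precede_insert hj,
    precede_insert hk, pow_add, Finset.insert_comm k j]
  linear_combination (-1) ^ precede U j * (-1) ^ precede U k *
    sign_cancel hjk (ψ (insert j (insert k U)))

theorem fermionAnn_mul_conjTranspose (j k : V) :
    fermionAnn j * (fermionAnn k)ᴴ =
      (if j = k then 1 else 0) - (fermionAnn k)ᴴ * fermionAnn j := by
  refine matrix_ext_mulVec fun ψ U => ?_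
  have hs : ∀ n : ℕ, ((-1 : ℂ) ^ n) * (-1) ^ n = 1 := fun n => by
    rw [← mul_pow]; norm_num
  rw [Matrix.sub_mulVec, Pi.sub_apply, ← Matrix.mulVec_mulVec, ← Matrix.mulVec_mulVec,
    fermionAnn_mulVec, fermionAnn_conjTranspose_mulVec, fermionAnn_conjTranspose_mulVec,
    fermionAnn_mulVec]
  by_cases hjk : j = k
  · subst hjk
    simp only [if_true, Matrix.one_mulVec]
    by_cases hj : j ∈ U
    · have hp : precede (U.erase j) j = precede U j := by
        conv_rhs => rw [← Finset.insert_erase hj, precede_insert_self]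
      simp only [hj, if_true, Finset.notMem_erase, if_false, Finset.insert_erase hj, hp]
      linear_combination ψ U * hs (precede U j)
    · simp only [hj, if_false, Finset.mem_insert_self, if_true, Finset.erase_insert hj,
        precede_insert_self]
      linear_combination ψ U * hs (precede U j)
  · rw [if_neg hjk, Matrix.zero_mulVec, Pi.zero_apply]
    by_cases hj : j ∈ U
    · simp [hj, hjk]
    by_cases hk : k ∈ U
    · have he : (insert j U).erase k = insert j (U.erase k) :=
        Finset.erase_insert_of_ne hjk
      have hp : precede U j = precede (U.erase k) j +
          if Fintype.equivFin V k < Fintype.equivFin V j then 1 else 0 := by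
        conv_lhs => rw [← Finset.insert_erase hk]
        exact precede_insert (Finset.notMem_erase k U)
      simp only [hj, hk, if_false, if_true, Finset.mem_insert, or_true, Finset.mem_erase,
        and_false, precede_insert hj, he, hp, pow_add]
      have hc := sign_cancel hjk (ψ (insert j (U.erase k)))
      have h2 := hs (if Fintype.equivFin V k < Fintype.equivFin V j then 1 else 0)
      linear_combination (-1) ^ precede (U.erase k) j * (-1) ^ precede U k *
        ((-1) ^ (if Fintype.equivFin V k < Fintype.equivFin V j then 1 else 0) * hc -
          ψ (insert j (U.erase k)) * h2)
    · simp [hj, hk, Ne.symm hjk]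

theorem fermionHamiltonian_eq (t : V → V → ℝ) :
    fermionHamiltonian t 0 = -∑ j, ∑ k, (t j k : ℂ) • ((fermionAnn j)ᴴ * fermionAnn k) := by
  rw [fermionHamiltonian, hamiltonian, Complex.ofReal_zero, zero_smul, sub_zero]

/-- The commutator of a quadratic Hamiltonian with a fermion operator is linear in such operators,
so eigenvectors of t give operators that shift the energy by a definite amount. -/
theorem fermionHamiltonian_mul_ann (t : V → V → ℝ) (l : V) :
    fermionHamiltonian t 0 * fermionAnn l =
      fermionAnn l * fermionHamiltonian t 0 + ∑ k, (t l k : ℂ) • fermionAnn k := by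
  have h : ∀ j k, (fermionAnn j)ᴴ * fermionAnn k * fermionAnn l =
      fermionAnn l * ((fermionAnn j)ᴴ * fermionAnn k) - if l = j then fermionAnn k else 0 := by
    intro j k
    rw [mul_assoc, fermionAnn_mul_fermionAnn k l, mul_neg, ← mul_assoc, ← mul_assoc,
      fermionAnn_mul_conjTranspose l j, sub_mul, ite_mul, one_mul, zero_mul]
    abel
  simp only [fermionHamiltonian_eq, neg_mul, mul_neg, Finset.sum_mul, Finset.mul_sum, smul_mul_assoc,
    mul_smul_comm, h, smul_sub, Finset.sum_sub_distrib, smul_ite, smul_zero]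
  rw [Finset.sum_comm (f := fun j k => if l = j then (t j k : ℂ) • fermionAnn k else 0)]
  simp
  abel

theorem fermionHamiltonian_mul_conjTranspose (t : V → V → ℝ) (l : V) :
    fermionHamiltonian t 0 * (fermionAnn l)ᴴ =
      (fermionAnn l)ᴴ * fermionHamiltonian t 0 - ∑ j, (t j l : ℂ) • (fermionAnn j)ᴴ := by
  have h : ∀ j k, (fermionAnn j)ᴴ * fermionAnn k * (fermionAnn l)ᴴ =
      (fermionAnn l)ᴴ * ((fermionAnn j)ᴴ * fermionAnn k) + if k = l then (fermionAnn j)ᴴ else 0 := by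
    intro j k
    have h2 : (fermionAnn j)ᴴ * (fermionAnn l)ᴴ = -((fermionAnn l)ᴴ * (fermionAnn j)ᴴ) := by
      rw [← Matrix.conjTranspose_mul, fermionAnn_mul_fermionAnn, Matrix.conjTranspose_neg,
        Matrix.conjTranspose_mul]
    rw [mul_assoc, fermionAnn_mul_conjTranspose k l, mul_sub, mul_ite, mul_one, mul_zero,
      ← mul_assoc, h2, neg_mul, ← mul_assoc]
    abel
  simp only [fermionHamiltonian_eq, neg_mul, mul_neg, Finset.sum_mul, Finset.mul_sum, smul_mul_assoc,
    mul_smul_comm, h, smul_add, Finset.sum_add_distrib, smul_ite, smul_zero]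
  simp [sub_eq_add_neg]
  abel

/-- The annihilation operator of a mode. -/
def modeAnn (u : V → ℝ) : Matrix (Finset V) (Finset V) ℂ := ∑ j, (u j : ℂ) • fermionAnn j

theorem modeAnn_conjTranspose (u : V → ℝ) :
    (modeAnn u)ᴴ = ∑ j, (u j : ℂ) • (fermionAnn j)ᴴ := by
  simp [modeAnn, Matrix.conjTranspose_sum, Matrix.conjTranspose_smul]

theorem fermionHamiltonian_mul_modeAnn {t : V → V → ℝ} (hs : ∀ j k, t j k = t k j) {u : V → ℝ}
    {μ : ℝ} (hu : ∀ j, ∑ k, t j k * u k = μ * u j) :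
    fermionHamiltonian t 0 * modeAnn u = modeAnn u * fermionHamiltonian t 0 + (μ : ℂ) • modeAnn u := by
  simp only [modeAnn, Finset.mul_sum, Finset.sum_mul, mul_smul_comm, smul_mul_assoc,
    fermionHamiltonian_mul_ann, smul_add, Finset.sum_add_distrib, Finset.smul_sum]
  congr 1
  rw [Finset.sum_comm]
  refine Finset.sum_congr rfl fun k _ => ?_
  simp only [smul_smul, ← Finset.sum_smul]
  congr 1
  have := hu k
  rw [← Complex.ofReal_mul, ← this, Complex.ofReal_sum]
  refine Finset.sum_congr rfl fun j _ => ?_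
  rw [hs j k]
  push_cast
  ring

theorem fermionHamiltonian_mul_modeAnn_conjTranspose {t : V → V → ℝ} {u : V → ℝ}
    {μ : ℝ} (hu : ∀ j, ∑ k, t j k * u k = μ * u j) :
    fermionHamiltonian t 0 * (modeAnn u)ᴴ =
      (modeAnn u)ᴴ * fermionHamiltonian t 0 - (μ : ℂ) • (modeAnn u)ᴴ := by
  simp only [modeAnn_conjTranspose, Finset.mul_sum, Finset.sum_mul, mul_smul_comm, smul_mul_assoc,
    fermionHamiltonian_mul_conjTranspose, smul_sub, Finset.sum_sub_distrib, Finset.smul_sum]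
  congr 1
  rw [Finset.sum_comm]
  refine Finset.sum_congr rfl fun k _ => ?_
  simp only [smul_smul, ← Finset.sum_smul]
  congr 1
  have := hu k
  rw [← Complex.ofReal_mul, ← this, Complex.ofReal_sum]
  refine Finset.sum_congr rfl fun j _ => ?_
  push_cast
  ring

theorem modeAnn_mul_conjTranspose {u : V → ℝ} (hu : ∑ j, u j * u j = 1) :
    modeAnn u * (modeAnn u)ᴴ = 1 - (modeAnn u)ᴴ * modeAnn u := by
  rw [modeAnn_conjTranspose]
  simp only [modeAnn, Finset.mul_sum, Finset.sum_mul, mul_smul_comm, smul_mul_assoc,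
    fermionAnn_mul_conjTranspose, smul_sub, Finset.sum_sub_distrib, Finset.smul_sum, smul_smul]
  refine congrArg₂ (· - ·) ?_ ?_
  · have : (∑ j, (u j : ℂ) * u j) = 1 := by exact_mod_cast hu
    simp only [smul_ite, smul_zero, Finset.sum_ite_eq', Finset.mem_univ, if_true]
    rw [← Finset.sum_smul, this, one_smul]
  · rw [Finset.sum_comm]
    refine Finset.sum_congr rfl fun j _ => Finset.sum_congr rfl fun k _ => ?_
    rw [mul_comm]

/-- The ground-state energy of free fermions, from the eigenvalues of the hopping matrix. -/
theorem groundEnergy_fermionHamiltonian {t : V → V → ℝ} (hs : ∀ j k, t j k = t k j)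
    (h0 : ∀ j, t j j = 0) (hT : (Matrix.of t).IsHermitian) :
    groundEnergy (fermionHamiltonian t 0) = -(1 / 2) * ∑ a, |hT.eigenvalues a| := by
  set μ := hT.eigenvalues with hμ
  set u : V → V → ℝ := fun a j => hT.eigenvectorBasis a j with hu
  have hsum : ∀ j k, t j k = ∑ a, μ a * (u a j * u a k) := by
    intro j k
    have := congrFun (congrFun hT.spectral_theorem j) k
    rw [Unitary.conjStarAlgAut_apply, Matrix.mul_apply] at this
    simp only [Matrix.mul_diagonal, Matrix.star_apply, Matrix.IsHermitian.eigenvectorUnitary_apply,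
      Matrix.of_apply, Function.comp_apply] at this
    rw [this]
    refine Finset.sum_congr rfl fun a _ => ?_
    simp [hu, hμ]
    ring
  have heig : ∀ a j, ∑ k, t j k * u a k = μ a * u a j := by
    intro a j
    have := congrFun (hT.mulVec_eigenvectorBasis a) j
    simpa [Matrix.mulVec, dotProduct] using this
  have hnorm : ∀ a, ∑ j, u a j * u a j = 1 := by
    intro a
    have := hT.eigenvectorBasis.orthonormal.1 a
    have h2 : ‖hT.eigenvectorBasis a‖ ^ 2 = 1 := by rw [this]; norm_num
    rw [EuclideanSpace.norm_sq_eq] at h2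
    simpa [sq] using h2
  -- Without diagonal hopping the eigenvalues sum to zero; this later turns the sum of positive
  -- parts into half the sum of absolute values.
  have htr : ∑ a, μ a = 0 := by
    have := hT.trace_eq_sum_eigenvalues
    simp only [Matrix.trace, Matrix.diag, Matrix.of_apply, h0, Finset.sum_const_zero] at this
    exact_mod_cast this.symm
  have hH : fermionHamiltonian t 0 = -∑ a, (μ a : ℂ) • ((modeAnn (u a))ᴴ * modeAnn (u a)) := by
    rw [fermionHamiltonian_eq]
    congr 1
    simp only [modeAnn_conjTranspose]
    simp only [modeAnn, Finset.mul_sum, Finset.sum_mul, mul_smul_comm, smul_mul_assoc,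
      Finset.smul_sum, smul_smul]
    symm
    rw [Finset.sum_comm]
    refine (Finset.sum_congr rfl fun k _ => Finset.sum_comm).trans ?_
    rw [Finset.sum_comm]
    refine Finset.sum_congr rfl fun j _ => Finset.sum_congr rfl fun k _ => ?_
    rw [← Finset.sum_smul, hsum, Complex.ofReal_sum]
    congr 1
    refine Finset.sum_congr rfl fun a _ => ?_
    push_cast
    ring
  have hherm : (fermionHamiltonian t 0).IsHermitian := hamiltonian_isHermitian _ t hs 0
  obtain ⟨ψ, hψ0, hψ⟩ := exists_eigenvector_groundEnergy hherm
  set E := groundEnergy (fermionHamiltonian t 0) with hE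
  have hleast : ∀ (φ : Finset V → ℂ) (e : ℝ), e < E →
      fermionHamiltonian t 0 *ᵥ φ = (e : ℂ) • φ → φ = 0 := by
    intro φ e he hφ
    by_contra hne
    have h3 : Module.End.HasEigenvalue (Matrix.toLin' (fermionHamiltonian t 0)) (e : ℂ) :=
      Module.End.hasEigenvalue_of_hasEigenvector (x := φ)
        ⟨Module.End.mem_eigenspace_iff.2 (by rw [Matrix.toLin'_apply, hφ]), hne⟩
    have := (groundEnergy_isLeast hherm).2 h3
    linarith
  -- Emptying a mode changes the energy by μ, filling it by -μ. Neither can lower the ground energy,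
  -- so in the ground state modes with μ < 0 are empty and those with μ > 0 are filled; modes with μ
  -- = 0 do not contribute.
  have hocc : ∀ a, (μ a : ℂ) • (((modeAnn (u a))ᴴ * modeAnn (u a)) *ᵥ ψ) =
      ((max (μ a) 0 : ℝ) : ℂ) • ψ := by
    intro a
    rcases lt_trichotomy (μ a) 0 with h | h | h
    · have : modeAnn (u a) *ᵥ ψ = 0 := by
        refine hleast _ (E + μ a) (by linarith) ?_
        rw [Matrix.mulVec_mulVec, fermionHamiltonian_mul_modeAnn hs (heig a), Matrix.add_mulVec,
          ← Matrix.mulVec_mulVec, hψ, Matrix.mulVec_smul, Matrix.smul_mulVec, ← add_smul]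
        push_cast
        rfl
      rw [← Matrix.mulVec_mulVec, this, Matrix.mulVec_zero, smul_zero, max_eq_right h.le]
      simp
    · rw [h]; simp
    · have : (modeAnn (u a))ᴴ *ᵥ ψ = 0 := by
        refine hleast _ (E - μ a) (by linarith) ?_
        rw [Matrix.mulVec_mulVec, fermionHamiltonian_mul_modeAnn_conjTranspose (heig a),
          Matrix.sub_mulVec, ← Matrix.mulVec_mulVec, hψ, Matrix.mulVec_smul, Matrix.smul_mulVec,
          ← sub_smul]
        push_cast
        rfl
      have h2 : ((modeAnn (u a))ᴴ * modeAnn (u a)) *ᵥ ψ = ψ := by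
        have h3 := modeAnn_mul_conjTranspose (hnorm a)
        have h4 : (modeAnn (u a))ᴴ * modeAnn (u a) = 1 - modeAnn (u a) * (modeAnn (u a))ᴴ := by
          rw [h3]; abel
        rw [h4, Matrix.sub_mulVec, ← Matrix.mulVec_mulVec, this, Matrix.mulVec_zero,
          Matrix.one_mulVec, sub_zero]
      rw [h2, max_eq_left h.le]
  have hfin : ((E : ℂ) + ((∑ a, max (μ a) 0 : ℝ) : ℂ)) • ψ = 0 := by
    rw [add_smul, ← hψ, hH, Matrix.neg_mulVec, Matrix.sum_mulVec]
    simp only [Matrix.smul_mulVec, hocc, Complex.ofReal_sum, Finset.sum_smul]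
    exact neg_add_cancel _
  have h5 := (smul_eq_zero.1 hfin).resolve_right hψ0
  have h6 : E + ∑ a, max (μ a) 0 = 0 := by exact_mod_cast h5
  have h7 : ∑ a, max (μ a) 0 = 1 / 2 * ∑ a, |μ a| + 1 / 2 * ∑ a, μ a := by
    rw [Finset.mul_sum, Finset.mul_sum, ← Finset.sum_add_distrib]
    refine Finset.sum_congr rfl fun a _ => ?_
    rcases le_total 0 (μ a) with h | h
    · rw [max_eq_left h, abs_of_nonneg h]; ring
    · rw [max_eq_right h, abs_of_nonpos h]; ring
  rw [h7, htr] at h6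
  linarith

end Fermion

/-! ## The moments of the hopping matrix -/

theorem trace_pow_eq_sum_eigenvalues {V : Type*} [Fintype V] [DecidableEq V] {A : Matrix V V ℝ}
    (hA : A.IsHermitian) (n : ℕ) : (A ^ n).trace = ∑ a, hA.eigenvalues a ^ n := by
  conv_lhs => rw [hA.spectral_theorem]
  rw [← map_pow, Unitary.conjStarAlgAut_apply, Matrix.trace_mul_cycle, Unitary.coe_star_mul_self,
    one_mul, Matrix.diagonal_pow, Matrix.trace_diagonal]
  rfl

section Anticommuting
variable {R : Type*} [Ring R]

theorem mul_eq_neg_of_inverse {a b b' : R} (h : b * b' = 1) (h' : b' * b = 1)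
    (hab : a * b = -(b * a)) : a * b' = -(b' * a) := by
  calc a * b' = b' * (b * a) * b' := by rw [← mul_assoc, h', one_mul]
    _ = -(b' * (a * b) * b') := by rw [hab, mul_neg, neg_mul, neg_neg]
    _ = -(b' * a) := by rw [mul_assoc, mul_assoc, h, mul_one]

theorem sq_add_of_anticomm {x y : R} (h : x * y = -(y * x)) : (x + y) ^ 2 = x ^ 2 + y ^ 2 := by
  rw [sq, sq, sq, add_mul, mul_add, mul_add, h]
  abel

theorem commute_sq_of_anticomm {x y : R} (h : x * y = -(y * x)) : Commute (x ^ 2) (y ^ 2) := by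
  have h1 : Commute (x ^ 2) y := by
    change x ^ 2 * y = y * x ^ 2
    rw [sq, mul_assoc, h, mul_neg, ← mul_assoc, h, neg_mul, neg_neg, mul_assoc]
  exact h1.pow_right 2

end Anticommuting

section Moves
variable {Lx Ly : ℕ}

/-- A matrix all of whose nonzero entries connect sites at a given displacement. -/
def Moves (M : Matrix (Site Lx Ly) (Site Lx Ly) ℝ) (v : ℤ × ℤ) : Prop :=
  ∀ s s', M s s' ≠ 0 → s' = s + shift v

/-- Hopping in one direction. -/
def stepMat (t : Site Lx Ly → Site Lx Ly → ℝ) (w : ℤ × ℤ) : Matrix (Site Lx Ly) (Site Lx Ly) ℝ :=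
  fun s s' => if s' = s + shift w then t s s' else 0

theorem moves_stepMat (t : Site Lx Ly → Site Lx Ly → ℝ) (w : ℤ × ℤ) : Moves (stepMat t w) w := by
  intro s s' h
  by_contra hn
  exact h (if_neg hn)

variable {t : Site Lx Ly → Site Lx Ly → ℝ}

theorem IsPiFlux.sq_step (ht : IsPiFlux t) {w : ℤ × ℤ} (hw : w ∈ steps) (s : Site Lx Ly) :
    t s (s + shift w) * t s (s + shift w) = 1 := by
  rcases ht.bond _ _ (isNeighbour_iff.2 ⟨w, hw, rfl⟩) with h | h <;> rw [h] <;> norm_num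

theorem hopMat_eq (ht : IsPiFlux t) (hx : 4 ≤ Lx) (hy : 4 ≤ Ly) :
    Matrix.of t = (stepMat t (1, 0) + stepMat t (-(1, 0))) +
      (stepMat t (0, 1) + stepMat t (-(0, 1))) := by
  have hsum : (stepMat t (1, 0) + stepMat t (-(1, 0))) + (stepMat t (0, 1) + stepMat t (-(0, 1))) =
      ∑ w ∈ steps, stepMat t w := by
    rw [steps, Finset.sum_insert (by decide), Finset.sum_insert (by decide),
      Finset.sum_insert (by decide), Finset.sum_singleton]
    simp only [Prod.neg_mk, neg_zero]
    abel
  rw [hsum]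
  ext s s'
  rw [Matrix.sum_apply, Matrix.of_apply]
  by_cases hn : IsNeighbour s s'
  · obtain ⟨w, hw, rfl⟩ := isNeighbour_iff.1 hn
    rw [Finset.sum_eq_single w]
    · rw [stepMat, if_pos rfl]
    · intro w' hw' hne
      refine if_neg fun h => hne ?_
      have hb := (by decide : ∀ w ∈ steps, ∀ w' ∈ steps, |w.1 - w'.1| ≤ 3 ∧ |w.2 - w'.2| ≤ 3)
        w hw w' hw'
      exact (shift_inj hx hy hb.1 hb.2 (add_left_cancel h)).symm
    · exact fun h => absurd hw h
  · rw [ht.nonbond _ _ hn]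
    refine (Finset.sum_eq_zero fun w hw => if_neg fun h => hn ?_).symm
    exact isNeighbour_iff.2 ⟨w, hw, h⟩

theorem hopMat_isHermitian (ht : IsPiFlux t) : (Matrix.of t).IsHermitian := by
  ext j k
  simp [ht.symm j k]

variable [NeZero Lx] [NeZero Ly]

theorem Moves.mul {M N : Matrix (Site Lx Ly) (Site Lx Ly) ℝ} {v w : ℤ × ℤ} (hM : Moves M v)
    (hN : Moves N w) : Moves (M * N) (v + w) := by
  intro s s' h
  rw [Matrix.mul_apply] at h
  obtain ⟨r, _, hr⟩ := Finset.exists_ne_zero_of_sum_ne_zero h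
  rw [hN _ _ (right_ne_zero_of_mul hr), hM _ _ (left_ne_zero_of_mul hr), shift_add, add_assoc]

theorem Moves.pow {M : Matrix (Site Lx Ly) (Site Lx Ly) ℝ} {v : ℤ × ℤ} (hM : Moves M v) (n : ℕ) :
    Moves (M ^ n) (n • v) := by
  induction n with
  | zero =>
    intro s s' h
    rw [pow_zero, Matrix.one_apply] at h
    have : s = s' := by
      by_contra hn
      exact h (if_neg hn)
    rw [← this, zero_smul]
    ext <;> simp [shift]
  | succ n ih => rw [pow_succ, succ_nsmul]; exact ih.mul hM

/-- A nonzero displacement shorter than the torus cannot wrap around, so no diagonal entry survives.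
-/
theorem Moves.trace_eq_zero {M : Matrix (Site Lx Ly) (Site Lx Ly) ℝ} {v : ℤ × ℤ} (hM : Moves M v)
    (hv : v ≠ 0) (h1 : |v.1| < Lx) (h2 : |v.2| < Ly) : M.trace = 0 := by
  refine Finset.sum_eq_zero fun s _ => ?_
  by_contra h
  have h3 := hM s s h
  have h4 : (shift v : Site Lx Ly) = 0 := by simpa using h3.symm
  obtain ⟨ha, hb⟩ := Prod.ext_iff.1 h4
  refine hv (Prod.ext ?_ ?_)
  · exact Int.eq_zero_of_abs_lt_dvd ((ZMod.intCast_zmod_eq_zero_iff_dvd _ _).1 ha) h1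
  · exact Int.eq_zero_of_abs_lt_dvd ((ZMod.intCast_zmod_eq_zero_iff_dvd _ _).1 hb) h2

theorem stepMat_mul_apply (t : Site Lx Ly → Site Lx Ly → ℝ) (w : ℤ × ℤ)
    (M : Matrix (Site Lx Ly) (Site Lx Ly) ℝ) (s s' : Site Lx Ly) :
    (stepMat t w * M) s s' = t s (s + shift w) * M (s + shift w) s' := by
  rw [Matrix.mul_apply, Finset.sum_eq_single (s + shift w)]
  · rw [stepMat, if_pos rfl]
  · intro r _ hr
    rw [stepMat, if_neg hr, zero_mul]
  · simp

theorem stepMat_mul_stepMat_neg (ht : IsPiFlux t) {w : ℤ × ℤ} (hw : w ∈ steps) :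
    stepMat t w * stepMat t (-w) = 1 := by
  ext s s'
  rw [stepMat_mul_apply, stepMat, shift_neg, add_neg_cancel_right, Matrix.one_apply]
  by_cases h : s' = s
  · rw [if_pos h, if_pos h.symm, h, ht.symm (s + shift w), ht.sq_step hw]
  · rw [if_neg h, if_neg (Ne.symm h), mul_zero]

/-- The two ways around a plaquette from corner to opposite corner differ by the flux factor -1. -/
theorem stepMat_anticomm (ht : IsPiFlux t) :
    stepMat t (1, 0) * stepMat t (0, 1) = -(stepMat t (0, 1) * stepMat t (1, 0)) := by
  ext s s'
  rw [Matrix.neg_apply, stepMat_mul_apply, stepMat_mul_apply, stepMat, stepMat, ← ex_eq_shift,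
    ← ey_eq_shift, add_right_comm s ey ex]
  split_ifs with h
  · rw [h]
    have h1 := ht.flux s
    have h2 := ht.sq_step (w := (0, 1)) (by decide) s
    have h3 := ht.sq_step (w := (1, 0)) (by decide) (s + ey)
    rw [← ey_eq_shift] at h2
    rw [← ex_eq_shift, add_right_comm s ey ex] at h3
    rw [ht.symm (s + ex + ey) (s + ey), ht.symm (s + ey) s] at h1
    linear_combination t (s + ey) (s + ex + ey) * t s (s + ey) * h1 -
      t s (s + ex) * t (s + ex) (s + ex + ey) * h2 -
      t s (s + ex) * t (s + ex) (s + ex + ey) * t s (s + ey) * t s (s + ey) * h3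
  · simp

theorem trace_pow_mul_pow (ht : IsPiFlux t) {i j k l : ℕ} (h1 : i + j < Lx) (h2 : k + l < Ly) :
    ((stepMat t (1, 0) ^ i * stepMat t (-(1, 0)) ^ j) *
      (stepMat t (0, 1) ^ k * stepMat t (-(0, 1)) ^ l)).trace =
      if i = j ∧ k = l then (Lx : ℝ) * Ly else 0 := by
  split_ifs with h
  · obtain ⟨rfl, rfl⟩ := h
    have hX := stepMat_mul_stepMat_neg ht (w := (1, 0)) (by decide)
    have hX' := stepMat_mul_stepMat_neg ht (w := (-1, 0)) (by decide)
    have hY := stepMat_mul_stepMat_neg ht (w := (0, 1)) (by decide)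
    have hY' := stepMat_mul_stepMat_neg ht (w := (0, -1)) (by decide)
    have hcX : Commute (stepMat t (1, 0)) (stepMat t (-(1, 0))) := hX.trans hX'.symm
    have hcY : Commute (stepMat t (0, 1)) (stepMat t (-(0, 1))) := hY.trans hY'.symm
    rw [← hcX.mul_pow, ← hcY.mul_pow, hX, hY, one_pow, one_pow, one_mul, Matrix.trace_one]
    simp [ZMod.card]
  · refine ((((moves_stepMat t (1, 0)).pow i).mul ((moves_stepMat t (-(1, 0))).pow j)).mul
      (((moves_stepMat t (0, 1)).pow k).mul ((moves_stepMat t (-(0, 1))).pow l))).trace_eq_zero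
        ?_ ?_ ?_
    · intro h0
      obtain ⟨ha, hb⟩ := Prod.ext_iff.1 h0
      simp at ha hb
      omega
    · simp
      rw [abs_lt]
      constructor <;> omega
    · simp
      rw [abs_lt]
      constructor <;> omega

/-- In each direction the forward and backward steps commute, being mutually inverse. Only the
balanced term of each binomial expansion has a trace, and there the product of steps is the
identity: boundary phases do not enter. -/
theorem trace_sq_pow_mul_sq_pow (ht : IsPiFlux t) {i k : ℕ} (h1 : 2 * i < Lx) (h2 : 2 * k < Ly) :
    (((stepMat t (1, 0) + stepMat t (-(1, 0))) ^ 2) ^ i *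
      ((stepMat t (0, 1) + stepMat t (-(0, 1))) ^ 2) ^ k).trace =
      i.centralBinom * k.centralBinom * ((Lx : ℝ) * Ly) := by
  have hX := stepMat_mul_stepMat_neg ht (w := (1, 0)) (by decide)
  have hX' := stepMat_mul_stepMat_neg ht (w := (-1, 0)) (by decide)
  have hY := stepMat_mul_stepMat_neg ht (w := (0, 1)) (by decide)
  have hY' := stepMat_mul_stepMat_neg ht (w := (0, -1)) (by decide)
  have hcX : Commute (stepMat t (1, 0)) (stepMat t (-(1, 0))) := hX.trans hX'.symm
  have hcY : Commute (stepMat t (0, 1)) (stepMat t (-(0, 1))) := hY.trans hY'.symm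
  rw [← pow_mul, ← pow_mul, hcX.add_pow, hcY.add_pow, Finset.sum_mul_sum, Matrix.trace_sum]
  have hterm : ∀ a ∈ Finset.range (2 * i + 1), ∀ b ∈ Finset.range (2 * k + 1),
      ((stepMat t (1, 0) ^ a * stepMat t (-(1, 0)) ^ (2 * i - a) *
        (((2 * i).choose a : ℕ) : Matrix (Site Lx Ly) (Site Lx Ly) ℝ)) *
        (stepMat t (0, 1) ^ b * stepMat t (-(0, 1)) ^ (2 * k - b) *
        (((2 * k).choose b : ℕ) : Matrix (Site Lx Ly) (Site Lx Ly) ℝ))).trace =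
        if a = i then if b = k then i.centralBinom * k.centralBinom * ((Lx : ℝ) * Ly) else 0
          else 0 := by
    intro a ha b hb
    rw [Finset.mem_range] at ha hb
    rw [← nsmul_eq_mul', ← nsmul_eq_mul', smul_mul_smul_comm, Matrix.trace_smul,
      trace_pow_mul_pow ht (by omega) (by omega)]
    by_cases h1 : a = i
    · by_cases h2 : b = k
      · rw [if_pos (by omega), if_pos h1, if_pos h2, h1, h2, nsmul_eq_mul, Nat.centralBinom,
          Nat.centralBinom]
        push_cast
        ring
      · rw [if_neg (by omega), if_pos h1, if_neg h2, smul_zero]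
    · rw [if_neg (by omega), if_neg h1, smul_zero]
  rw [Finset.sum_congr rfl fun a ha => (Matrix.trace_sum _ _).trans
    (Finset.sum_congr rfl fun b hb => hterm a ha b hb)]
  rw [Finset.sum_eq_single i, Finset.sum_eq_single k]
  · simp
  · intro b _ hb; simp [hb]
  · intro h; exact absurd (Finset.mem_range.2 (by omega)) h
  · intro a _ ha; simp [ha]
  · intro h; exact absurd (Finset.mem_range.2 (by omega)) h

/-- The moments of the square of the dispersion. -/
def moment (m : ℕ) : ℝ :=
  ∑ i ∈ Finset.range (m + 1), i.centralBinom * (m - i).centralBinom * m.choose i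

/-- The x and y parts anticommute, because anticommutation of the unit steps passes to their
inverses. The mixed terms in the square cancel, and the two squares commute, so the binomial theorem
applies. -/
theorem trace_hopMat_sq_pow (ht : IsPiFlux t) (hx : 4 ≤ Lx) (hy : 4 ≤ Ly) {m : ℕ}
    (h1 : 2 * m < Lx) (h2 : 2 * m < Ly) :
    ((Matrix.of t ^ 2) ^ m).trace = (Lx : ℝ) * Ly * moment m := by
  have hX := stepMat_mul_stepMat_neg ht (w := (1, 0)) (by decide)
  have hX' := stepMat_mul_stepMat_neg ht (w := (-1, 0)) (by decide)
  have hY := stepMat_mul_stepMat_neg ht (w := (0, 1)) (by decide)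
  have hY' := stepMat_mul_stepMat_neg ht (w := (0, -1)) (by decide)
  have hXX' : stepMat t (-(1, 0)) * stepMat t (1, 0) = 1 := hX'
  have hYY' : stepMat t (-(0, 1)) * stepMat t (0, 1) = 1 := hY'
  have a1 := stepMat_anticomm ht
  have a2 := mul_eq_neg_of_inverse hY hYY' a1
  have a1' := mul_eq_neg_of_inverse hX hXX' (neg_eq_iff_eq_neg.2 a1).symm
  have a2' := mul_eq_neg_of_inverse hX hXX' (neg_eq_iff_eq_neg.2 a2).symm
  have hanti : (stepMat t (1, 0) + stepMat t (-(1, 0))) * (stepMat t (0, 1) + stepMat t (-(0, 1))) =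
      -((stepMat t (0, 1) + stepMat t (-(0, 1))) * (stepMat t (1, 0) + stepMat t (-(1, 0)))) := by
    rw [add_mul, mul_add, mul_add, add_mul, mul_add, mul_add, a1, a2, a1', a2']
    abel
  rw [hopMat_eq ht hx hy, sq_add_of_anticomm hanti, (commute_sq_of_anticomm hanti).add_pow,
    Matrix.trace_sum, moment, Finset.mul_sum]
  refine Finset.sum_congr rfl fun i hi => ?_
  rw [Finset.mem_range] at hi
  rw [← nsmul_eq_mul', Matrix.trace_smul, trace_sq_pow_mul_sq_pow ht (by omega) (by omega),
    nsmul_eq_mul]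
  ring

theorem sum_eigenvalues_sq_pow (ht : IsPiFlux t) (hx : 4 ≤ Lx) (hy : 4 ≤ Ly) {m : ℕ}
    (h1 : 2 * m < Lx) (h2 : 2 * m < Ly) :
    ∑ a, ((hopMat_isHermitian ht).eigenvalues a ^ 2) ^ m = (Lx : ℝ) * Ly * moment m := by
  rw [← trace_hopMat_sq_pow ht hx hy h1 h2, ← pow_mul,
    trace_pow_eq_sum_eigenvalues (hopMat_isHermitian ht)]
  simp only [pow_mul]

/-- Gershgorin's theorem: a row has at most four nonzero entries, each of modulus 1. -/
theorem eigenvalues_sq_mem (ht : IsPiFlux t) (a : Site Lx Ly) :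
    (hopMat_isHermitian ht).eigenvalues a ^ 2 ∈ Set.Icc (0 : ℝ) 16 := by
  refine ⟨sq_nonneg _, ?_⟩
  have hT := hopMat_isHermitian ht
  have hev : Module.End.HasEigenvalue (Matrix.toLin' (Matrix.of t)) (hT.eigenvalues a) :=
    Module.End.hasEigenvalue_of_hasEigenvector (x := (hT.eigenvectorBasis a).ofLp)
      ⟨Module.End.mem_eigenspace_iff.2 (by
        rw [Matrix.toLin'_apply, hT.mulVec_eigenvectorBasis]),
        fun h => hT.eigenvectorBasis.orthonormal.ne_zero a (by ext j; exact congrFun h j)⟩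
  obtain ⟨k, hk⟩ := eigenvalue_mem_ball hev
  rw [Metric.mem_closedBall, Real.dist_eq] at hk
  have hsum : |t k k| + ∑ j ∈ Finset.univ.erase k, ‖Matrix.of t k j‖ ≤ 4 := by
    have e : |t k k| + ∑ j ∈ Finset.univ.erase k, ‖Matrix.of t k j‖ = ∑ j, |t k j| :=
      Finset.add_sum_erase _ (fun j => |t k j|) (Finset.mem_univ k)
    rw [e]
    have hsub : ∑ j, |t k j| = ∑ j ∈ steps.image fun w => k + shift w, |t k j| := by
      refine (Finset.sum_subset (Finset.subset_univ _) fun j _ hj => ?_).symm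
      rw [ht.nonbond k j, abs_zero]
      intro hn
      obtain ⟨w, hw, rfl⟩ := isNeighbour_iff.1 hn
      exact hj (Finset.mem_image_of_mem _ hw)
    rw [hsub]
    have hle : ∀ j ∈ steps.image fun w => k + shift w, |t k j| ≤ 1 := by
      intro j hj
      obtain ⟨w, hw, rfl⟩ := Finset.mem_image.1 hj
      rcases ht.bond _ _ (isNeighbour_iff.2 ⟨w, hw, rfl⟩) with h | h <;> rw [h] <;> norm_num
    refine (Finset.sum_le_card_nsmul _ _ 1 hle).trans ?_
    have : (steps.image fun w => k + shift w).card ≤ 4 := Finset.card_image_le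
    rw [nsmul_eq_mul, mul_one]
    exact_mod_cast this
  have h4 : |hT.eigenvalues a| ≤ 4 := by
    have h5 : |hT.eigenvalues a| ≤ |hT.eigenvalues a - t k k| + |t k k| := by
      have := abs_add_le (hT.eigenvalues a - t k k) (t k k)
      rwa [sub_add_cancel] at this
    have : |hT.eigenvalues a - t k k| ≤ _ := hk
    linarith
  have := sq_le_sq' (abs_le.1 h4).1 (abs_le.1 h4).2
  linarith

end Moves

/-! ## Means over the Brillouin zone -/

/-- The mean over a period. -/
def circleMean (f : ℝ → ℝ) : ℝ := 1 / (2 * Real.pi) * ∫ x in (0 : ℝ)..(2 * Real.pi), f x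

/-- The mean over two periods. -/
def torusMean (F : ℝ → ℝ → ℝ) : ℝ := circleMean fun x => circleMean fun y => F x y

theorem circleMean_sum {ι : Type*} (s : Finset ι) (c : ι → ℝ) (f : ι → ℝ → ℝ)
    (hf : ∀ i ∈ s, Continuous (f i)) :
    circleMean (fun x => ∑ i ∈ s, c i * f i x) = ∑ i ∈ s, c i * circleMean (f i) := by
  simp only [circleMean]
  rw [intervalIntegral.integral_finsetSum (f := fun i x => c i * f i x) fun i hi =>
    (continuous_const.mul (hf i hi)).intervalIntegrable _ _, Finset.mul_sum]
  refine Finset.sum_congr rfl fun i _ => ?_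
  rw [intervalIntegral.integral_const_mul]
  ring

theorem circleMean_const_mul (c : ℝ) (f : ℝ → ℝ) :
    circleMean (fun x => c * f x) = c * circleMean f := by
  simp only [circleMean]
  rw [intervalIntegral.integral_const_mul]
  ring

theorem continuous_circleMean {F : ℝ → ℝ → ℝ} (hF : Continuous (Function.uncurry F)) :
    Continuous fun x => circleMean fun y => F x y :=
  continuous_const.mul
    (intervalIntegral.continuous_parametric_intervalIntegral_of_continuous' hF _ _)

theorem abs_circleMean_le {f : ℝ → ℝ} {C : ℝ} (hf : ∀ x, |f x| ≤ C) : |circleMean f| ≤ C := by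
  have hp : 0 < 2 * Real.pi := Real.two_pi_pos
  have := intervalIntegral.norm_integral_le_of_norm_le_const (a := 0) (b := 2 * Real.pi) (f := f)
    (C := C) fun x _ => hf x
  rw [Real.norm_eq_abs, sub_zero, abs_of_pos hp] at this
  rw [circleMean, abs_mul, abs_of_pos (by positivity), one_div, inv_mul_le_iff₀ hp]
  linarith

theorem torusMean_sum {ι : Type*} (s : Finset ι) (c : ι → ℝ) (F : ι → ℝ → ℝ → ℝ)
    (hF : ∀ i ∈ s, Continuous (Function.uncurry (F i))) :
    torusMean (fun x y => ∑ i ∈ s, c i * F i x y) = ∑ i ∈ s, c i * torusMean (F i) := by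
  simp only [torusMean]
  rw [← circleMean_sum _ _ _ fun i hi => continuous_circleMean (hF i hi)]
  congr 1
  funext x
  exact circleMean_sum _ _ _ fun i hi => (hF i hi).comp (Continuous.prodMk_right x)

theorem torusMean_sub {F G : ℝ → ℝ → ℝ} (hF : Continuous (Function.uncurry F))
    (hG : Continuous (Function.uncurry G)) :
    torusMean (fun x y => F x y - G x y) = torusMean F - torusMean G := by
  have := torusMean_sum Finset.univ ![1, -1] ![F, G] (by
    intro i _
    fin_cases i
    exacts [hF, hG])
  simp only [Fin.sum_univ_two, Matrix.cons_val_zero, Matrix.cons_val_one, one_mul, neg_mul,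
    ← sub_eq_add_neg] at this
  exact this

theorem abs_torusMean_le {F : ℝ → ℝ → ℝ} {C : ℝ} (hF : ∀ x y, |F x y| ≤ C) : |torusMean F| ≤ C :=
  abs_circleMean_le fun x => abs_circleMean_le (hF x)

theorem torusMean_add_pow {f g : ℝ → ℝ} (hf : Continuous f) (hg : Continuous g) (n : ℕ) :
    torusMean (fun x y => (f x + g y) ^ n) = ∑ i ∈ Finset.range (n + 1),
      n.choose i * (circleMean (fun x => f x ^ i) * circleMean fun y => g y ^ (n - i)) := by
  have h : (fun x y => (f x + g y) ^ n) = fun x y => ∑ i ∈ Finset.range (n + 1),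
      (n.choose i : ℝ) * (f x ^ i * g y ^ (n - i)) := by
    funext x y
    rw [add_pow]
    exact Finset.sum_congr rfl fun i _ => by ring
  rw [h, torusMean_sum _ _ _ fun i _ => by
    have h1 : Continuous fun p : ℝ × ℝ => f p.1 := hf.comp continuous_fst
    have h2 : Continuous fun p : ℝ × ℝ => g p.2 := hg.comp continuous_snd
    exact (h1.pow i).mul (h2.pow (n - i))]
  refine Finset.sum_congr rfl fun i _ => ?_
  congr 1
  rw [torusMean]
  simp only [circleMean_const_mul]
  rw [mul_comm (circleMean fun x => f x ^ i), ← circleMean_const_mul]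
  simp only [mul_comm]

/-- The boundary term of the reduction formula contains a sine and vanishes at both ends. -/
theorem integral_cos_pow_even {b : ℝ} (hb : Real.sin b = 0) (n : ℕ) :
    ∫ x in (0 : ℝ)..b, Real.cos x ^ (2 * n) = b * (n.centralBinom / 4 ^ n) := by
  induction n with
  | zero => simp
  | succ n ih =>
    rw [mul_add, mul_one, integral_cos_pow, ih, hb, Real.sin_zero]
    have h := Nat.succ_mul_centralBinom_succ n
    have h' : ((n : ℝ) + 1) * (n + 1).centralBinom = 2 * (2 * n + 1) * n.centralBinom := by
      exact_mod_cast h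
    have : ((n + 1).centralBinom : ℝ) = 2 * (2 * n + 1) * n.centralBinom / (n + 1) := by
      field_simp
      linarith
    rw [this]
    push_cast
    field_simp
    ring

theorem integral_cos_pow_odd {b : ℝ} (hb : Real.sin b = 0) (n : ℕ) :
    ∫ x in (0 : ℝ)..b, Real.cos x ^ (2 * n + 1) = 0 := by
  induction n with
  | zero => simp [hb]
  | succ n ih =>
    rw [show 2 * (n + 1) + 1 = 2 * n + 1 + 2 by ring, integral_cos_pow, ih, hb, Real.sin_zero]
    simp

theorem circleMean_cos_mul_pow {k : ℕ} (hk : k ≠ 0) (n : ℕ) :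
    circleMean (fun x => Real.cos (k * x) ^ n) =
      if Even n then ((n / 2).centralBinom : ℝ) / 4 ^ (n / 2) else 0 := by
  have hk' : (k : ℝ) ≠ 0 := by exact_mod_cast hk
  have hs : Real.sin (k * (2 * Real.pi)) = 0 := by
    have := Real.sin_nat_mul_pi (2 * k)
    push_cast at this
    rw [← this]
    congr 1
    ring
  rw [circleMean, intervalIntegral.integral_comp_mul_left (fun x => Real.cos x ^ n) hk', mul_zero]
  split_ifs with h
  · obtain ⟨m, rfl⟩ := h
    rw [← two_mul, integral_cos_pow_even hs, Nat.mul_div_cancel_left m two_pos, smul_eq_mul]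
    have := Real.pi_ne_zero
    field_simp
  · obtain ⟨m, rfl⟩ := Nat.not_even_iff_odd.1 h
    rw [integral_cos_pow_odd hs, smul_zero, mul_zero]

/-- The square of the dispersion of the model with flux `π`. -/
def bandSq (x y : ℝ) : ℝ := (2 * Real.cos x) ^ 2 + (2 * Real.cos y) ^ 2

theorem continuous_bandSq : Continuous (Function.uncurry bandSq) := by
  unfold bandSq Function.uncurry
  fun_prop

theorem bandSq_mem (x y : ℝ) : bandSq x y ∈ Set.Icc (0 : ℝ) 16 := by
  have h1 := Real.cos_sq_le_one x
  have h2 := Real.cos_sq_le_one y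
  unfold bandSq
  constructor
  · positivity
  · nlinarith

/-- The mean of (2 cos x)^(2i) is a central binomial coefficient, just as the number of balanced
step sequences on the lattice; hence the moments agree. -/
theorem torusMean_bandSq_pow (m : ℕ) : torusMean (fun x y => bandSq x y ^ m) = moment m := by
  have hc : ∀ i, circleMean (fun x => ((2 * Real.cos x) ^ 2) ^ i) = i.centralBinom := by
    intro i
    have h := circleMean_cos_mul_pow one_ne_zero (2 * i)
    rw [if_pos (even_two_mul i), Nat.mul_div_cancel_left i two_pos] at h
    have h2 : (fun x => ((2 * Real.cos x) ^ 2) ^ i) =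
        fun x => (4 : ℝ) ^ i * Real.cos ((1 : ℕ) * x) ^ (2 * i) := by
      funext x
      rw [Nat.cast_one, one_mul, mul_pow, mul_pow, ← pow_mul (Real.cos x)]
      norm_num
    rw [h2, circleMean_const_mul, h]
    field_simp
  unfold bandSq
  rw [torusMean_add_pow (by fun_prop) (by fun_prop), moment]
  refine Finset.sum_congr rfl fun i _ => ?_
  rw [hc, hc]
  ring

theorem fermionLimit_eq : fermionLimit = -(1 / 2) * torusMean fun x y => Real.sqrt (bandSq x y) := by
  have h : ∀ x y, Real.sqrt (bandSq x y) = 2 * Real.sqrt (Real.cos x ^ 2 + Real.cos y ^ 2) := by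
    intro x y
    rw [bandSq, show (2 * Real.cos x) ^ 2 + (2 * Real.cos y) ^ 2 =
      2 ^ 2 * (Real.cos x ^ 2 + Real.cos y ^ 2) by ring, Real.sqrt_mul (by norm_num),
      Real.sqrt_sq (by norm_num)]
  simp only [torusMean, h, circleMean_const_mul]
  simp only [circleMean, intervalIntegral.integral_const_mul, fermionLimit]
  have := Real.pi_ne_zero
  field_simp
  ring

/-- Both the eigenvalue sum and the integral are means of the square root over quantities in [0,
16]. A polynomial close to the square root has the same mean in both cases as long as the torus
exceeds twice its degree. -/
theorem tendsto_fermionEnergy (ε : ℝ) (hε : 0 < ε) : ∃ L₀ : ℕ, ∀ (Lx Ly : ℕ) [NeZero Lx] [NeZero Ly],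
    L₀ ≤ Lx → L₀ ≤ Ly → ∀ t : Site Lx Ly → Site Lx Ly → ℝ, IsPiFlux t →
      |fermionEnergy t / ((Lx : ℝ) * (Ly : ℝ)) - fermionLimit| < ε := by
  obtain ⟨p, hp⟩ := exists_polynomial_near_of_continuousOn 0 16 Real.sqrt
    Real.continuous_sqrt.continuousOn (ε / 2) (by positivity)
  refine ⟨2 * p.natDegree + 4, fun Lx Ly _ _ hx hy t ht => ?_⟩
  have hx4 : 4 ≤ Lx := by omega
  have hy4 : 4 ≤ Ly := by omega
  have hN : 0 < (Lx : ℝ) * Ly := by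
    have := NeZero.pos Lx
    have := NeZero.pos Ly
    positivity
  set μ := (hopMat_isHermitian ht).eigenvalues with hμ
  set P : ℝ := ∑ i ∈ Finset.range (p.natDegree + 1), p.coeff i * moment i with hP
  have h1 : |torusMean (fun x y => Real.sqrt (bandSq x y)) - P| ≤ ε / 2 := by
    have hc : ∀ i, Continuous (Function.uncurry fun x y => bandSq x y ^ i) := fun i =>
      continuous_bandSq.pow i
    have hPm : P = torusMean fun x y => p.eval (bandSq x y) := by
      simp only [Polynomial.eval_eq_sum_range]
      rw [torusMean_sum _ _ (fun i x y => bandSq x y ^ i) fun i _ => hc i, hP]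
      simp only [torusMean_bandSq_pow]
    rw [hPm, ← torusMean_sub]
    · refine abs_torusMean_le fun x y => ?_
      rw [abs_sub_comm]
      exact (hp _ (bandSq_mem x y)).le
    · exact Real.continuous_sqrt.comp continuous_bandSq
    · exact p.continuous.comp continuous_bandSq
  have h2 : |∑ a, |μ a| - Lx * Ly * P| ≤ Lx * Ly * (ε / 2) := by
    have hs : Lx * Ly * P = ∑ a, p.eval (μ a ^ 2) := by
      simp only [Polynomial.eval_eq_sum_range]
      rw [Finset.sum_comm, hP, Finset.mul_sum]
      refine Finset.sum_congr rfl fun i hi => ?_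
      rw [Finset.mem_range] at hi
      rw [← Finset.mul_sum, sum_eigenvalues_sq_pow ht hx4 hy4 (by omega) (by omega)]
      ring
    rw [hs, ← Finset.sum_sub_distrib]
    refine (Finset.abs_sum_le_sum_abs _ _).trans ?_
    have hb : ∀ a ∈ Finset.univ, |(|μ a| - p.eval (μ a ^ 2))| ≤ ε / 2 := fun a _ => by
      rw [abs_sub_comm, ← Real.sqrt_sq_eq_abs (μ a)]
      exact (hp _ (eigenvalues_sq_mem ht a)).le
    refine (Finset.sum_le_card_nsmul _ _ _ hb).trans (le_of_eq ?_)
    rw [Finset.card_univ, Fintype.card_prod, ZMod.card, ZMod.card, nsmul_eq_mul]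
    push_cast
    ring
  have h3 : |(∑ a, |μ a|) / (Lx * Ly) - P| ≤ ε / 2 := by
    rw [← mul_le_mul_iff_right₀ hN, ← abs_of_pos hN, ← abs_mul, abs_of_pos hN, mul_sub,
      mul_div_cancel₀ _ hN.ne']
    exact h2
  have h4 : fermionEnergy t = -(1 / 2) * ∑ a, |μ a| :=
    groundEnergy_fermionHamiltonian ht.symm (ht.diag hx4 hy4) (hopMat_isHermitian ht)
  rw [h4, fermionLimit_eq]
  rw [abs_le] at h1 h3
  rw [mul_div_assoc, abs_lt]
  constructor <;> linarith [h1.1, h1.2, h3.1, h3.2]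

/-! ## The value of the fermionic energy -/

theorem ring_choose_succ (a : ℝ) (n : ℕ) :
    ((n : ℝ) + 1) * Ring.choose a (n + 1) = (a - n) * Ring.choose a n := by
  have h := Nat.factorial_ne_zero n
  simp only [Ring.choose_eq_smul, descPochhammer_succ_right, Polynomial.smeval_mul,
    Polynomial.smeval_sub, Polynomial.smeval_X, Polynomial.smeval_natCast, Nat.factorial_succ,
    smul_eq_mul, pow_one, pow_zero, nsmul_eq_mul, mul_one]
  push_cast
  field_simp

theorem hasSum_sqrt_one_add {z : ℝ} (hz : |z| < 1) :
    HasSum (fun n => Ring.choose (1 / 2 : ℝ) n * z ^ n) (Real.sqrt (1 + z)) := by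
  have h := (Real.one_add_rpow_hasFPowerSeriesOnBall_zero (a := 1 / 2)).hasSum (y := z) (by
    rw [Metric.mem_eball, edist_zero_right]
    have : ‖z‖₊ < 1 := by
      rw [← NNReal.coe_lt_coe]
      exact hz
    rw [enorm_eq_nnnorm]
    exact_mod_cast this)
  simp only [binomialSeries_apply, zero_add, List.ofFn_const, List.prod_replicate, smul_eq_mul] at h
  rwa [Real.sqrt_eq_rpow]

/-- Successive coefficients have ratio at most 1 in modulus. This crude bound gives geometric
domination for r < 1. -/
theorem abs_choose_half_le (n : ℕ) : |Ring.choose (1 / 2 : ℝ) n| ≤ 1 := by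
  induction n with
  | zero => simp
  | succ n ih =>
    have h := ring_choose_succ (1 / 2) n
    have hn : (0 : ℝ) < n + 1 := by positivity
    have h2 : ((n : ℝ) + 1) * |Ring.choose (1 / 2 : ℝ) (n + 1)| =
        |1 / 2 - (n : ℝ)| * |Ring.choose (1 / 2 : ℝ) n| := by
      rw [← abs_mul, ← h, abs_mul, abs_of_pos hn]
    have h3 : |1 / 2 - (n : ℝ)| ≤ n + 1 := by
      have : (0 : ℝ) ≤ n := n.cast_nonneg
      rw [abs_le]
      constructor <;> linarith
    have h4 : ((n : ℝ) + 1) * |Ring.choose (1 / 2 : ℝ) (n + 1)| ≤ (n + 1) * 1 := by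
      rw [h2]
      exact mul_le_mul h3 ih (abs_nonneg _) hn.le
    exact le_of_mul_le_mul_left h4 hn

/-- The reduced dispersion. -/
def bandW (x y : ℝ) : ℝ := Real.cos ((2 : ℕ) * x) / 2 + Real.cos ((2 : ℕ) * y) / 2

theorem continuous_bandW : Continuous (Function.uncurry bandW) := by
  unfold bandW Function.uncurry
  fun_prop

theorem abs_bandW_le (x y : ℝ) : |bandW x y| ≤ 1 := by
  have h1 := abs_le.1 (Real.abs_cos_le_one ((2 : ℕ) * x))
  have h2 := abs_le.1 (Real.abs_cos_le_one ((2 : ℕ) * y))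
  rw [bandW, abs_le]
  generalize Real.cos ((2 : ℕ) * x) = a at *
  generalize Real.cos ((2 : ℕ) * y) = b at *
  constructor <;> linarith [h1.1, h1.2, h2.1, h2.2]

theorem bandSq_eq (x y : ℝ) : bandSq x y = 2 ^ 2 * (1 + bandW x y) := by
  rw [bandSq, bandW, Nat.cast_ofNat, Real.cos_two_mul, Real.cos_two_mul]
  ring

theorem sum_range_eq_sum_even {h : ℕ → ℝ} (hodd : ∀ i, ¬ Even i → h i = 0) (m : ℕ) :
    ∑ i ∈ Finset.range (2 * m + 1), h i = ∑ j ∈ Finset.range (m + 1), h (2 * j) := by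
  induction m with
  | zero => simp
  | succ m ih =>
    rw [Finset.sum_range_succ _ (m + 1), ← ih, mul_add, mul_one, Finset.sum_range_succ,
      Finset.sum_range_succ, hodd (2 * m + 1) (by simp), add_zero]

/-- It turns the sum over j in the even moments into the sum of squared binomial coefficients, which
is again a central one. -/
theorem choose_mul_centralBinom_mul_centralBinom {m j : ℕ} (hj : j ≤ m) :
    ((2 * m).choose (2 * j) : ℝ) * (j.centralBinom * (m - j).centralBinom) =
      m.centralBinom * (m.choose j : ℝ) ^ 2 := by
  obtain ⟨l, rfl⟩ := Nat.exists_eq_add_of_le hj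
  have f : ∀ n : ℕ, (n.factorial : ℝ) ≠ 0 := fun n => by exact_mod_cast n.factorial_ne_zero
  have hc : ∀ n : ℕ, (n.centralBinom : ℝ) = (n + n).factorial / (n.factorial * n.factorial) :=
    fun n => by rw [Nat.centralBinom, two_mul, Nat.cast_add_choose]
  rw [hc, hc, hc, Nat.add_sub_cancel_left, show 2 * (j + l) = (j + j) + (l + l) by ring,
    show 2 * j = j + j by ring, Nat.cast_add_choose, Nat.cast_add_choose]
  have := f j; have := f l; have := f (j + j); have := f (l + l); have := f (j + l)
  rw [show j + j + (l + l) = j + l + (j + l) by ring]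
  field_simp

theorem circleMean_half_cos_pow (i : ℕ) :
    circleMean (fun x => (Real.cos ((2 : ℕ) * x) / 2) ^ i) =
      (1 / 2) ^ i * if Even i then ((i / 2).centralBinom : ℝ) / 4 ^ (i / 2) else 0 := by
  rw [← circleMean_cos_mul_pow two_ne_zero, ← circleMean_const_mul]
  congr 1
  funext x
  rw [← mul_pow]
  congr 1
  ring

theorem torusMean_bandW_pow_odd {n : ℕ} (hn : ¬ Even n) :
    torusMean (fun x y => bandW x y ^ n) = 0 := by
  unfold bandW
  rw [torusMean_add_pow (by fun_prop) (by fun_prop)]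
  refine Finset.sum_eq_zero fun i hi => ?_
  rw [circleMean_half_cos_pow, circleMean_half_cos_pow]
  have hi' : i ≤ n := Nat.lt_succ_iff.1 (Finset.mem_range.1 hi)
  by_cases h : Even i
  · rw [if_neg (c := Even (n - i)) fun h2 => hn ((Nat.even_sub hi').1 h2 |>.2 h)]
    ring
  · rw [if_neg h]; ring

theorem torusMean_bandW_pow_even (m : ℕ) :
    torusMean (fun x y => bandW x y ^ (2 * m)) = ((m.centralBinom : ℝ) / 4 ^ m) ^ 2 := by
  unfold bandW
  rw [torusMean_add_pow (by fun_prop) (by fun_prop)]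
  simp only [circleMean_half_cos_pow]
  rw [sum_range_eq_sum_even fun i hi => by rw [if_neg hi]; ring]
  have hterm : ∀ j ∈ Finset.range (m + 1), ((2 * m).choose (2 * j) : ℝ) *
      ((1 / 2) ^ (2 * j) * (if Even (2 * j) then ((2 * j / 2).centralBinom : ℝ) / 4 ^ (2 * j / 2)
        else 0) * ((1 / 2) ^ (2 * m - 2 * j) * if Even (2 * m - 2 * j) then
          (((2 * m - 2 * j) / 2).centralBinom : ℝ) / 4 ^ ((2 * m - 2 * j) / 2) else 0)) =
      m.centralBinom / 4 ^ m / 4 ^ m * ((m.choose j ^ 2 : ℕ) : ℝ) := by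
    intro j hj
    have hj' : j ≤ m := Nat.lt_succ_iff.1 (Finset.mem_range.1 hj)
    have h := choose_mul_centralBinom_mul_centralBinom hj'
    rw [← Nat.mul_sub, if_pos (even_two_mul j), if_pos (even_two_mul (m - j)),
      Nat.mul_div_cancel_left _ two_pos, Nat.mul_div_cancel_left _ two_pos]
    have h4 : (4 : ℝ) ^ m = 4 ^ j * 4 ^ (m - j) := by rw [← pow_add, Nat.add_sub_cancel' hj']
    have h2 : ((1 : ℝ) / 2) ^ (2 * j) * (1 / 2) ^ (2 * (m - j)) = 1 / 4 ^ m := by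
      rw [← pow_add, ← Nat.mul_add, Nat.add_sub_cancel' hj', pow_mul, ← one_div_pow]
      norm_num
    push_cast
    calc _ = ((2 * m).choose (2 * j) : ℝ) * (j.centralBinom * (m - j).centralBinom) *
          (((1 : ℝ) / 2) ^ (2 * j) * (1 / 2) ^ (2 * (m - j))) / (4 ^ j * 4 ^ (m - j)) := by
          field_simp
      _ = _ := by rw [h, h2, ← h4]; field_simp
  rw [Finset.sum_congr rfl hterm, ← Finset.mul_sum, ← Nat.cast_sum, Nat.sum_range_choose_sq]
  rw [← Nat.centralBinom]
  ring

/-- The coefficients of the series of the fermionic energy. -/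
def bandCoeff : ℕ → ℝ
  | 0 => 1
  | m + 1 => bandCoeff m * ((16 * (m : ℝ) ^ 2 - 1) * (2 * m + 1) / (32 * ((m : ℝ) + 1) ^ 3))

theorem bandCoeff_eq (m : ℕ) :
    bandCoeff m = Ring.choose (1 / 2 : ℝ) (2 * m) * ((m.centralBinom : ℝ) / 4 ^ m) ^ 2 := by
  induction m with
  | zero => simp [bandCoeff]
  | succ m ih =>
    have h1 := ring_choose_succ (1 / 2) (2 * m)
    have h2 := ring_choose_succ (1 / 2) (2 * m + 1)
    have h3 : ((m : ℝ) + 1) * (m + 1).centralBinom = 2 * (2 * m + 1) * m.centralBinom := by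
      exact_mod_cast Nat.succ_mul_centralBinom_succ m
    have hm : (m : ℝ) + 1 ≠ 0 := by positivity
    have hm2 : (2 * m : ℝ) + 1 ≠ 0 := by positivity
    push_cast at h1 h2
    have e1 : Ring.choose (1 / 2 : ℝ) (2 * m + 1) =
        (1 / 2 - 2 * m) * Ring.choose (1 / 2) (2 * m) / (2 * m + 1) := by
      field_simp at h1 ⊢
      linarith
    have e2 : Ring.choose (1 / 2 : ℝ) (2 * m + 1 + 1) =
        (1 / 2 - (2 * m + 1)) * Ring.choose (1 / 2) (2 * m + 1) / (2 * m + 1 + 1) := by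
      rw [eq_div_iff (by positivity)]
      linarith
    have e3 : ((m + 1).centralBinom : ℝ) = 2 * (2 * m + 1) * m.centralBinom / (m + 1) := by
      rw [eq_div_iff hm]
      linarith
    rw [bandCoeff, ih, show 2 * (m + 1) = 2 * m + 1 + 1 by ring, e2, e1, e3, pow_succ]
    field_simp
    ring

/-- For r < 1 the binomial series converges uniformly, with a geometric tail, so the mean may be
taken term by term; the odd moments vanish. -/
theorem hasSum_torusMean_sqrt {r : ℝ} (h0 : 0 ≤ r) (h1 : r < 1) :
    HasSum (fun m => bandCoeff m * r ^ (2 * m))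
      (torusMean fun x y => Real.sqrt (1 + r * bandW x y)) := by
  have hall : HasSum (fun n => Ring.choose (1 / 2 : ℝ) n * r ^ n *
      torusMean fun x y => bandW x y ^ n) (torusMean fun x y => Real.sqrt (1 + r * bandW x y)) := by
    have hgeom : Summable fun n : ℕ => r ^ n := summable_geometric_of_lt_one h0 h1
    have hz : ∀ x y, |r * bandW x y| ≤ r := fun x y => by
      rw [abs_mul, abs_of_nonneg h0]
      exact mul_le_of_le_one_right h0 (abs_bandW_le x y)
    have hterm : ∀ x y n, |Ring.choose (1 / 2 : ℝ) n * (r * bandW x y) ^ n| ≤ r ^ n := by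
      intro x y n
      rw [abs_mul, abs_pow]
      exact (mul_le_of_le_one_left (by positivity) (abs_choose_half_le n)).trans
        (pow_le_pow_left₀ (abs_nonneg _) (hz x y) n)
    have hsum : Summable fun n => Ring.choose (1 / 2 : ℝ) n * r ^ n *
        torusMean fun x y => bandW x y ^ n := by
      refine Summable.of_norm_bounded hgeom fun n => ?_
      rw [Real.norm_eq_abs, abs_mul, abs_mul, abs_of_nonneg (pow_nonneg h0 n)]
      have h2 : |torusMean fun x y => bandW x y ^ n| ≤ 1 := abs_torusMean_le fun x y => by
        rw [abs_pow]; exact pow_le_one₀ (abs_nonneg _) (abs_bandW_le x y)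
      have h3 := abs_choose_half_le n
      have h4 := pow_nonneg h0 n
      calc _ ≤ 1 * r ^ n * 1 := by gcongr
        _ = r ^ n := by ring
    refine (hsum.hasSum_iff_tendsto_nat).2 ?_
    have htail : Filter.Tendsto (fun n => ∑' k, r ^ (k + n)) Filter.atTop (nhds 0) :=
      tendsto_sum_nat_add fun n => r ^ n
    refine tendsto_iff_norm_sub_tendsto_zero.2 (squeeze_zero (fun _ => norm_nonneg _) (fun N => ?_)
      htail)
    have hP : ∑ n ∈ Finset.range N, Ring.choose (1 / 2 : ℝ) n * r ^ n *
        (torusMean fun x y => bandW x y ^ n) = torusMean fun x y => ∑ n ∈ Finset.range N,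
          Ring.choose (1 / 2 : ℝ) n * r ^ n * bandW x y ^ n :=
      (torusMean_sum _ _ (fun n x y => bandW x y ^ n) fun n _ => continuous_bandW.pow n).symm
    rw [hP, norm_sub_rev, Real.norm_eq_abs, ← torusMean_sub]
    · refine abs_torusMean_le fun x y => ?_
      have hs := hasSum_sqrt_one_add ((hz x y).trans_lt h1)
      have hsumm : Summable fun k => Ring.choose (1 / 2 : ℝ) (k + N) * (r * bandW x y) ^ (k + N) :=
        (summable_nat_add_iff N).2 hs.summable
      have hsub : Real.sqrt (1 + r * bandW x y) - ∑ n ∈ Finset.range N,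
          Ring.choose (1 / 2 : ℝ) n * r ^ n * bandW x y ^ n =
          ∑' k, Ring.choose (1 / 2 : ℝ) (k + N) * (r * bandW x y) ^ (k + N) := by
        rw [← hs.tsum_eq, ← hs.summable.sum_add_tsum_nat_add N]
        simp only [mul_pow, mul_assoc, add_sub_cancel_left]
      rw [hsub, ← Real.norm_eq_abs]
      exact tsum_of_norm_bounded ((summable_nat_add_iff N).2 hgeom).hasSum fun k => hterm x y _
    · exact Real.continuous_sqrt.comp (continuous_const.add (continuous_const.mul continuous_bandW))
    · exact continuous_finsetSum _ fun n _ => continuous_const.mul (continuous_bandW.pow n)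
  have hinj : Function.Injective fun m : ℕ => 2 * m := fun a b h => by
    simp only at h; omega
  have := (hinj.hasSum_iff fun n hn => ?_).2 hall
  · refine this.congr_fun fun m => ?_
    rw [Function.comp_apply, torusMean_bandW_pow_even, bandCoeff_eq]
    ring
  · rw [torusMean_bandW_pow_odd fun h => hn ?_, mul_zero]
    obtain ⟨m, rfl⟩ := h
    exact ⟨m, two_mul m⟩

/-- The quantity -a_m m² equals 1/32 at m = 1 and does not increase, because the ratio of successive
coefficients is at most (m/(m+1))². -/
theorem bandCoeff_succ_neg (m : ℕ) :
    bandCoeff (m + 1) < 0 ∧ -bandCoeff (m + 1) * ((m : ℝ) + 1) ^ 2 ≤ 1 / 32 := by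
  induction m with
  | zero => norm_num [bandCoeff]
  | succ m ih =>
    obtain ⟨h1, h2⟩ := ih
    have hm : (0 : ℝ) ≤ m := m.cast_nonneg
    set ρ : ℝ := (16 * ((m + 1 : ℕ) : ℝ) ^ 2 - 1) * (2 * ((m + 1 : ℕ) : ℝ) + 1) /
      (32 * (((m + 1 : ℕ) : ℝ) + 1) ^ 3) with hρ
    have hrec : bandCoeff (m + 1 + 1) = bandCoeff (m + 1) * ρ := rfl
    have hpos : 0 < ρ := by
      rw [hρ]
      push_cast
      have : (0 : ℝ) < 16 * ((m : ℝ) + 1) ^ 2 - 1 := by nlinarith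
      positivity
    refine ⟨by rw [hrec]; exact mul_neg_of_neg_of_pos h1 hpos, le_trans ?_ h2⟩
    have hle : ρ * ((m : ℝ) + 1 + 1) ^ 2 ≤ ((m : ℝ) + 1) ^ 2 := by
      rw [hρ]
      push_cast
      rw [div_mul_eq_mul_div, div_le_iff₀ (by positivity)]
      have h3 : ((m : ℝ) + 1) ^ 2 * (32 * (m + 1 + 1) ^ 3) -
          (16 * (m + 1) ^ 2 - 1) * (2 * (m + 1) + 1) * (m + 1 + 1) ^ 2 =
          (m + 1 + 1) ^ 2 * (16 * (m + 1) ^ 2 + 2 * (m + 1) + 1) := by ring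
      have h4 : (0 : ℝ) ≤ (m + 1 + 1) ^ 2 * (16 * (m + 1) ^ 2 + 2 * (m + 1) + 1) := by positivity
      linarith
    have := mul_le_mul_of_nonneg_left hle (neg_nonneg.2 h1.le)
    rw [hrec]
    push_cast
    linarith

theorem summable_bandCoeff : Summable bandCoeff := by
  rw [← summable_nat_add_iff 1]
  have hs : Summable fun m : ℕ => 1 / 32 * (1 / (((m + 1 : ℕ) : ℝ)) ^ 2) :=
    ((summable_nat_add_iff 1).2 (Real.summable_one_div_nat_pow.2 one_lt_two)).mul_left _
  refine Summable.of_norm_bounded hs fun m => ?_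
  obtain ⟨h1, h2⟩ := bandCoeff_succ_neg m
  rw [Real.norm_eq_abs, abs_of_neg h1]
  push_cast
  rw [mul_one_div, le_div_iff₀ (by positivity)]
  exact h2

theorem sqrt_le_sqrt_add_sqrt {a b d : ℝ} (h : a ≤ b + d) (hb : 0 ≤ b) (hd : 0 ≤ d) :
    Real.sqrt a ≤ Real.sqrt b + Real.sqrt d := by
  refine Real.sqrt_le_iff.2 ⟨by positivity, ?_⟩
  nlinarith [Real.sq_sqrt hb, Real.sq_sqrt hd, mul_nonneg (Real.sqrt_nonneg b) (Real.sqrt_nonneg d)]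

/-- Abel's limit r → 1: the series side passes by dominated convergence, the integral side since the
integrands differ by at most √(1 - r) uniformly. -/
theorem hasSum_bandCoeff :
    HasSum bandCoeff (torusMean fun x y => Real.sqrt (1 + bandW x y)) := by
  have hev : ∀ᶠ r : ℝ in nhdsWithin 1 (Set.Iio 1), r ∈ Set.Ioo 0 1 :=
    Ioo_mem_nhdsLT one_pos
  have h1 : Filter.Tendsto (fun r : ℝ => ∑' m, bandCoeff m * r ^ (2 * m))
      (nhdsWithin 1 (Set.Iio 1)) (nhds (∑' m, bandCoeff m)) := by
    refine tendsto_tsum_of_dominated_convergence (bound := fun m => |bandCoeff m|)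
      summable_bandCoeff.abs (fun m => ?_) ?_
    · have : Filter.Tendsto (fun r : ℝ => bandCoeff m * r ^ (2 * m)) (nhds 1)
          (nhds (bandCoeff m * 1 ^ (2 * m))) :=
        (continuous_const.mul (continuous_pow _)).tendsto 1
      rw [one_pow, mul_one] at this
      exact this.mono_left nhdsWithin_le_nhds
    · filter_upwards [hev] with r hr m
      rw [Real.norm_eq_abs, abs_mul, abs_pow, abs_of_pos hr.1]
      exact mul_le_of_le_one_right (abs_nonneg _) (pow_le_one₀ hr.1.le hr.2.le)
  have h2 : Filter.Tendsto (fun r : ℝ => ∑' m, bandCoeff m * r ^ (2 * m))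
      (nhdsWithin 1 (Set.Iio 1)) (nhds (torusMean fun x y => Real.sqrt (1 + bandW x y))) := by
    have hlim : Filter.Tendsto (fun r : ℝ => Real.sqrt (1 - r)) (nhdsWithin 1 (Set.Iio 1))
        (nhds 0) := by
      have : Filter.Tendsto (fun r : ℝ => Real.sqrt (1 - r)) (nhds 1) (nhds (Real.sqrt (1 - 1))) :=
        (Real.continuous_sqrt.comp (continuous_const.sub continuous_id)).tendsto 1
      rw [sub_self, Real.sqrt_zero] at this
      exact this.mono_left nhdsWithin_le_nhds
    refine tendsto_iff_norm_sub_tendsto_zero.2 (squeeze_zero' (Filter.Eventually.of_forall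
      fun _ => norm_nonneg _) ?_ hlim)
    filter_upwards [hev] with r hr
    rw [(hasSum_torusMean_sqrt hr.1.le hr.2).tsum_eq, Real.norm_eq_abs, ← torusMean_sub]
    · refine abs_torusMean_le fun x y => ?_
      have hw := abs_le.1 (abs_bandW_le x y)
      have hd : 0 ≤ 1 - r := by linarith [hr.2]
      have e1 := sqrt_le_sqrt_add_sqrt (a := 1 + r * bandW x y) (b := 1 + bandW x y) (d := 1 - r)
        (by nlinarith [hw.1, hw.2]) (by linarith [hw.1]) hd
      have e2 := sqrt_le_sqrt_add_sqrt (a := 1 + bandW x y) (b := 1 + r * bandW x y) (d := 1 - r)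
        (by nlinarith [hw.1, hw.2]) (by nlinarith [hw.1, hw.2, hr.1, hr.2]) hd
      rw [abs_le]
      constructor <;> linarith
    · exact Real.continuous_sqrt.comp (continuous_const.add (continuous_const.mul continuous_bandW))
    · exact Real.continuous_sqrt.comp (continuous_const.add continuous_bandW)
  rw [tendsto_nhds_unique h2 h1]
  exact summable_bandCoeff.hasSum

/-- Partial sums of the series of the fermionic energy with an approximation to the remainder. -/
def bandPartial (b : ℝ) (K : ℕ) : ℝ :=
  ∑ m ∈ Finset.range K, bandCoeff m + bandCoeff K * (2 * K / 3 + b)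

/-- The coefficients are O(1/K²), so the correction linear in K vanishes in the limit. Its slope 2/3
matches the tail of a series decaying like K^(-5/2). -/
theorem tendsto_bandPartial (b : ℝ) : Filter.Tendsto (bandPartial b) Filter.atTop
    (nhds (torusMean fun x y => Real.sqrt (1 + bandW x y))) := by
  have h1 := hasSum_bandCoeff.tendsto_sum_nat
  have h2 : Filter.Tendsto (fun K : ℕ => bandCoeff K * (2 * K / 3 + b)) Filter.atTop (nhds 0) := by
    rw [← Filter.tendsto_add_atTop_iff_nat 1]
    have hlim : Filter.Tendsto (fun K : ℕ => 1 / 32 * (1 + |b|) * (1 / ((K : ℝ) + 1))) Filter.atTop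
        (nhds (1 / 32 * (1 + |b|) * 0)) :=
      tendsto_one_div_add_atTop_nhds_zero_nat.const_mul _
    rw [mul_zero] at hlim
    refine squeeze_zero_norm (fun K => ?_) hlim
    obtain ⟨h3, h4⟩ := bandCoeff_succ_neg K
    have hK : (0 : ℝ) < K + 1 := by positivity
    rw [Real.norm_eq_abs, abs_mul, abs_of_neg h3, mul_one_div, le_div_iff₀ hK]
    have h5 : |2 * ((K + 1 : ℕ) : ℝ) / 3 + b| ≤ (1 + |b|) * (K + 1) := by
      push_cast
      have hb := abs_nonneg b
      have hK0 : (0 : ℝ) ≤ K := K.cast_nonneg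
      have hbK := mul_nonneg hb hK0
      have hb2 := abs_le.1 (le_refl |b|)
      rw [abs_le]
      constructor <;> nlinarith [hb2.1, hb2.2]
    have h6 : -bandCoeff (K + 1) * |2 * ((K + 1 : ℕ) : ℝ) / 3 + b| ≤
        -bandCoeff (K + 1) * ((1 + |b|) * (K + 1)) := mul_le_mul_of_nonneg_left h5 (by linarith)
    calc -bandCoeff (K + 1) * |2 * ((K + 1 : ℕ) : ℝ) / 3 + b| * (K + 1) ≤
        -bandCoeff (K + 1) * ((1 + |b|) * (K + 1)) * (K + 1) :=
          mul_le_mul_of_nonneg_right h6 hK.le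
      _ = (-bandCoeff (K + 1) * ((K : ℝ) + 1) ^ 2) * (1 + |b|) := by ring
      _ ≤ 1 / 32 * (1 + |b|) := mul_le_mul_of_nonneg_right h4 (by positivity)
  have := h1.add h2
  rwa [add_zero] at this

theorem bandPartial_succ_sub (b : ℝ) (K : ℕ) : bandPartial b (K + 1) - bandPartial b K =
    bandCoeff K / (32 * ((K : ℝ) + 1) ^ 3) * ((16 * (K : ℝ) ^ 2 - 1) * (2 * K + 1) *
      (2 * (K + 1) / 3 + b) - 32 * (K + 1) ^ 3 * (2 * K / 3 + b - 1)) := by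
  rw [bandPartial, bandPartial, Finset.sum_range_succ, bandCoeff]
  have : (K : ℝ) + 1 ≠ 0 := by positivity
  push_cast
  field_simp
  ring

/-- In `bandPartial_succ_sub` the powers K⁴ and K³ cancel for every b, and the coefficient 124/3 -
80b of K² vanishes for b = 31/60. What is left is positive and multiplies a negative coefficient, so
the sequence decreases to its limit. -/
theorem torusMean_le_bandPartial (M : ℕ) (hM : 1 ≤ M) :
    (torusMean fun x y => Real.sqrt (1 + bandW x y)) ≤ bandPartial (31 / 60) M := by
  have hanti : ∀ K, M ≤ K → bandPartial (31 / 60) (K + 1) ≤ bandPartial (31 / 60) K := by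
    intro K hK
    obtain ⟨k, rfl⟩ := Nat.exists_eq_add_of_le' (hM.trans hK)
    rw [← sub_nonpos, bandPartial_succ_sub]
    refine mul_nonpos_of_nonpos_of_nonneg (div_nonpos_of_nonpos_of_nonneg
      (bandCoeff_succ_neg k).1.le (by positivity)) ?_
    push_cast
    have hk : (0 : ℝ) ≤ k := k.cast_nonneg
    nlinarith
  refine le_of_tendsto (tendsto_bandPartial (31 / 60)) ?_
  filter_upwards [Filter.eventually_ge_atTop M] with K hK
  induction K, hK using Nat.le_induction with
  | base => exact le_rfl
  | succ K hK ih => exact (hanti K hK).trans ih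

/-- For b = 7/12 the leading coefficient 124/3 - 80b is negative and the polynomial is nonpositive
from K = 4 on, so the sequence increases to its limit. -/
theorem bandPartial_le_torusMean (M : ℕ) (hM : 4 ≤ M) :
    bandPartial (7 / 12) M ≤ torusMean fun x y => Real.sqrt (1 + bandW x y) := by
  have hmono : ∀ K, M ≤ K → bandPartial (7 / 12) K ≤ bandPartial (7 / 12) (K + 1) := by
    intro K hK
    obtain ⟨k, rfl⟩ := Nat.exists_eq_add_of_le' (hM.trans hK)
    rw [← sub_nonneg, bandPartial_succ_sub]
    refine mul_nonneg_of_nonpos_of_nonpos (div_nonpos_of_nonpos_of_nonneg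
      (bandCoeff_succ_neg (k + 3)).1.le (by positivity)) ?_
    push_cast
    have hk : (0 : ℝ) ≤ k := k.cast_nonneg
    nlinarith
  refine ge_of_tendsto (tendsto_bandPartial (7 / 12)) ?_
  filter_upwards [Filter.eventually_ge_atTop M] with K hK
  induction K, hK using Nat.le_induction with
  | base => exact le_rfl
  | succ K hK ih => exact ih.trans (hmono K hK)

/-- The two enclosing values differ by -a/15 with a the coefficient of index 24, because 7/12 -
31/60 = 1/15; at this index the gap is within 10⁻⁶. -/
theorem bandPartial_bounds :
    bandPartial (31 / 60) 24 ≤ 0.9580915 ∧ 0.9580905 ≤ bandPartial (7 / 12) 24 := by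
  simp only [bandPartial, Finset.sum_range_succ, Finset.sum_range_zero, bandCoeff]
  norm_num

theorem abs_fermionLimit_le : |fermionLimit - (-0.958091)| ≤ 0.0000005 := by
  have h : fermionLimit = -torusMean fun x y => Real.sqrt (1 + bandW x y) := by
    rw [fermionLimit_eq]
    have : ∀ x y, Real.sqrt (bandSq x y) = 2 * Real.sqrt (1 + bandW x y) := fun x y => by
      rw [bandSq_eq, Real.sqrt_mul (by norm_num), Real.sqrt_sq (by norm_num)]
    simp only [torusMean, this, circleMean_const_mul]
    ring
  have h1 := torusMean_le_bandPartial 24 (by norm_num)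
  have h2 := bandPartial_le_torusMean 24 (by norm_num)
  obtain ⟨h3, h4⟩ := bandPartial_bounds
  rw [h, abs_le]
  norm_num at h3 h4 ⊢
  constructor <;> linarith

end PiFlux

end

theorem mainTheorem2 :
    -- Anderson bound for hard-core bosons, on every finite torus
    (∀ (Lx Ly : ℕ) [NeZero Lx] [NeZero Ly], 4 ≤ Lx → 4 ≤ Ly → Even Lx → Even Ly →
      ∀ t : PiFlux.Site Lx Ly → PiFlux.Site Lx Ly → ℝ, PiFlux.IsPiFlux t →
        4 * (PiFlux.centres Lx Ly).card = Lx * Ly ∧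
        (∀ a ∈ PiFlux.centres Lx Ly, (PiFlux.crossSites a).card = 12) ∧
        PiFlux.bosonHamiltonian t 0 =
          ∑ a ∈ PiFlux.centres Lx Ly, PiFlux.crossHamiltonian t a ∧
        ∑ a ∈ PiFlux.centres Lx Ly, PiFlux.groundEnergy (PiFlux.crossHamiltonian t a) ≤
          PiFlux.bosonEnergy t ∧
        (∀ a ∈ PiFlux.centres Lx Ly,
          |PiFlux.groundEnergy (PiFlux.crossHamiltonian t a) - (-3.609035)| ≤ 0.0000005) ∧
        -0.902259 ≤ PiFlux.bosonEnergy t / ((Lx : ℝ) * (Ly : ℝ))) ∧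
    -- the energy per site of free fermions in the thermodynamic limit, and its value
    (∀ ε : ℝ, 0 < ε → ∃ L₀ : ℕ, ∀ (Lx Ly : ℕ) [NeZero Lx] [NeZero Ly],
      L₀ ≤ Lx → L₀ ≤ Ly → Even Lx → Even Ly →
      ∀ t : PiFlux.Site Lx Ly → PiFlux.Site Lx Ly → ℝ, PiFlux.IsPiFlux t →
        |PiFlux.fermionEnergy t / ((Lx : ℝ) * (Ly : ℝ)) - PiFlux.fermionLimit| < ε) ∧
    |PiFlux.fermionLimit - (-0.958091)| ≤ 0.0000005 ∧
    -- strict inversion of the energies per site, surviving the thermodynamic limit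
    (∃ δ : ℝ, 0 < δ ∧ ∃ L₀ : ℕ, ∀ (Lx Ly : ℕ) [NeZero Lx] [NeZero Ly],
      L₀ ≤ Lx → L₀ ≤ Ly → Even Lx → Even Ly →
      ∀ t : PiFlux.Site Lx Ly → PiFlux.Site Lx Ly → ℝ, PiFlux.IsPiFlux t →
        PiFlux.fermionEnergy t / ((Lx : ℝ) * (Ly : ℝ)) + δ ≤
          PiFlux.bosonEnergy t / ((Lx : ℝ) * (Ly : ℝ))) := by
  refine ⟨fun Lx Ly _ _ hx hy hxe hye t ht => ⟨PiFlux.four_mul_card_centres hxe hye,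
    fun a _ => PiFlux.card_crossSites hx hy a, PiFlux.bosonHamiltonian_eq_sum_cross ht hx hy hxe hye,
    PiFlux.sum_groundEnergy_cross_le ht hx hy hxe hye,
    fun a _ => PiFlux.abs_groundEnergy_cross_le ht hx hy a,
    PiFlux.le_bosonEnergy_div ht hx hy hxe hye⟩, fun ε hε => ?_, PiFlux.abs_fermionLimit_le,
    1 / 20, by norm_num, ?_⟩
  · obtain ⟨L₀, h⟩ := PiFlux.tendsto_fermionEnergy ε hε
    exact ⟨L₀, fun Lx Ly _ _ hx hy _ _ t ht => h Lx Ly hx hy t ht⟩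
  -- The two numbers are about 0.0558 apart, which covers 1/20 plus the tolerance 1/200 for the
  -- finite fermionic system.
  · obtain ⟨L₀, h⟩ := PiFlux.tendsto_fermionEnergy (1 / 200) (by norm_num)
    refine ⟨max L₀ 4, fun Lx Ly _ _ hx hy hxe hye t ht => ?_⟩
    have h1 := (abs_lt.1 (h Lx Ly (le_of_max_le_left hx) (le_of_max_le_left hy) t ht)).2
    have h2 := PiFlux.le_bosonEnergy_div ht (le_of_max_le_right hx) (le_of_max_le_right hy) hxe hye
    have h3 := (abs_le.1 PiFlux.abs_fermionLimit_le).2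
    norm_num at h2 h3
    linarith
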